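/- Consider the restricted Min-Max allocation (makespan) problem: there are $m$ machines and $n\ge 1$ jobs $J_1,\dots,J_n$, a bipartite graph $H$ between machines and jobs, and processing times $p_1,\dots,p_n\in\mathbb{Q}_{>0}$; job $J_j$ takes $p_j$ units of time on each machine adjacent to it in $H$ and cannot be executed on other machines, and every job is adjacent to at least one machine. A feasible assignment assigns every job to a machine adjacent to it; its makespan is the maximum over the machines of the total processing time of the jobs assigned to the machine, and it is to be minimized. The instance is on an inclusion-free convex graph: the jobs are given in an order $J_1,\dots,J_n$ such that the neighbourhood $N(M)$ of every machine $M$ consists of consecutive jobs, and whenever $N(M)\subseteq N(M')$ for machines $M,M'$, the jobs of $N(M')\setminus N(M)$ are consecutive. For every integer $k\ge 4$ there are an integer $C\ge 0$ with $C\le k^{1.4}$ and $C\le\left\lceil \log k/\log(1+\tfrac1k)\right\rceil$, and an algorithm that, on every such instance, computes a feasible assignment whose makespan is at most $1+\frac4k+\frac3{k^2}$ times the optimal one, in time $O\big((m+n)\,m\,n^{2(C+1)}\big)$, where the constant depends only on $k$. Consequently the problem has a PTAS: for every $\varepsilon>0$ there is an algorithm that computes on every such instance, in time polynomial in $m+n$,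 a feasible assignment whose makespan is at most $1+\varepsilon$ times the optimal one. Here time is the number of steps of a random access machine that adds, subtracts, compares and scales by fixed constants stored rational numbers at unit cost, that adds, subtracts and compares stored natural numbers and uses them as addresses at unit cost, and that has no multiplication of two stored numbers. -/

import Mathlib

/-! ### A unit-cost random access machine with structured programs

The memory has finitely many named arrays in use: arrays of natural numbers (for indices and
control) and arrays of rational numbers (for processing times).  Stored numbers can be added,
subtracted, compared and scaled by constants written in the program; there is no multiplication
of two stored numbers, so a computation of `t` steps only increases bit lengths by `O(t)`
and the model is polynomially equivalent to Turing machines. -/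

namespace RAM

/-- A memory content: `idx a i` is cell `i` of the array `a` of natural numbers, `val a i` is
cell `i` of the array `a` of rational numbers. -/
structure State where
  idx : ℕ → ℕ → ℕ
  val : ℕ → ℕ → ℚ

/-- Index expressions; `get a e` is the content of the cell of the array `a` whose position is
the value of `e` (so nested `get`s are indirect addressing), `sub` is truncated subtraction. -/
inductive NExp where
  | const (c : ℕ)
  | get (a : ℕ) (e : NExp)
  | add (e f : NExp)
  | sub (e f : NExp)

/-- Rational expressions. -/
inductive QExp where
  | const (c : ℚ)
  | get (a : ℕ) (e : NExp)
  | add (e f : QExp)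
  | sub (e f : QExp)
  | scale (c : ℚ) (e : QExp)

/-- Tests. -/
inductive BExp where
  | leN (e f : NExp)
  | leQ (e f : QExp)

/-- Programs. -/
inductive Cmd where
  | skip
  | setN (a : ℕ) (e f : NExp)
  | setQ (a : ℕ) (e : NExp) (f : QExp)
  | seq (c d : Cmd)
  | cond (b : BExp) (c d : Cmd)
  | loop (b : BExp) (c : Cmd)

namespace NExp

/-- The value of an index expression. -/
def eval (s : State) : NExp → ℕ
  | const c => c
  | get a e => s.idx a (e.eval s)
  | add e f => e.eval s + f.eval s
  | sub e f => e.eval s - f.eval s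

/-- Evaluating an expression takes one step for each of its nodes. -/
def cost : NExp → ℕ
  | const _ => 1
  | get _ e => e.cost + 1
  | add e f => e.cost + f.cost + 1
  | sub e f => e.cost + f.cost + 1

end NExp

namespace QExp

/-- The value of a rational expression. -/
def eval (s : State) : QExp → ℚ
  | const c => c
  | get a e => s.val a (e.eval s)
  | add e f => e.eval s + f.eval s
  | sub e f => e.eval s - f.eval s
  | scale c e => c * e.eval s

/-- Evaluating an expression takes one step for each of its nodes. -/
def cost : QExp → ℕ
  | const _ => 1
  | get _ e => e.cost + 1
  | add e f => e.cost + f.cost + 1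
  | sub e f => e.cost + f.cost + 1
  | scale _ e => e.cost + 1

end QExp

namespace BExp

/-- The truth value of a test. -/
def Holds (s : State) : BExp → Prop
  | leN e f => e.eval s ≤ f.eval s
  | leQ e f => e.eval s ≤ f.eval s

/-- A test takes one step in addition to the evaluation of its two sides. -/
def cost : BExp → ℕ
  | leN e f => e.cost + f.cost + 1
  | leQ e f => e.cost + f.cost + 1

end BExp

namespace State

/-- Write `v` to cell `i` of the index array `a`. -/
def setN (s : State) (a i v : ℕ) : State where
  idx := Function.update s.idx a (Function.update (s.idx a) i v)
  val := s.val

/-- Write `v` to cell `i` of the rational array `a`. -/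
def setQ (s : State) (a i : ℕ) (v : ℚ) : State where
  idx := s.idx
  val := Function.update s.val a (Function.update (s.val a) i v)

end State

/-- `Exec c s t s'`: the program `c`, started in the memory `s`, halts after exactly `t` steps with
the memory `s'`. -/
inductive Exec : Cmd → State → ℕ → State → Prop where
  | skip (s : State) : Exec Cmd.skip s 1 s
  | setN (a : ℕ) (e f : NExp) (s : State) :
      Exec (Cmd.setN a e f) s (e.cost + f.cost + 1) (s.setN a (e.eval s) (f.eval s))
  | setQ (a : ℕ) (e : NExp) (f : QExp) (s : State) :
      Exec (Cmd.setQ a e f) s (e.cost + f.cost + 1) (s.setQ a (e.eval s) (f.eval s))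
  | seq {c d : Cmd} {s s' s'' : State} {t t' : ℕ} :
      Exec c s t s' → Exec d s' t' s'' → Exec (Cmd.seq c d) s (t + t') s''
  | condTrue {b : BExp} {c d : Cmd} {s s' : State} {t : ℕ} :
      b.Holds s → Exec c s t s' → Exec (Cmd.cond b c d) s (b.cost + t) s'
  | condFalse {b : BExp} {c d : Cmd} {s s' : State} {t : ℕ} :
      ¬ b.Holds s → Exec d s t s' → Exec (Cmd.cond b c d) s (b.cost + t) s'
  | loopTrue {b : BExp} {c : Cmd} {s s' s'' : State} {t t' : ℕ} :
      b.Holds s → Exec c s t s' → Exec (Cmd.loop b c) s' t' s'' →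
      Exec (Cmd.loop b c) s (b.cost + t + t') s''
  | loopFalse {b : BExp} {c : Cmd} {s : State} :
      ¬ b.Holds s → Exec (Cmd.loop b c) s b.cost s

end RAM

/-! ### The restricted min-max allocation problem

`m` machines, `n` jobs in a given order; `E i j = true` if machine `i` can execute job `j`; job `j`
has processing time `p j` on every machine that can execute it. -/

namespace MinMax

/-- The set of the jobs that machine `i` can execute. -/
def nbhd {m n : ℕ} (E : Fin m → Fin n → Bool) (i : Fin m) : Set (Fin n) :=
  {j | E i j = true}

/-- The neighbourhood of each machine consists of consecutive jobs. -/
def AdjacencyProperty {m n : ℕ} (E : Fin m → Fin n → Bool) : Prop :=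
  ∀ i, (nbhd E i).OrdConnected

/-- Whenever one neighbourhood contains another one, their difference consists of
consecutive jobs. -/
def EnclosureProperty {m n : ℕ} (E : Fin m → Fin n → Bool) : Prop :=
  ∀ i i', nbhd E i ⊆ nbhd E i' → (nbhd E i' \ nbhd E i).OrdConnected

/-- An instance on an inclusion-free convex graph: at least one job, positive processing
times, every job can be executed on some machine, and the order of the jobs has the adjacency and the
enclosure property. -/
structure IsInstance {m n : ℕ} (E : Fin m → Fin n → Bool) (p : Fin n → ℚ) : Prop where
  jobs_pos : 0 < n
  time_pos : ∀ j, 0 < p j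
  executable : ∀ j, ∃ i, E i j = true
  adjacency : AdjacencyProperty E
  enclosure : EnclosureProperty E

/-- A feasible assignment: every job is assigned to a machine that can execute it. -/
def IsFeasible {m n : ℕ} (E : Fin m → Fin n → Bool) (a : Fin n → Fin m) : Prop :=
  ∀ j, E (a j) j = true

/-- The makespan: the maximum load of a machine. -/
noncomputable def makespan {m n : ℕ} (p : Fin n → ℚ) (a : Fin n → Fin m) : ℝ :=
  ⨆ i : Fin m, ∑ j with a j = i, (p j : ℝ)

/-- The initial memory: cells 0 and 1 of index array 0 hold `m` and `n`, index array 1 holds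
the `m × n` adjacency matrix row by row, rational array 0 holds the processing times, and
all other cells hold 0. -/
def input {m n : ℕ} (E : Fin m → Fin n → Bool) (p : Fin n → ℚ) : RAM.State where
  idx a x :=
    if a = 0 then (if x = 0 then m else if x = 1 then n else 0)
    else if a = 1 then (if ∃ i : Fin m, ∃ j : Fin n, x = i * n + j ∧ E i j = true then 1 else 0)
    else 0
  val a x := if h : a = 0 ∧ x < n then p ⟨x, h.2⟩ else 0

/-- In the memory `s` index array 2 holds the assignment `a`: cell `j` is the machine of job `j`. -/
def IsOutput {m n : ℕ} (s : RAM.State) (a : Fin n → Fin m) : Prop :=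
  ∀ j : Fin n, s.idx 2 j = a j

/-- On every instance with `m` machines and `n` jobs the program `P` halts within `T m n` steps and
outputs a feasible assignment whose makespan is at most `ρ` times the optimal one. -/
def IsApproxAlgorithm (P : RAM.Cmd) (ρ : ℝ) (T : ℕ → ℕ → ℕ) : Prop :=
  ∀ (m n : ℕ) (E : Fin m → Fin n → Bool) (p : Fin n → ℚ), IsInstance E p →
    ∃ (t : ℕ) (s : RAM.State) (a : Fin n → Fin m),
      RAM.Exec P (input E p) t s ∧ t ≤ T m n ∧ IsOutput s a ∧ IsFeasible E a ∧
      ∀ b : Fin n → Fin m, IsFeasible E b → makespan p a ≤ ρ * makespan p b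

end MinMax

/-! Fix a guess `T` for the optimum. A job of size at most `T / k` is small (class 0). The other
jobs fall into `C` classes within which sizes differ by a factor of at most `1 + 2 / k`; as `(1 + 2
/ k) ^ C ≥ k`, these classes reach up to `T`. By the enclosure property, sorting the machines with
nonempty interval `L ≤ j < R` by `L + R` sorts both ends simultaneously (`Inst.sorted`).

Let `b` be an assignment with loads at most `T`. Within each class it can be rearranged so that the
machines, in this order, receive consecutive blocks of the class. The blocks end at cuts: for a set
`P` of first machines, the cut is the first position below which the class weighs as much as `b`
puts on `P`. Small jobs are weighed by size, and a block overshoots by at most one job, that is, by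
`T / k`. Large jobs are counted, so a block has no more jobs than before, each larger by a factor of
at most `1 + 2 / k`. Hence the new loads are at most `(1 + 3 / k) * T` (`load_between_cuts`). The
blocks respect the graph because the machines are sorted (`mem_of_between_cuts`).

A rearranged assignment is a monotone path of position vectors, one position in `0, …, n` for each
of the `C + 1` classes. There are `(n + 1) ^ (C + 1)` vectors, coded in base `n + 1`. A dynamic
program keeps for each code a small load of the current machine together with a partial assignment
witnessing it. Every finite entry is witnessed (`Data.solve_sound`), and the path of the cuts keeps
its entries finite (`Data.solve_complete`), so a failure proves that no assignment has loads at most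
`T`.

The guess starts at the largest processing time, a lower bound for the optimum, and grows by `1 / k`
of it after each failure. The first success has `T ≤ (1 + 1 / k) * OPT`, after at most `(k + 1) * n`
attempts (`runs_searchCmd`), and `(1 + 3 / k) * (1 + 1 / k) = 1 + 4 / k + 3 / k ^ 2`. The total time
is `O(m * n ^ (C + 4))`, within the claimed bound once `C ≥ 1`. The estimate `C ≤ k ^ 1.4` is
`numClasses_le_rpow`.

The programs are verified by a Hoare logic with time bounds: each command is shown to transform the
memory as the corresponding function transforms abstract tables. -/

/-! ### Bounded-time Hoare logic for the random access machine -/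

namespace RAM

/-- The program `c`, started in `s`, halts within `t` steps in a memory satisfying `Q`. -/
def Runs (c : Cmd) (s : State) (t : ℕ) (Q : State → Prop) : Prop :=
  ∃ t' s', Exec c s t' s' ∧ t' ≤ t ∧ Q s'

theorem Runs.mono {c : Cmd} {s : State} {t t' : ℕ} {Q Q' : State → Prop} (h : Runs c s t Q)
    (ht : t ≤ t') (hQ : ∀ s', Q s' → Q' s') : Runs c s t' Q' := by
  obtain ⟨u, s', he, hu, hq⟩ := h
  exact ⟨u, s', he, hu.trans ht, hQ _ hq⟩

theorem Runs.le {c : Cmd} {s : State} {t t' : ℕ} {Q : State → Prop} (h : Runs c s t Q)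
    (ht : t ≤ t') : Runs c s t' Q :=
  h.mono ht fun _ hq => hq

theorem Runs.skip {s : State} {Q : State → Prop} (h : Q s) : Runs Cmd.skip s 1 Q :=
  ⟨1, s, Exec.skip s, le_rfl, h⟩

theorem Runs.setN {a : ℕ} {e f : NExp} {s : State} {Q : State → Prop}
    (h : Q (s.setN a (e.eval s) (f.eval s))) :
    Runs (Cmd.setN a e f) s (e.cost + f.cost + 1) Q :=
  ⟨_, _, Exec.setN a e f s, le_rfl, h⟩

theorem Runs.setQ {a : ℕ} {e : NExp} {f : QExp} {s : State} {Q : State → Prop}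
    (h : Q (s.setQ a (e.eval s) (f.eval s))) :
    Runs (Cmd.setQ a e f) s (e.cost + f.cost + 1) Q :=
  ⟨_, _, Exec.setQ a e f s, le_rfl, h⟩

theorem Runs.seq {c d : Cmd} {s : State} {t t' : ℕ} {Q : State → Prop}
    (h : Runs c s t (fun s' => Runs d s' t' Q)) : Runs (Cmd.seq c d) s (t + t') Q := by
  obtain ⟨u, s', he, hu, u', s'', he', hu', hq⟩ := h
  exact ⟨_, _, Exec.seq he he', by omega, hq⟩

theorem Runs.cond {b : BExp} {c d : Cmd} {s : State} {t t' : ℕ} {Q : State → Prop}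
    (h₁ : b.Holds s → Runs c s t Q) (h₂ : ¬ b.Holds s → Runs d s t' Q) :
    Runs (Cmd.cond b c d) s (b.cost + max t t') Q := by
  by_cases hb : b.Holds s
  · obtain ⟨u, s', he, hu, hq⟩ := h₁ hb
    exact ⟨_, _, Exec.condTrue hb he, by omega, hq⟩
  · obtain ⟨u, s', he, hu, hq⟩ := h₂ hb
    exact ⟨_, _, Exec.condFalse hb he, by omega, hq⟩

/-- A loop whose invariant counts the iterations and bounds their number by `G`. -/
theorem Runs.loop {b : BExp} {c : Cmd} {t G : ℕ} {Q : State → Prop} (I : ℕ → State → Prop)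
    (hG : ∀ g s, I g s → b.Holds s → g < G)
    (hstep : ∀ g s, I g s → b.Holds s → Runs c s t (I (g + 1)))
    (hQ : ∀ g s, I g s → ¬ b.Holds s → Q s) {s : State} (h0 : I 0 s) :
    Runs (Cmd.loop b c) s (G * (b.cost + t) + b.cost) Q := by
  -- The induction is on a bound `d` for the number of iterations still to come.
  have key : ∀ d g s, I g s → G - g ≤ d →
      Runs (Cmd.loop b c) s (d * (b.cost + t) + b.cost) Q := by
    intro d
    induction d with
    | zero =>
      intro g s hI hd
      have hb : ¬ b.Holds s := fun hb => by have := hG g s hI hb; omega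
      exact ⟨_, _, Exec.loopFalse hb, by omega, hQ g s hI hb⟩
    | succ d ih =>
      intro g s hI hd
      by_cases hb : b.Holds s
      · obtain ⟨u, s', he, hu, hq⟩ := hstep g s hI hb
        obtain ⟨u', s'', he', hu', hq'⟩ := ih (g + 1) s' hq (by omega)
        refine ⟨_, _, Exec.loopTrue hb he he', ?_, hq'⟩
        rw [Nat.succ_mul]; omega
      · exact ⟨_, _, Exec.loopFalse hb, by omega, hQ g s hI hb⟩
  exact key G 0 s h0 (by omega)

/-! ### Frame conditions and counting loops -/

/-- The memories `s` and `s'` agree on all arrays whose number satisfies `P`. -/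
def Agree (P : ℕ → Prop) (s s' : State) : Prop :=
  ∀ a, P a → s'.idx a = s.idx a ∧ s'.val a = s.val a

namespace Agree

variable {P P' : ℕ → Prop} {s s' s'' : State}

theorem refl (P : ℕ → Prop) (s : State) : Agree P s s := fun _ _ => ⟨rfl, rfl⟩

theorem trans (h : Agree P s s') (h' : Agree P s' s'') : Agree P s s'' := fun a ha =>
  ⟨(h' a ha).1.trans (h a ha).1, (h' a ha).2.trans (h a ha).2⟩

theorem mono (h : Agree P s s') (hP : ∀ a, P' a → P a) : Agree P' s s' := fun a ha => h a (hP a ha)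

theorem idx (h : Agree P s s') {a : ℕ} (ha : P a) : s'.idx a = s.idx a := (h a ha).1

theorem val (h : Agree P s s') {a : ℕ} (ha : P a) : s'.val a = s.val a := (h a ha).2

theorem setN (h : Agree P s s') {a i v : ℕ} (ha : ¬ P a) : Agree P s (s'.setN a i v) := by
  intro b hb
  have : b ≠ a := fun e => ha (e ▸ hb)
  exact ⟨by simpa [State.setN, Function.update_of_ne this] using (h b hb).1, (h b hb).2⟩

theorem setQ (h : Agree P s s') {a i : ℕ} {v : ℚ} (ha : ¬ P a) : Agree P s (s'.setQ a i v) := by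
  intro b hb
  have : b ≠ a := fun e => ha (e ▸ hb)
  exact ⟨(h b hb).1, by simpa [State.setQ, Function.update_of_ne this] using (h b hb).2⟩

end Agree

namespace State

@[simp] theorem setN_idx (s : State) (a i v b j : ℕ) :
    (s.setN a i v).idx b j = if b = a ∧ j = i then v else s.idx b j := by
  by_cases h : b = a
  · subst h; simp [setN, Function.update_apply]
  · simp [setN, h]

@[simp] theorem setN_val (s : State) (a i v : ℕ) : (s.setN a i v).val = s.val := rfl

@[simp] theorem setQ_val (s : State) (a i : ℕ) (v : ℚ) (b j : ℕ) :
    (s.setQ a i v).val b j = if b = a ∧ j = i then v else s.val b j := by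
  by_cases h : b = a
  · subst h; simp [setQ, Function.update_apply]
  · simp [setQ, h]

@[simp] theorem setQ_idx (s : State) (a i : ℕ) (v : ℚ) : (s.setQ a i v).idx = s.idx := rfl

end State

/-- The scalar variable stored in cell 0 of the index array `a`. -/
abbrev NExp.var (a : ℕ) : NExp := NExp.get a (NExp.const 0)

/-- Run `c` with the variable `a` counting from 0 up to the value of `b` (exclusively). -/
def Cmd.forTo (a : ℕ) (b : NExp) (c : Cmd) : Cmd :=
  Cmd.seq (Cmd.setN a (NExp.const 0) (NExp.const 0))
    (Cmd.loop (BExp.leN (NExp.add (NExp.var a) (NExp.const 1)) b)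
      (Cmd.seq c (Cmd.setN a (NExp.const 0) (NExp.add (NExp.var a) (NExp.const 1)))))

/-- The invariant `J` of a counting loop whose body and bound respect the arrays in `P`. -/
theorem Runs.forTo {a : ℕ} {b : NExp} {c : Cmd} {s : State} {t N : ℕ} (P : ℕ → Prop)
    (J : ℕ → State → Prop) (ha : ¬ P a)
    (hJ : ∀ i s' x, J i s' → J i (s'.setN a 0 x))
    (hb : ∀ s', Agree P s s' → b.eval s' = N) (h0 : J 0 s)
    (hstep : ∀ i s', i < N → Agree P s s' → s'.idx a 0 = i → J i s' →
      Runs c s' t (fun s'' => Agree P s' s'' ∧ s''.idx a 0 = i ∧ J (i + 1) s'')) :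
    Runs (Cmd.forTo a b c) s ((N + 1) * (t + b.cost + 11))
      (fun s' => Agree P s s' ∧ J N s') := by
  -- A test costs `b.cost + 5` steps and an increment of the counter 6. The extra round in the bound
  -- pays for the last test and the initialization.
  refine Runs.le (Runs.seq (t' := N * ((b.cost + 5) + (t + 6)) + (b.cost + 5))
    (Runs.setN ?_)) ?_
  · refine Runs.le (Runs.loop (G := N) (t := t + 6)
      (fun g s' => g ≤ N ∧ Agree P s s' ∧ s'.idx a 0 = g ∧ J g s') ?_ ?_ ?_ ?_) ?_
    · rintro g s' ⟨-, h1, h2, -⟩ hh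
      simp only [BExp.Holds, NExp.eval, hb _ h1, h2] at hh
      omega
    · rintro g s' ⟨-, h1, h2, h3⟩ hh
      simp only [BExp.Holds, NExp.eval, hb _ h1, h2] at hh
      refine Runs.seq (t' := 6) (Runs.mono (hstep g s' (by omega) h1 h2 h3) le_rfl ?_)
      rintro s'' ⟨k1, k2, k3⟩
      refine Runs.le (Runs.setN ?_) (by simp [NExp.cost])
      refine ⟨by omega, (h1.trans k1).setN ha, by simp [NExp.eval, k2], hJ _ _ _ k3⟩
    · rintro g s' ⟨h0, h1, h2, h3⟩ hh
      simp only [BExp.Holds, NExp.eval, hb _ h1, h2] at hh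
      obtain rfl : g = N := by omega
      exact ⟨h1, h3⟩
    · exact ⟨by omega, (Agree.refl P s).setN ha, by simp [NExp.eval], hJ _ _ _ h0⟩
    · simp only [BExp.cost, NExp.cost]
      apply le_of_eq; ring
  · simp only [NExp.cost]
    nlinarith

end RAM

/-! ### The dynamic program on tables -/

namespace ConvexMakespan

/-! ### Codes of position vectors in base `n + 1` -/

/-- The `c`-th digit of `v` in base `n + 1`. -/
def pos (n c v : ℕ) : ℕ := v / (n + 1) ^ c % (n + 1)

theorem pos_le (n c v : ℕ) : pos n c v ≤ n :=
  Nat.lt_succ_iff.1 (Nat.mod_lt _ n.succ_pos)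

theorem pos_zero (n c : ℕ) : pos n c 0 = 0 := by simp [pos]

theorem div_pow_succ (n c v : ℕ) : v / (n + 1) ^ (c + 1) = v / (n + 1) ^ c / (n + 1) := by
  rw [pow_succ, Nat.div_div_eq_div_mul]

theorem add_pow_div (n c v : ℕ) : (v + (n + 1) ^ c) / (n + 1) ^ c = v / (n + 1) ^ c + 1 :=
  Nat.add_div_right _ (by positivity)

/-- A digit below `n` can be raised by one without a carry, so the higher digits do not change. -/
theorem add_pow_div_of_lt {n c c' v : ℕ} (h : pos n c v < n) (hc : c < c') :
    (v + (n + 1) ^ c) / (n + 1) ^ c' = v / (n + 1) ^ c' := by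
  induction c', hc using Nat.le_induction with
  | base =>
    rw [div_pow_succ, div_pow_succ, add_pow_div]
    unfold pos at h
    set q := v / (n + 1) ^ c
    rw [Nat.succ_div_of_not_dvd]
    intro hd
    have h1 := Nat.div_add_mod q (n + 1)
    obtain ⟨e, he⟩ := hd
    have h3 : (q + 1) % (n + 1) = q % (n + 1) + 1 := by
      rw [Nat.add_mod, Nat.mod_eq_of_lt (a := q % (n + 1) + 1 % (n + 1))] <;>
        rcases n with _ | n <;> simp_all
    rw [he] at h3
    simp at h3
  | succ c' _ ih => rw [div_pow_succ, ih, ← div_pow_succ]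

theorem pos_add_self {n c v : ℕ} (h : pos n c v < n) :
    pos n c (v + (n + 1) ^ c) = pos n c v + 1 := by
  unfold pos at *
  rw [add_pow_div, Nat.add_mod, Nat.mod_eq_of_lt (a := _ + 1 % (n + 1))] <;>
    rcases n with _ | n <;> simp_all

/-- The digit wraps around. This case never occurs in a relaxation; it is needed for tabulating the
digits of all codes. -/
theorem pos_add_self_of_eq {n c v : ℕ} (h : ¬ pos n c v < n) :
    pos n c (v + (n + 1) ^ c) = 0 := by
  have h' : pos n c v = n := le_antisymm (pos_le n c v) (not_lt.1 h)
  unfold pos at *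
  rw [add_pow_div, Nat.add_mod, h']
  rcases n with _ | n <;> simp

/-- Lower digits are unaffected because the stride is a multiple of a higher power of the base,
higher ones because there is no carry. Thus adding a stride moves exactly one coordinate of the
position vector. -/
theorem pos_add_of_ne {n c c' v : ℕ} (h : pos n c v < n) (hc : c' ≠ c) :
    pos n c' (v + (n + 1) ^ c) = pos n c' v := by
  rcases lt_or_gt_of_ne hc with hc | hc
  · unfold pos
    obtain ⟨d, rfl⟩ := Nat.exists_eq_add_of_lt hc
    have : (n + 1) ^ (c' + d + 1) = (n + 1) ^ c' * ((n + 1) * (n + 1) ^ d) := by ring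
    rw [this, Nat.add_mul_div_left _ _ (by positivity), Nat.add_mul_mod_self_left]
  · unfold pos
    rw [add_pow_div_of_lt h hc]

theorem add_pow_lt {n c c' v : ℕ} (h : pos n c v < n) (hc : c < c') (hv : v < (n + 1) ^ c') :
    v + (n + 1) ^ c < (n + 1) ^ c' := by
  have := add_pow_div_of_lt h hc
  rw [Nat.div_eq_of_lt hv] at this
  exact (Nat.div_eq_zero_iff_lt (by positivity)).1 this

theorem pos_of_lt {n c v : ℕ} (hv : v < (n + 1) ^ c) : pos n c v = 0 := by
  simp [pos, Nat.div_eq_of_lt hv]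

/-- Identifies the endpoint of the dynamic program: the vector with all positions equal to `n` has
the largest code. -/
theorem add_one_eq_of_pos_eq {n c v : ℕ} (hv : v < (n + 1) ^ c) (h : ∀ d < c, pos n d v = n) :
    v + 1 = (n + 1) ^ c := by
  have key : ∀ d ≤ c, v % (n + 1) ^ d + 1 = (n + 1) ^ d := by
    intro d
    induction d with
    | zero => intro _; simp [Nat.mod_one]
    | succ d ih =>
      intro hd
      rw [pow_succ, Nat.mod_mul]
      have h1 := ih (by omega)
      have h2 := h d (by omega)
      unfold pos at h2
      rw [h2]
      nlinarith
  simpa [Nat.mod_eq_of_lt hv] using key c le_rfl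

theorem pos_last (n : ℕ) {c C : ℕ} (h : c < C) : pos n c ((n + 1) ^ C - 1) = n := by
  have hv : (n + 1) ^ C - 1 < (n + 1) ^ C := Nat.sub_lt (by positivity) one_pos
  by_contra hne
  have := add_pow_lt (lt_of_le_of_ne (pos_le _ _ _) hne) h hv
  have : 0 < (n + 1) ^ c := by positivity
  omega

/-! ### Tables and relaxation steps -/

/-- Apply `f 0`, …, `f (q - 1)` in this order. -/
def iter {α : Type*} (f : ℕ → α → α) : ℕ → α → α
  | 0, x => x
  | q + 1, x => f q (iter f q x)

theorem iter_induction {α : Type*} {f : ℕ → α → α} (I : ℕ → α → Prop) {q : ℕ} {x : α}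
    (h0 : I 0 x) (h : ∀ i y, i < q → I i y → I (i + 1) (f i y)) : I q (iter f q x) := by
  induction q with
  | zero => exact h0
  | succ q ih => exact h q _ (by omega) (ih fun i y hi => h i y (by omega))

/-- A table: for every code `v` of a vector of positions, the load `D v` of the current machine and a
partial assignment `A v`. -/
structure Tab where
  D : ℕ → ℚ
  A : ℕ → ℕ → ℕ

/-- The data of the dynamic program: number of machines, of jobs, number of the last class,
processing times, classes of the jobs, bound for the loads, and the
machine `i` can execute the jobs `j` with `L i ≤ j < R i`. -/
structure Data where
  m : ℕ
  n : ℕ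
  C : ℕ
  p : ℕ → ℚ
  cls : ℕ → ℕ
  B : ℚ
  L : ℕ → ℕ
  R : ℕ → ℕ

namespace Data

variable (d : Data)

/-- The number of codes. -/
def V : ℕ := (d.n + 1) ^ (d.C + 1)

/-- Try to advance position `c` of `v` by one job on the machine `cur` with jobs `l ≤ j < r`. -/
def relax (cur l r c v : ℕ) (t : Tab) : Tab :=
  if t.D v ≤ d.B ∧ pos d.n c v < d.n then
    if d.cls (pos d.n c v) = c then
      if l ≤ pos d.n c v ∧ pos d.n c v < r ∧ t.D v + d.p (pos d.n c v) ≤ d.B ∧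
          t.D v + d.p (pos d.n c v) < t.D (v + (d.n + 1) ^ c) then
        ⟨Function.update t.D (v + (d.n + 1) ^ c) (t.D v + d.p (pos d.n c v)),
          Function.update t.A (v + (d.n + 1) ^ c)
            (Function.update (t.A v) (pos d.n c v) cur)⟩
      else t
    else if t.D v < t.D (v + (d.n + 1) ^ c) then
      ⟨Function.update t.D (v + (d.n + 1) ^ c) (t.D v),
        Function.update t.A (v + (d.n + 1) ^ c) (t.A v)⟩
    else t
  else t

/-- All steps on coordinate `c`. -/
def phase (cur l r c : ℕ) (t : Tab) : Tab := iter (d.relax cur l r c) d.V t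

/-- Start a new machine. -/
def resetAt (v : ℕ) (t : Tab) : Tab :=
  if t.D v ≤ d.B then ⟨Function.update t.D v 0, t.A⟩ else t

def reset (t : Tab) : Tab := iter d.resetAt d.V t

/-- Extend the partial assignments by jobs on the machine `cur`. -/
def process (cur l r : ℕ) (t : Tab) : Tab := iter (d.phase cur l r) (d.C + 1) (d.reset t)

/-- The machines `i` with `L i + R i = s`. -/
def sweepKey (s : ℕ) (t : Tab) : Tab :=
  iter (fun i t => if d.L i + d.R i = s then d.process i (d.L i) (d.R i) t else t) d.m t

/-- All machines, by increasing `L i + R i`. -/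
def sweep (t : Tab) : Tab := iter d.sweepKey (2 * d.n + 1) t

/-- The initial table. -/
def start (A : ℕ → ℕ → ℕ) : Tab := ⟨fun v => if v = 0 then 0 else d.B + 1, A⟩

/-- The whole dynamic program; in the end jobs without class are skipped. -/
def solve (A : ℕ → ℕ → ℕ) : Tab := d.process d.m 1 0 (d.sweep (d.start A))

/-! ### Soundness -/

/-- The jobs done at `v`. -/
def Done (v j : ℕ) : Prop := j < pos d.n (d.cls j) v

instance (v j : ℕ) : Decidable (d.Done v j) := by unfold Done; infer_instance

/-- The load of the machine `i` in the partial assignment `A v`. -/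
def load (t : Tab) (v i : ℕ) : ℚ :=
  ∑ j ∈ Finset.range d.n, if d.Done v j ∧ t.A v j = i then d.p j else 0

/-- The machine `i` can execute the job `j`. -/
def Ok (i j : ℕ) : Prop := i < d.m ∧ d.L i ≤ j ∧ j < d.R i

/-- Every finite entry of the table is witnessed by its partial assignment, which uses machines from `P`
and the machine `cur` only. -/
def Sound (P : ℕ → Prop) (cur : ℕ) (t : Tab) : Prop :=
  ∀ v < d.V, t.D v ≤ d.B → 0 ≤ t.D v ∧
    (∀ j < d.n, d.Done v j → d.Ok (t.A v j) j ∧ (P (t.A v j) ∨ t.A v j = cur)) ∧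
    (∀ i, d.load t v i ≤ d.B) ∧ d.load t v cur ≤ t.D v

variable {d}

/-- A relaxation rewrites a single entry, so the invariant has to be checked anew only at that code
`w`. -/
theorem Sound.of_entry {P : ℕ → Prop} {cur w : ℕ} {t t' : Tab} (h : d.Sound P cur t)
    (hD : ∀ v, v ≠ w → t'.D v = t.D v) (hA : ∀ v, v ≠ w → t'.A v = t.A v)
    (hw : t'.D w ≤ d.B → 0 ≤ t'.D w ∧
      (∀ j < d.n, d.Done w j → d.Ok (t'.A w j) j ∧ (P (t'.A w j) ∨ t'.A w j = cur)) ∧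
      (∀ i, d.load t' w i ≤ d.B) ∧ d.load t' w cur ≤ t'.D w) : d.Sound P cur t' := by
  intro v hv hB
  by_cases hvw : v = w
  · subst hvw; exact hw hB
  · have := h v hv (by rwa [← hD v hvw])
    simpa only [load, hD v hvw, hA v hvw] using this

/-- The target entry receives a copy of the whole row of `v`, so it carries its own witness whatever
happens to row `v` later. Whether a job is done depends only on the coordinate of its own class:
advancing coordinate `c` past a job of class `c` adds exactly this job, past any other job nothing.
-/
theorem Sound.relax {P : ℕ → Prop} {cur l r c v : ℕ} {t : Tab} (h : d.Sound P cur t)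
    (hp : ∀ j, 0 ≤ d.p j) (hok : ∀ j, l ≤ j → j < r → d.Ok cur j) (hv : v < d.V) :
    d.Sound P cur (d.relax cur l r c v t) := by
  unfold Data.relax
  split_ifs with h1 h2 h3 h3
  · obtain ⟨hB, hn⟩ := h1
    obtain ⟨hl, hr, hle, hlt⟩ := h3
    obtain ⟨k1, k2, k3, k4⟩ := h v hv hB
    have hdone : ∀ j < d.n, d.Done (v + (d.n + 1) ^ c) j ↔ (d.Done v j ∨ j = pos d.n c v) := by
      intro j hj
      unfold Done
      by_cases hcj : d.cls j = c
      · rw [hcj, pos_add_self hn]; omega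
      · rw [pos_add_of_ne hn hcj]
        have : j ≠ pos d.n c v := by rintro rfl; exact hcj h2
        tauto
    have hnd : ¬ d.Done v (pos d.n c v) := by unfold Done; rw [h2]; omega
    have hload : ∀ i, d.load ⟨Function.update t.D (v + (d.n + 1) ^ c) (t.D v + d.p (pos d.n c v)),
          Function.update t.A (v + (d.n + 1) ^ c)
            (Function.update (t.A v) (pos d.n c v) cur)⟩ (v + (d.n + 1) ^ c) i =
        d.load t v i + if cur = i then d.p (pos d.n c v) else 0 := by
      intro i
      have e : (if cur = i then d.p (pos d.n c v) else 0) =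
          ∑ j ∈ Finset.range d.n, if j = pos d.n c v then
            (if cur = i then d.p (pos d.n c v) else 0) else 0 := by
        rw [Finset.sum_ite_eq' (Finset.range d.n)]; simp [hn]
      unfold load
      rw [e, ← Finset.sum_add_distrib]
      refine Finset.sum_congr rfl fun j hj => ?_
      rw [Finset.mem_range] at hj
      simp only [Function.update_self, hdone j hj]
      by_cases hj0 : j = pos d.n c v
      · simp [hj0, hnd]
      · simp [hj0]
    refine h.of_entry (w := v + (d.n + 1) ^ c) (fun u hu => by simp [hu])
      (fun u hu => by simp [hu]) fun _ => ⟨?_, ?_, ?_, ?_⟩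
    · simpa using add_nonneg k1 (hp _)
    · intro j hj hd
      rw [hdone j hj] at hd
      by_cases hj0 : j = pos d.n c v
      · simpa [hj0] using hok _ hl hr
      · simpa [hj0] using k2 j hj (hd.resolve_right hj0)
    · intro i
      rw [hload]
      split_ifs with hi
      · subst hi; linarith
      · simpa using k3 i
    · rw [hload]; simpa using k4
  · exact h
  · obtain ⟨hB, hn⟩ := h1
    obtain ⟨k1, k2, k3, k4⟩ := h v hv hB
    have hdone : ∀ j, d.Done (v + (d.n + 1) ^ c) j ↔ d.Done v j := by
      intro j
      unfold Done
      by_cases hcj : d.cls j = c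
      · rw [hcj, pos_add_self hn]
        have : j ≠ pos d.n c v := by rintro rfl; exact h2 hcj
        omega
      · rw [pos_add_of_ne hn hcj]
    have hload : ∀ i, d.load ⟨Function.update t.D (v + (d.n + 1) ^ c) (t.D v),
          Function.update t.A (v + (d.n + 1) ^ c) (t.A v)⟩ (v + (d.n + 1) ^ c) i =
        d.load t v i := by
      intro i
      simp [load, hdone]
    refine h.of_entry (w := v + (d.n + 1) ^ c) (fun u hu => by simp [hu])
      (fun u hu => by simp [hu]) fun _ => ⟨?_, ?_, ?_, ?_⟩
    · simpa using k1
    · simpa [hdone] using k2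
    · simpa [hload] using k3
    · simpa [hload] using k4
  · exact h
  · exact h

theorem resetAt_A (v : ℕ) (t : Tab) : (d.resetAt v t).A = t.A := by
  unfold resetAt; split_ifs <;> rfl

theorem resetAt_D (v u : ℕ) (t : Tab) :
    (d.resetAt v t).D u = if u = v ∧ t.D u ≤ d.B then 0 else t.D u := by
  unfold resetAt
  by_cases hu : u = v
  · subst hu; split_ifs <;> simp_all
  · split_ifs <;> simp_all

theorem iter_resetAt (q : ℕ) (t : Tab) :
    (iter d.resetAt q t).A = t.A ∧
      ∀ v, (iter d.resetAt q t).D v = if v < q ∧ t.D v ≤ d.B then 0 else t.D v := by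
  induction q with
  | zero => simp [iter]
  | succ q ih =>
    refine ⟨(resetAt_A _ _).trans ih.1, fun v => ?_⟩
    rw [iter, resetAt_D, ih.2]
    rcases lt_trichotomy v q with h | h | h
    · simp [h, h.ne, h.trans (Nat.lt_succ_self q)]
    · simp [h]
    · simp [h.ne', not_lt.2 h.le, not_lt.2 (Nat.succ_le_of_lt h)]

theorem reset_A (t : Tab) : (d.reset t).A = t.A := (iter_resetAt _ _).1

theorem reset_D (t : Tab) {v : ℕ} (hv : v < d.V) :
    (d.reset t).D v = if t.D v ≤ d.B then 0 else t.D v := by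
  rw [reset, (iter_resetAt d.V t).2 v]
  simp [hv]

/-- All jobs done so far are on machines in `P'`, so the new machine `cur'` has load 0, matching the
new entries. -/
theorem Sound.reset {P P' : ℕ → Prop} {cur cur' : ℕ} {t : Tab} (h : d.Sound P cur t)
    (hP : ∀ i, P i ∨ i = cur → P' i) (hcur : ¬ P' cur') :
    d.Sound P' cur' (d.reset t) := by
  intro v hv hB
  have hBt : t.D v ≤ d.B := by
    by_contra hcon
    rw [reset_D t hv, if_neg hcon] at hB
    exact hcon hB
  obtain ⟨k1, k2, k3, k4⟩ := h v hv hBt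
  rw [reset_D t hv, if_pos hBt]
  have hl : d.load (d.reset t) v = d.load t v := by funext i; simp [load, reset_A]
  simp only [reset_A, hl]
  refine ⟨le_rfl, fun j hj hd => ⟨(k2 j hj hd).1, Or.inl (hP _ (k2 j hj hd).2)⟩, k3, le_of_eq ?_⟩
  refine Finset.sum_eq_zero fun j hj => if_neg ?_
  rintro ⟨hd, he⟩
  exact hcur (he ▸ hP _ (k2 j (Finset.mem_range.1 hj) hd).2)

theorem Sound.process {P P' : ℕ → Prop} {cur cur' l r : ℕ} {t : Tab} (h : d.Sound P cur t)
    (hP : ∀ i, P i ∨ i = cur → P' i) (hcur : ¬ P' cur')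
    (hp : ∀ j, 0 ≤ d.p j) (hok : ∀ j, l ≤ j → j < r → d.Ok cur' j) :
    d.Sound P' cur' (d.process cur' l r t) :=
  iter_induction (fun _ t => d.Sound P' cur' t) (h.reset hP hcur) fun _ _ _ hI =>
    iter_induction (fun _ t => d.Sound P' cur' t) hI fun _ _ hv hI' =>
      hI'.relax hp hok hv

theorem Sound.mono {P P' : ℕ → Prop} {cur : ℕ} {t : Tab} (h : d.Sound P cur t)
    (hP : ∀ i, P i → P' i) : d.Sound P' cur t := fun v hv hB =>
  ⟨(h v hv hB).1, fun j hj hd => ⟨((h v hv hB).2.1 j hj hd).1,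
    ((h v hv hB).2.1 j hj hd).2.imp_left (hP _)⟩, (h v hv hB).2.2⟩

end Data

end ConvexMakespan

namespace ConvexMakespan

namespace Data

variable {d : Data}

/-- The machines processed before machine `i` in round `s`; `d.m + 1` is an unused dummy. -/
def Before (d : Data) (s i x : ℕ) : Prop :=
  x = d.m + 1 ∨ (x < d.m ∧ (d.L x + d.R x < s ∨ (d.L x + d.R x = s ∧ x < i)))

/-- The initial value `B + 1` plays the role of infinity; the only finite entry is at code 0, where
no job is done. -/
theorem sound_start (A : ℕ → ℕ → ℕ) (P : ℕ → Prop) (cur : ℕ) (hB : 0 ≤ d.B) :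
    d.Sound P cur (d.start A) := by
  intro v _ hv
  have h0 : v = 0 := by
    by_contra h
    simp [start, h] at hv
    linarith
  subst h0
  have hd : ∀ j, ¬ d.Done 0 j := fun j => by simp [Done, pos_zero]
  simp [start, hd, load, hB]

/-- The last processed machine is quantified existentially because a round may process none; before
the first machine it is the dummy `d.m + 1`. A machine is fresh when its turn comes, since it is not
yet in `Before`. -/
theorem sound_sweep (A : ℕ → ℕ → ℕ) (hB : 0 ≤ d.B) (hp : ∀ j, 0 ≤ d.p j) :
    ∃ cur, d.Sound (d.Before (2 * d.n + 1) 0) cur (d.sweep (d.start A)) ∧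
      d.Before (2 * d.n + 1) 0 cur := by
  unfold sweep
  refine iter_induction (fun s t => ∃ cur, d.Sound (d.Before s 0) cur t ∧ d.Before s 0 cur)
    ⟨d.m + 1, sound_start A _ _ hB, Or.inl rfl⟩ ?_
  intro s t _ hI
  have : ∃ cur, d.Sound (d.Before s d.m) cur (d.sweepKey s t) ∧ d.Before s d.m cur := by
    unfold sweepKey
    refine iter_induction (fun i t => ∃ cur, d.Sound (d.Before s i) cur t ∧ d.Before s i cur) hI ?_
    rintro i t hi ⟨cur, h1, h2⟩
    have hmono : ∀ x, d.Before s i x → d.Before s (i + 1) x := by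
      unfold Before; intro x hx; omega
    split_ifs with hk
    · refine ⟨i, (h1.process (P' := d.Before s i) (cur' := i) ?_ ?_ hp ?_).mono hmono, ?_⟩
      · rintro x (hx | rfl) <;> assumption
      · unfold Before; omega
      · exact fun j hl hr => ⟨hi, hl, hr⟩
      · unfold Before; omega
    · exact ⟨cur, h1.mono hmono, hmono _ h2⟩
  have hmono : ∀ x, d.Before s d.m x → d.Before (s + 1) 0 x := by
    unfold Before; intro x hx; omega
  obtain ⟨cur, h1, h2⟩ := this
  exact ⟨cur, h1.mono hmono, hmono _ h2⟩

/-- A finite last entry of the final table comes with a feasible assignment of all jobs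
whose loads are at most `B`. -/
theorem solve_sound (A : ℕ → ℕ → ℕ) (hB : 0 ≤ d.B) (hp : ∀ j, 0 ≤ d.p j)
    (hcls : ∀ j < d.n, d.cls j ≤ d.C) (h : (d.solve A).D (d.V - 1) ≤ d.B) :
    (∀ j < d.n, d.Ok ((d.solve A).A (d.V - 1) j) j) ∧
      ∀ i, ∑ j ∈ Finset.range d.n,
        (if (d.solve A).A (d.V - 1) j = i then d.p j else 0) ≤ d.B := by
  obtain ⟨cur, h1, h2⟩ := sound_sweep A hB hp
  -- The final pass belongs to the fictitious machine `d.m` with the empty interval `1 ≤ j < 0`, so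
  -- it only skips jobs.
  have hs := h1.process (P' := d.Before (2 * d.n + 1) 0) (cur' := d.m) (l := 1) (r := 0)
    (by rintro x (hx | rfl) <;> assumption) (by unfold Before; omega) hp
    (fun j _ hr => absurd hr (Nat.not_lt_zero j))
  obtain ⟨-, k2, k3, -⟩ := hs (d.V - 1) (Nat.sub_lt (by unfold V; positivity) one_pos) h
  have hd : ∀ j < d.n, d.Done (d.V - 1) j := by
    intro j hj
    unfold Done V
    rwa [pos_last _ (Nat.lt_succ_of_le (hcls j hj))]
  refine ⟨fun j hj => (k2 j hj (hd j hj)).1, fun i => le_trans (le_of_eq ?_) (k3 i)⟩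
  refine Finset.sum_congr rfl fun j hj => ?_
  simp only [hd j (Finset.mem_range.1 hj), true_and]
  rfl

/-! ### Completeness -/

/-- Entries never grow within a phase, so an upper bound once reached persists. -/
theorem relax_D_le (cur l r c v : ℕ) (t : Tab) (u : ℕ) : (d.relax cur l r c v t).D u ≤ t.D u := by
  unfold relax
  split_ifs with h1 h2 h3 h3
  · simp only [Function.update_apply]; split_ifs with h
    · subst h; exact h3.2.2.2.le
    · exact le_rfl
  · exact le_rfl
  · simp only [Function.update_apply]; split_ifs with h
    · subst h; exact h3.le
    · exact le_rfl
  · exact le_rfl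
  · exact le_rfl

theorem iter_relax_D_le (cur l r c : ℕ) (t : Tab) (u : ℕ) {q q' : ℕ} (h : q ≤ q') :
    (iter (d.relax cur l r c) q' t).D u ≤ (iter (d.relax cur l r c) q t).D u := by
  induction q', h using Nat.le_induction with
  | base => exact le_rfl
  | succ q' _ ih => exact (relax_D_le _ _ _ _ _ _ _).trans ih

/-- If the test declines the update although the job fits, the target entry was already at least as
small. -/
theorem relax_D_target {cur l r c v : ℕ} {t : Tab} {x : ℚ} (hv : t.D v ≤ x)
    (hn : pos d.n c v < d.n)
    (hlr : d.cls (pos d.n c v) = c → l ≤ pos d.n c v ∧ pos d.n c v < r)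
    (hx : x ≤ d.B)
    (hB : x + (if d.cls (pos d.n c v) = c then d.p (pos d.n c v) else 0) ≤ d.B) :
    (d.relax cur l r c v t).D (v + (d.n + 1) ^ c) ≤
      x + (if d.cls (pos d.n c v) = c then d.p (pos d.n c v) else 0) := by
  unfold relax
  rw [if_pos ⟨hv.trans hx, hn⟩]
  split_ifs at hB ⊢ with h2 h3 h3
  · simpa using hv
  · have := hlr h2
    have h4 : t.D v + d.p (pos d.n c v) ≤ d.B := by linarith
    have : t.D (v + (d.n + 1) ^ c) ≤ t.D v + d.p (pos d.n c v) :=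
      not_lt.1 fun h => h3 ⟨this.1, this.2, h4, h⟩
    linarith
  · simpa using hv
  · linarith

/-- Codes are relaxed in increasing order and every target has a larger code than its source. Hence
a single pass advances coordinate `c` by any number `e` of positions, paying for the jobs of class
`c` only. -/
theorem phase_complete {cur l r c v a : ℕ} {t : Tab} {x : ℚ} (hp : ∀ j, 0 ≤ d.p j) (hc : c ≤ d.C)
    (hv : v < d.V) (hpos : pos d.n c v = a) (hx : t.D v ≤ x) (e : ℕ) (hn : a + e ≤ d.n)
    (hlr : ∀ j, a ≤ j → j < a + e → d.cls j = c → l ≤ j ∧ j < r)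
    (hB : x + ∑ j ∈ Finset.Ico a (a + e), (if d.cls j = c then d.p j else 0) ≤ d.B) :
    v + e * (d.n + 1) ^ c < d.V ∧ pos d.n c (v + e * (d.n + 1) ^ c) = a + e ∧
      (∀ c', c' ≠ c → pos d.n c' (v + e * (d.n + 1) ^ c) = pos d.n c' v) ∧
      ∀ q, v + e * (d.n + 1) ^ c ≤ q →
        (iter (d.relax cur l r c) q t).D (v + e * (d.n + 1) ^ c) ≤
          x + ∑ j ∈ Finset.Ico a (a + e), (if d.cls j = c then d.p j else 0) := by
  induction e with
  | zero =>
    refine ⟨by simpa using hv, by simpa using hpos, by simp, fun q _ => ?_⟩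
    have := (iter_relax_D_le (d := d) cur l r c t v (Nat.zero_le q)).trans hx
    simpa using this
  | succ e ih =>
    have hsum : ∑ j ∈ Finset.Ico a (a + (e + 1)), (if d.cls j = c then d.p j else 0) =
        ∑ j ∈ Finset.Ico a (a + e), (if d.cls j = c then d.p j else 0) +
          (if d.cls (a + e) = c then d.p (a + e) else 0) := by
      rw [← add_assoc, Finset.sum_Ico_succ_top (by omega)]
    have h0 : 0 ≤ (if d.cls (a + e) = c then d.p (a + e) else 0) := by
      split_ifs
      · exact hp _
      · exact le_rfl
    rw [hsum] at hB ⊢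
    obtain ⟨i1, i2, i3, i4⟩ := ih (by omega) (fun j h1 h2 => hlr j h1 (by omega)) (by linarith)
    have hw : v + (e + 1) * (d.n + 1) ^ c = v + e * (d.n + 1) ^ c + (d.n + 1) ^ c := by ring
    rw [hw]
    set u := v + e * (d.n + 1) ^ c
    have hlt : pos d.n c u < d.n := by omega
    refine ⟨add_pow_lt hlt (Nat.lt_succ_of_le hc) i1, by rw [pos_add_self hlt]; omega,
      fun c' hc' => by rw [pos_add_of_ne hlt hc', i3 c' hc'], fun q hq => ?_⟩
    have hpow : 0 < (d.n + 1) ^ c := by positivity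
    -- The step at `u` is among the first `q`, as its target lies strictly above `u`.
    have hq' : u + 1 ≤ q := by omega
    refine (iter_relax_D_le cur l r c t _ hq').trans ?_
    have := relax_D_target (d := d) (cur := cur) (l := l) (r := r) (c := c) (v := u)
      (i4 u le_rfl) hlt (by rw [i2]; exact hlr _ (by omega) (by omega)) (by linarith)
      (by rw [i2]; linarith)
    rw [i2] at this
    simpa [iter, add_assoc] using this

/-- The coordinates are moved from `y` to `y'` one after the other, one phase each, starting from
load 0 after the reset. All partial sums stay below the bound because sizes are nonnegative. -/
theorem process_complete {cur l r v : ℕ} {t : Tab} (y y' : ℕ → ℕ) (hp : ∀ j, 0 ≤ d.p j)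
    (hv : v < d.V) (hpos : ∀ c ≤ d.C, pos d.n c v = y c) (hx : t.D v ≤ d.B)
    (hy : ∀ c ≤ d.C, y c ≤ y' c) (hy' : ∀ c ≤ d.C, y' c ≤ d.n)
    (hlr : ∀ c ≤ d.C, ∀ j, y c ≤ j → j < y' c → d.cls j = c → l ≤ j ∧ j < r)
    (hB : ∑ c ∈ Finset.range (d.C + 1), ∑ j ∈ Finset.Ico (y c) (y' c),
      (if d.cls j = c then d.p j else 0) ≤ d.B) :
    ∃ v < d.V, (∀ c ≤ d.C, pos d.n c v = y' c) ∧ (d.process cur l r t).D v ≤ d.B := by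
  have key : ∀ q ≤ d.C + 1, ∃ v < d.V,
      (∀ c ≤ d.C, pos d.n c v = if c < q then y' c else y c) ∧
      (iter (d.phase cur l r) q (d.reset t)).D v ≤ ∑ c ∈ Finset.range q,
        ∑ j ∈ Finset.Ico (y c) (y' c), (if d.cls j = c then d.p j else 0) := by
    intro q
    induction q with
    | zero =>
      intro _
      exact ⟨v, hv, by simpa using hpos, by simp [iter, reset_D t hv, hx]⟩
    | succ q ih =>
      intro hq
      obtain ⟨u, hu, h1, h2⟩ := ih (by omega)
      have hle : ∑ c ∈ Finset.range (q + 1), ∑ j ∈ Finset.Ico (y c) (y' c),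
          (if d.cls j = c then d.p j else 0) ≤ d.B := by
        refine (Finset.sum_le_sum_of_subset_of_nonneg
          (Finset.range_subset_range.2 hq) fun c _ _ => Finset.sum_nonneg fun j _ => ?_).trans hB
        split_ifs
        · exact hp _
        · exact le_rfl
      rw [Finset.sum_range_succ] at hle ⊢
      obtain ⟨e, he⟩ := Nat.exists_eq_add_of_le (hy q (by omega))
      have hyq := hy' q (by omega)
      have hpq : pos d.n q u = y q := by simpa using h1 q (by omega)
      obtain ⟨k1, k2, k3, k4⟩ := phase_complete (cur := cur) (l := l) (r := r) hp
        (show q ≤ d.C by omega) hu hpq h2 e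
        (by omega) (by rw [← he]; exact hlr q (by omega)) (by rw [← he]; exact hle)
      refine ⟨_, k1, fun c hc => ?_, ?_⟩
      · rcases lt_trichotomy c q with h | h | h
        · rw [k3 c h.ne, h1 c hc, if_pos h, if_pos (by omega)]
        · subst h; rw [k2, if_pos (by omega), he]
        · rw [k3 c h.ne', h1 c hc, if_neg (by omega), if_neg (by omega)]
      · rw [he]; exact k4 _ k1.le
  obtain ⟨u, hu, h1, h2⟩ := key (d.C + 1) le_rfl
  exact ⟨u, hu, fun c hc => by simpa [Nat.lt_succ_of_le hc] using h1 c hc, h2.trans hB⟩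

end Data

end ConvexMakespan

namespace ConvexMakespan

/-! ### Monotone assignments

Within each class, the jobs of an assignment `b` are rearranged such that the machines receive
consecutive jobs of the same total weight as before, up to the weight of one job. -/

open Classical in
/-- The total weight of the jobs `j < a` of class `c`. -/
noncomputable def weightBelow (cls : ℕ → ℕ) (w : ℕ → ℚ) (c a : ℕ) : ℚ :=
  ∑ j ∈ Finset.range a, if cls j = c then w j else 0

open Classical in
/-- The total weight of the jobs `j < n` of class `c` that `b` assigns to machines in `P`. -/
noncomputable def weightOn (n : ℕ) (cls : ℕ → ℕ) (w : ℕ → ℚ) (b : ℕ → ℕ) (P : ℕ → Prop) (c : ℕ) :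
    ℚ :=
  ∑ j ∈ Finset.range n, if cls j = c ∧ P (b j) then w j else 0

open Classical in
/-- The first position `j` where at least the weight `x` lies below `j`, or `n`. -/
noncomputable def cut (n : ℕ) (cls : ℕ → ℕ) (w : ℕ → ℚ) (c : ℕ) (x : ℚ) : ℕ :=
  Nat.find (p := fun j => j = n ∨ x ≤ weightBelow cls w c j) ⟨n, Or.inl rfl⟩

section

variable {n : ℕ} {cls : ℕ → ℕ} {w : ℕ → ℚ} {b : ℕ → ℕ} {P P' : ℕ → Prop} {c : ℕ} {x x' : ℚ}

theorem cut_le : cut n cls w c x ≤ n := by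
  classical
  exact Nat.find_min' _ (Or.inl rfl)

theorem weightBelow_lt {j : ℕ} (h : j < cut n cls w c x) : weightBelow cls w c j < x := by
  classical
  exact lt_of_not_ge fun h' => Nat.find_min _ h (Or.inr h')

theorem le_weightBelow (h : cut n cls w c x < n) :
    x ≤ weightBelow cls w c (cut n cls w c x) := by
  classical
  have : cut n cls w c x = n ∨ x ≤ weightBelow cls w c (cut n cls w c x) :=
    Nat.find_spec (p := fun j => j = n ∨ x ≤ weightBelow cls w c j) ⟨n, Or.inl rfl⟩
  exact this.resolve_left h.ne

theorem weightBelow_succ (a : ℕ) : weightBelow cls w c (a + 1) =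
    weightBelow cls w c a + if cls a = c then w a else 0 := by
  classical
  unfold weightBelow
  rw [Finset.sum_range_succ]

theorem weightBelow_mono (hw : ∀ j, 0 ≤ w j) {a a' : ℕ} (h : a ≤ a') :
    weightBelow cls w c a ≤ weightBelow cls w c a' := by
  induction a', h using Nat.le_induction with
  | base => exact le_rfl
  | succ a' _ ih =>
    rw [weightBelow_succ]
    split_ifs
    · linarith [hw a']
    · linarith

theorem cut_zero : cut n cls w c 0 = 0 := by
  by_contra h
  have := weightBelow_lt (Nat.pos_of_ne_zero h)
  simp [weightBelow] at this

theorem cut_mono (h : x ≤ x') : cut n cls w c x ≤ cut n cls w c x' := by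
  by_contra hcon
  rw [not_le] at hcon
  have h1 := weightBelow_lt hcon
  have h2 := le_weightBelow (lt_of_lt_of_le hcon cut_le)
  linarith

theorem weightOn_mono (hw : ∀ j, 0 ≤ w j) (h : ∀ i, P i → P' i) :
    weightOn n cls w b P c ≤ weightOn n cls w b P' c := by
  refine Finset.sum_le_sum fun j _ => ?_
  split_ifs with h1 h2 h2
  · exact le_rfl
  · exact absurd ⟨h1.1, h _ h1.2⟩ h2
  · exact hw j
  · exact le_rfl

theorem weightBelow_eq_sum {a : ℕ} (h : a ≤ n) : weightBelow cls w c a =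
    ∑ j ∈ Finset.range n, if cls j = c ∧ j < a then w j else 0 := by
  classical
  unfold weightBelow
  rw [← Finset.sum_subset (Finset.range_subset_range.2 h)]
  · refine Finset.sum_congr rfl fun j hj => ?_
    simp [Finset.mem_range.1 hj]
  · intro j _ hj
    rw [Finset.mem_range] at hj
    simp [hj]

/-- If the jobs on machines from `P` lie before `a`, so does the corresponding cut. -/
theorem weightOn_le_weightBelow (hw : ∀ j, 0 ≤ w j) {a : ℕ} (ha : a ≤ n)
    (h : ∀ j < n, P (b j) → j < a) : weightOn n cls w b P c ≤ weightBelow cls w c a := by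
  rw [weightBelow_eq_sum ha]
  refine Finset.sum_le_sum fun j hj => ?_
  have := h j (Finset.mem_range.1 hj)
  split_ifs with h1 h2 h2
  · exact le_rfl
  · exact absurd ⟨h1.1, this h1.2⟩ h2
  · exact hw j
  · exact le_rfl

theorem weightBelow_le_weightOn (hw : ∀ j, 0 ≤ w j) {a : ℕ} (ha : a ≤ n)
    (h : ∀ j < a, P (b j)) : weightBelow cls w c a ≤ weightOn n cls w b P c := by
  rw [weightBelow_eq_sum ha]
  refine Finset.sum_le_sum fun j _ => ?_
  split_ifs with h1 h2 h2
  · exact le_rfl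
  · exact absurd ⟨h1.1, h _ h1.2⟩ h2
  · exact hw j
  · exact le_rfl

/-- The jobs between the cuts belonging to `P` and to `P'` can be executed on a machine with the
jobs `l ≤ j < r` if all jobs on machines in `P'` precede `r` and all jobs on machines outside `P`
start at `l`. -/
theorem mem_of_between_cuts (hw' : ∀ j, 0 ≤ w j) (hw : ∀ j < n, 0 < w j) {l r j : ℕ}
    (hr : ∀ j < n, P' (b j) → j < r) (hl : ∀ j < n, ¬ P (b j) → l ≤ j)
    (h1 : cut n cls w c (weightOn n cls w b P c) ≤ j)
    (h2 : j < cut n cls w c (weightOn n cls w b P' c)) (hj : cls j = c) : l ≤ j ∧ j < r := by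
  have hn : j < n := lt_of_lt_of_le h2 cut_le
  constructor
  -- If `j < l`, all jobs up to and including `j` are on machines in `P`. Then `weightOn` for `P`
  -- exceeds the weight below `j`, although its cut is at most `j`.
  · by_contra hcon
    have h3 : weightBelow cls w c (j + 1) ≤ weightOn n cls w b P c :=
      weightBelow_le_weightOn hw' (by omega) fun j' hj' => by
        by_contra hP
        have := hl j' (by omega) hP
        omega
    have h4 := le_weightBelow (lt_of_le_of_lt h1 hn)
    have h5 := weightBelow_mono (cls := cls) (c := c) hw' h1
    rw [weightBelow_succ, if_pos hj] at h3
    linarith [hw j hn]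
  -- If `r ≤ j`, all jobs on `P'` precede `j`, so the cut of `P'` is reached at `j` already.
  · by_contra hcon
    have h3 : weightOn n cls w b P' c ≤ weightBelow cls w c j :=
      weightOn_le_weightBelow hw' hn.le fun j' hj' hP => lt_of_lt_of_le (hr j' hj' hP) (not_lt.1 hcon)
    linarith [weightBelow_lt h2]

/-- The last counted job on the way starts while the weight is still below `x'`, so the total
exceeds `x'` by at most the overshoot `ω`; if no job is counted, the weight stays the same. -/
theorem weightBelow_advance {ω x' : ℚ} {a : ℕ}
    (hω : ∀ j, cls j = c → weightBelow cls w c j < x' → weightBelow cls w c j + w j ≤ x' + ω)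
    (a' : ℕ) (ha : a ≤ a') (h : ∀ j, a ≤ j → j < a' → weightBelow cls w c j < x') :
    weightBelow cls w c a' = weightBelow cls w c a ∨ weightBelow cls w c a' ≤ x' + ω := by
  induction a', ha using Nat.le_induction with
  | base => exact Or.inl rfl
  | succ a' ha ih =>
    rw [weightBelow_succ]
    split_ifs with hc
    · exact Or.inr (hω _ hc (h _ ha (Nat.lt_succ_self _)))
    · simpa using ih fun j h1 h2 => h j h1 (by omega)

/-- The weight between two cuts. -/
theorem weight_between_cuts {ω : ℚ} (hω0 : 0 ≤ ω) (h : x ≤ x')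
    (hω : ∀ j, cls j = c → weightBelow cls w c j < x' → weightBelow cls w c j + w j ≤ x' + ω) :
    ∑ j ∈ Finset.Ico (cut n cls w c x) (cut n cls w c x'), (if cls j = c then w j else 0) ≤
      x' - x + ω := by
  have hc := cut_mono (n := n) (cls := cls) (w := w) (c := c) h
  have hsum : ∑ j ∈ Finset.Ico (cut n cls w c x) (cut n cls w c x'),
      (if cls j = c then w j else 0) =
      weightBelow cls w c (cut n cls w c x') - weightBelow cls w c (cut n cls w c x) := by
    unfold weightBelow
    rw [Finset.sum_Ico_eq_sub _ hc]
  rw [hsum]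
  rcases hc.eq_or_lt with he | hlt
  · rw [he]; linarith
  -- The lower cut has weight at least `x` below it, so an overshoot there only helps.
  have h1 := le_weightBelow (lt_of_lt_of_le hlt cut_le)
  rcases weightBelow_advance hω _ hc fun j _ hj => weightBelow_lt hj with h2 | h2 <;> linarith

theorem weightOn_sub {i : ℕ} (hP' : ∀ y, P' y ↔ P y ∨ y = i) (hi : ¬ P i) :
    weightOn n cls w b P' c - weightOn n cls w b P c =
      ∑ j ∈ Finset.range n, if cls j = c ∧ b j = i then w j else 0 := by
  unfold weightOn
  rw [← Finset.sum_sub_distrib]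
  refine Finset.sum_congr rfl fun j _ => ?_
  by_cases h1 : cls j = c
  · by_cases h2 : b j = i
    · simp [h1, h2, hP', hi]
    · by_cases h3 : P (b j) <;> simp [h1, h2, h3, hP']
  · simp [h1]

end

/-- Small jobs (class 0) are weighted by their processing times, the others are counted. -/
def weight (p : ℕ → ℚ) (c j : ℕ) : ℚ := if c = 0 then p j else 1

/-- Both the weights below positions and the targets of cuts are integers for a counted class, so
its cuts do not overshoot. -/
theorem exists_int_weightBelow (cls : ℕ → ℕ) (p : ℕ → ℚ) {c : ℕ} (hc : c ≠ 0) (a : ℕ) :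
    ∃ z : ℤ, weightBelow cls (weight p c) c a = z := by
  classical
  exact ⟨∑ j ∈ Finset.range a, if cls j = c then 1 else 0, by simp [weightBelow, weight, hc]⟩

theorem exists_int_weightOn (n : ℕ) (cls : ℕ → ℕ) (p : ℕ → ℚ) (b : ℕ → ℕ) (P : ℕ → Prop) {c : ℕ}
    (hc : c ≠ 0) : ∃ z : ℤ, weightOn n cls (weight p c) b P c = z := by
  classical
  exact ⟨∑ j ∈ Finset.range n, if cls j = c ∧ P (b j) then 1 else 0,
    by simp [weightOn, weight, hc]⟩

/-- The load of machine `i` in the rearranged assignment. -/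
theorem load_between_cuts {n C : ℕ} {cls : ℕ → ℕ} {p : ℕ → ℚ} {b : ℕ → ℕ} {P P' : ℕ → Prop} {i : ℕ}
    {lo : ℕ → ℚ} {ρ σ T : ℚ} (hp : ∀ j, 0 ≤ p j) (hσ : 0 ≤ σ) (hρ : 1 ≤ ρ)
    (hcls : ∀ j < n, cls j ≤ C) (hsmall : ∀ j, cls j = 0 → p j ≤ σ)
    (hlo : ∀ j < n, cls j ≠ 0 → lo (cls j) ≤ p j ∧ p j ≤ ρ * lo (cls j)) (hlo0 : ∀ c, 0 ≤ lo c)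
    (hP' : ∀ y, P' y ↔ P y ∨ y = i) (hi : ¬ P i)
    (hT : ∑ j ∈ Finset.range n, (if b j = i then p j else 0) ≤ T) :
    ∑ c ∈ Finset.range (C + 1), ∑ j ∈ Finset.Ico
      (cut n cls (weight p c) c (weightOn n cls (weight p c) b P c))
      (cut n cls (weight p c) c (weightOn n cls (weight p c) b P' c)),
      (if cls j = c then p j else 0) ≤ ρ * T + σ := by
  have hw : ∀ c j, 0 ≤ weight p c j := fun c j => by
    unfold weight; split_ifs
    · exact hp j
    · exact zero_le_one
  have hclass : ∀ c, ∑ j ∈ Finset.Ico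
      (cut n cls (weight p c) c (weightOn n cls (weight p c) b P c))
      (cut n cls (weight p c) c (weightOn n cls (weight p c) b P' c)),
      (if cls j = c then p j else 0) ≤
      ρ * (∑ j ∈ Finset.range n, if cls j = c ∧ b j = i then p j else 0) +
        if c = 0 then σ else 0 := by
    intro c
    have hmono : weightOn n cls (weight p c) b P c ≤ weightOn n cls (weight p c) b P' c :=
      weightOn_mono (hw c) fun y hy => (hP' y).2 (Or.inl hy)
    by_cases hc : c = 0
    · subst hc
      -- Small jobs: the overshoot is at most one job, hence at most `σ`.
      have h1 := weight_between_cuts (n := n) hσ hmono fun j hj hlt => by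
        have : weight p 0 j ≤ σ := by simpa [weight] using hsmall j hj
        linarith
      rw [weightOn_sub hP' hi] at h1
      simp only [weight, if_true] at h1 ⊢
      have h2 : 0 ≤ ∑ j ∈ Finset.range n, if cls j = 0 ∧ b j = i then p j else 0 :=
        Finset.sum_nonneg fun j _ => by
          split_ifs
          · exact hp j
          · exact le_rfl
      nlinarith
    -- Large jobs: for integers, being below the target leaves room for one more job, so the
    -- overshoot is 0.
    · have h1 := weight_between_cuts (n := n) le_rfl hmono fun j hj hlt => by
        obtain ⟨z, hz⟩ := exists_int_weightBelow cls p hc j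
        obtain ⟨z', hz'⟩ := exists_int_weightOn n cls p b P' hc
        rw [hz, hz'] at hlt ⊢
        have hlt' : z < z' := by exact_mod_cast hlt
        have : ((z + 1 : ℤ) : ℚ) ≤ z' := by exact_mod_cast hlt'
        simp only [weight, hc, if_false]
        push_cast at this
        linarith
      rw [weightOn_sub hP' hi, add_zero] at h1
      -- Each job of the block is at most `ρ * lo c`, there are at most as many as `b` puts on
      -- machine `i`, and each of those is at least `lo c`.
      calc _ ≤ ∑ j ∈ Finset.Ico
            (cut n cls (weight p c) c (weightOn n cls (weight p c) b P c))
            (cut n cls (weight p c) c (weightOn n cls (weight p c) b P' c)),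
            (ρ * lo c) * (if cls j = c then weight p c j else 0) := by
            refine Finset.sum_le_sum fun j hj => ?_
            split_ifs with h
            · subst h
              have hjn : j < n := lt_of_lt_of_le (Finset.mem_Ico.1 hj).2 cut_le
              simpa [weight, hc] using (hlo j hjn hc).2
            · simp
        _ ≤ (ρ * lo c) * ∑ j ∈ Finset.range n,
            if cls j = c ∧ b j = i then weight p c j else 0 := by
            rw [← Finset.mul_sum]
            exact mul_le_mul_of_nonneg_left h1 (mul_nonneg (by linarith) (hlo0 c))
        _ ≤ _ := by
            rw [if_neg hc, add_zero, mul_assoc, Finset.mul_sum]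
            refine mul_le_mul_of_nonneg_left (Finset.sum_le_sum fun j hj => ?_) (by linarith)
            split_ifs with h
            · obtain ⟨rfl, -⟩ := h
              simpa [weight, hc] using (hlo j (Finset.mem_range.1 hj) hc).1
            · simp
  refine (Finset.sum_le_sum fun c _ => hclass c).trans ?_
  rw [Finset.sum_add_distrib, ← Finset.mul_sum, Finset.sum_comm]
  have h3 : ∑ c ∈ Finset.range (C + 1), (if c = 0 then σ else 0) = σ := by simp
  rw [h3]
  have h4 : ∑ j ∈ Finset.range n, ∑ c ∈ Finset.range (C + 1),
      (if cls j = c ∧ b j = i then p j else 0) ≤ T := by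
    refine le_trans (le_of_eq (Finset.sum_congr rfl fun j hj => ?_)) hT
    simp only [ite_and]
    rw [Finset.sum_ite_eq (Finset.range (C + 1)) (cls j)]
    simp [Nat.lt_succ_of_le (hcls j (Finset.mem_range.1 hj))]
  have := mul_le_mul_of_nonneg_left h4 (show 0 ≤ ρ by linarith)
  linarith

namespace Data

variable {d : Data}

/-- If there is an assignment `b` with loads at most `T`, the dynamic program with a bound of at least
`ρ * T + σ` succeeds. -/
theorem solve_complete (A : ℕ → ℕ → ℕ) {b : ℕ → ℕ} {lo : ℕ → ℚ} {ρ σ T : ℚ}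
    (hp : ∀ j, 0 ≤ d.p j) (hp' : ∀ j < d.n, 0 < d.p j)
    (hcls : ∀ j < d.n, d.cls j ≤ d.C)
    (hsort : ∀ i i', i < d.m → i' < d.m → d.L i < d.R i → d.L i' < d.R i' →
      d.L i + d.R i ≤ d.L i' + d.R i' → d.L i ≤ d.L i' ∧ d.R i ≤ d.R i')
    (hend : ∀ i < d.m, d.L i ≤ d.n ∧ d.R i ≤ d.n)
    (hb : ∀ j < d.n, d.Ok (b j) j)
    (hσ : 0 ≤ σ) (hρ : 1 ≤ ρ) (hsmall : ∀ j, d.cls j = 0 → d.p j ≤ σ)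
    (hlo : ∀ j < d.n, d.cls j ≠ 0 → lo (d.cls j) ≤ d.p j ∧ d.p j ≤ ρ * lo (d.cls j))
    (hlo0 : ∀ c, 0 ≤ lo c) (hT0 : 0 ≤ T)
    (hT : ∀ i, ∑ j ∈ Finset.range d.n, (if b j = i then d.p j else 0) ≤ T)
    (hB : ρ * T + σ ≤ d.B) : (d.solve A).D (d.V - 1) ≤ d.B := by
  have hw : ∀ c j, 0 ≤ weight d.p c j := fun c j => by
    unfold weight; split_ifs
    · exact hp j
    · exact zero_le_one
  have hw' : ∀ c, ∀ j < d.n, 0 < weight d.p c j := fun c j hj => by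
    unfold weight; split_ifs
    · exact hp' j hj
    · exact zero_lt_one
  have hB0 : 0 ≤ d.B := by nlinarith
  -- The path followed through the table: `Y P` is the vector of cuts after the machines in `P`.
  let Y : (ℕ → Prop) → ℕ → ℕ := fun P c =>
    cut d.n d.cls (weight d.p c) c (weightOn d.n d.cls (weight d.p c) b P c)
  let I : ℕ → ℕ → Tab → Prop := fun s i t =>
    ∃ v < d.V, (∀ c ≤ d.C, pos d.n c v = Y (d.Before s i) c) ∧ t.D v ≤ d.B
  have hsweep : I (2 * d.n + 1) 0 (d.sweep (d.start A)) := by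
    unfold sweep
    refine iter_induction (fun s t => I s 0 t) ⟨0, by unfold V; positivity, fun c _ => ?_, ?_⟩ ?_
    · have : weightOn d.n d.cls (weight d.p c) b (d.Before 0 0) c = 0 := by
        refine Finset.sum_eq_zero fun j hj => if_neg ?_
        have := (hb j (Finset.mem_range.1 hj)).1
        unfold Before
        omega
      simp only [Y, this, cut_zero, pos_zero]
    · simpa [start] using hB0
    · intro s t _ hI
      -- The end of one round and the start of the next give the same set of machines.
      have hs : d.Before (s + 1) 0 = d.Before s d.m := by
        funext x; unfold Before; apply propext; omega
      simp only [I, hs]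
      unfold sweepKey
      refine iter_induction (fun i t => I s i t) hI ?_
      intro i t hi hI
      split_ifs with hk
      · obtain ⟨v, hv, h1, h2⟩ := hI
        have hP' : ∀ y, d.Before s (i + 1) y ↔ d.Before s i y ∨ y = i := by
          intro y
          by_cases hy : y = i
          · subst hy; unfold Before; omega
          · unfold Before; omega
        have hni : ¬ d.Before s i i := by unfold Before; omega
        refine process_complete (Y (d.Before s i)) (Y (d.Before s (i + 1))) hp hv h1 h2
          (fun c _ => cut_mono (weightOn_mono (hw c) fun y hy => (hP' y).2 (Or.inl hy)))
          (fun c _ => cut_le) ?_ ?_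
        · intro c _ j hj1 hj2 hj
          -- If `b` leaves machine `i` idle, its interval may be empty and its key says nothing
          -- about the order. But then its two cuts coincide and no job has to be executed.
          by_cases hex : ∃ j₀ < d.n, b j₀ = i
          · obtain ⟨j₀, hj₀, hbi⟩ := hex
            have hne : d.L i < d.R i := by
              have := hb j₀ hj₀
              rw [hbi] at this
              exact lt_of_le_of_lt this.2.1 this.2.2
            refine mem_of_between_cuts (hw c) (hw' c) ?_ ?_ hj1 hj2 hj
            · intro j' hj' hP
              obtain ⟨k1, k2, k3⟩ := hb j' hj'
              have := (hsort (b j') i k1 hi (lt_of_le_of_lt k2 k3) hne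
                (by unfold Before at hP; omega)).2
              omega
            · intro j' hj' hP
              obtain ⟨k1, k2, k3⟩ := hb j' hj'
              have := (hsort i (b j') hi k1 hne (lt_of_le_of_lt k2 k3)
                (by unfold Before at hP; omega)).1
              omega
          · exfalso
            have : weightOn d.n d.cls (weight d.p c) b (d.Before s (i + 1)) c =
                weightOn d.n d.cls (weight d.p c) b (d.Before s i) c := by
              have := weightOn_sub (n := d.n) (cls := d.cls) (w := weight d.p c) (b := b)
                (c := c) hP' hni
              rw [Finset.sum_eq_zero] at this
              · linarith
              · intro j' hj'
                exact if_neg fun h => hex ⟨j', Finset.mem_range.1 hj', h.2⟩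
            simp only [Y, this] at hj2
            exact absurd hj2 (not_lt.2 hj1)
        · exact (load_between_cuts hp hσ hρ hcls hsmall hlo hlo0 hP' hni (hT i)).trans hB
      · have : d.Before s (i + 1) = d.Before s i := by
          funext x; unfold Before; apply propext
          constructor
          · rintro (h | ⟨h1, h2 | ⟨h2, h3⟩⟩)
            · omega
            · omega
            · have : x ≠ i := by rintro rfl; exact hk h2
              omega
          · omega
        simpa only [I, this] using hI
  obtain ⟨v, hv, h1, h2⟩ := hsweep
  -- Beyond the cut for all machines no job of the class remains, as the target is then the weight
  -- of the whole class.
  have hcut : ∀ c, ∀ j, Y (d.Before (2 * d.n + 1) 0) c ≤ j → j < d.n → d.cls j ≠ c := by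
    intro c j hj1 hj hc
    have h3 := weightBelow_le_weightOn (cls := d.cls) (b := b) (c := c)
      (P := d.Before (2 * d.n + 1) 0) (hw c) le_rfl fun j' hj' => by
        obtain ⟨k1, k2, k3⟩ := hb j' hj'
        have := hend _ k1
        unfold Before
        omega
    have h4 := le_weightBelow (lt_of_le_of_lt hj1 hj)
    have h5 := weightBelow_mono (cls := d.cls) (c := c) (hw c) hj1
    have h6 := weightBelow_mono (cls := d.cls) (c := c) (hw c) (Nat.succ_le_of_lt hj)
    rw [Nat.succ_eq_add_one, weightBelow_succ, if_pos hc] at h6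
    linarith [hw' c j hj]
  -- A cut stops right after the last needed job of its class. The final pass moves all positions on
  -- to `n`, past jobs of other classes, without adding load.
  obtain ⟨u, hu, h3, h4⟩ := process_complete (cur := d.m) (l := 1) (r := 0)
    (t := d.sweep (d.start A)) (Y (d.Before (2 * d.n + 1) 0)) (fun _ => d.n) hp hv h1 h2
    (fun c _ => cut_le) (fun _ _ => le_rfl)
    (fun c _ j hj1 hj hc => absurd hc (hcut c j hj1 hj)) (by
      rw [Finset.sum_eq_zero]
      · exact hB0
      · intro c _
        refine Finset.sum_eq_zero fun j hj => if_neg ?_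
        rw [Finset.mem_Ico] at hj
        exact hcut c j hj.1 hj.2)
  have h5 := add_one_eq_of_pos_eq hu fun c hc => h3 c (Nat.lt_succ_iff.1 hc)
  have : d.V - 1 = u := by unfold V; omega
  rw [this]
  exact h4

end Data

end ConvexMakespan

/-! ### The dynamic program on the random access machine

Index arrays: 3 partial assignments, 4 to 7 counters, target and job of a step, 8 to 10 current machine and
its interval, 11 and 12 counters for machines and keys, 20 and 21 the intervals, 22 powers of
`n + 1`, 23 the number of codes, 24 addresses of rows, `100 + c` positions in class `c`.
Rational arrays: 0 processing times, 2 loads, 14 the guess of the optimum. -/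

namespace ConvexMakespan

open RAM

/-- The largest size of the jobs of class `c`, relative to the guess. -/
def hi (k c : ℕ) : ℚ := (1 + 2 / k) ^ c / k

/-- The strict lower bound for the sizes of the jobs of class `c`, relative to the guess. -/
def lo (k c : ℕ) : ℚ := if c = 0 then 0 else hi k (c - 1)

section Programs

variable (k C : ℕ)

def jobsE : NExp := NExp.get 0 (NExp.const 1)
def loadE (e : NExp) : QExp := QExp.get 2 e
def guessE : QExp := QExp.get 14 (NExp.const 0)
def boundE : QExp := QExp.scale (1 + 3 / k) guessE

/-- Copy row `v` to row `w`. -/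
def copyRow : Cmd :=
  Cmd.forTo 4 jobsE (Cmd.setN 3 (NExp.add (NExp.get 24 (NExp.var 5)) (NExp.var 4))
    (NExp.get 3 (NExp.add (NExp.get 24 (NExp.var 7)) (NExp.var 4))))

/-- The load after adding the job of the current step. -/
def newLoadE : QExp := QExp.add (loadE (NExp.var 7)) (QExp.get 0 (NExp.var 6))

/-- Assign the job of the current step to the current machine. -/
def takeJob : Cmd :=
  Cmd.cond (BExp.leN (NExp.var 9) (NExp.var 6))
    (Cmd.cond (BExp.leN (NExp.add (NExp.var 6) (NExp.const 1)) (NExp.var 10))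
      (Cmd.cond (BExp.leQ newLoadE (boundE k))
        (Cmd.cond (BExp.leQ (loadE (NExp.var 5)) newLoadE) Cmd.skip
          (Cmd.seq (Cmd.setQ 2 (NExp.var 5) newLoadE)
            (Cmd.seq copyRow (Cmd.setN 3 (NExp.add (NExp.get 24 (NExp.var 5)) (NExp.var 6))
              (NExp.var 8)))))
        Cmd.skip)
      Cmd.skip)
    Cmd.skip

/-- Skip the job of the current step. -/
def passJob : Cmd :=
  Cmd.cond (BExp.leQ (loadE (NExp.var 5)) (loadE (NExp.var 7))) Cmd.skip
    (Cmd.seq (Cmd.setQ 2 (NExp.var 5) (loadE (NExp.var 7))) copyRow)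

def relaxCmd (c : ℕ) : Cmd :=
  Cmd.cond (BExp.leQ (loadE (NExp.var 7)) (boundE k))
    (Cmd.cond (BExp.leN (NExp.add (NExp.get (100 + c) (NExp.var 7)) (NExp.const 1)) jobsE)
      (Cmd.seq (Cmd.setN 5 (NExp.const 0) (NExp.add (NExp.var 7) (NExp.get 22 (NExp.const c))))
        (Cmd.seq (Cmd.setN 6 (NExp.const 0) (NExp.get (100 + c) (NExp.var 7)))
          (Cmd.cond (BExp.leQ (QExp.get 0 (NExp.var 6)) (QExp.scale (hi k c) guessE))
            (Cmd.cond (BExp.leQ (QExp.get 0 (NExp.var 6)) (QExp.scale (lo k c) guessE))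
              passJob (takeJob k))
            passJob)))
      Cmd.skip)
    Cmd.skip

def phaseCmd (c : ℕ) : Cmd := Cmd.forTo 7 (NExp.var 23) (relaxCmd k c)

def phasesCmd : ℕ → Cmd
  | 0 => Cmd.skip
  | q + 1 => Cmd.seq (phasesCmd q) (phaseCmd k q)

def resetCmd : Cmd :=
  Cmd.forTo 7 (NExp.var 23) (Cmd.cond (BExp.leQ (loadE (NExp.var 7)) (boundE k))
    (Cmd.setQ 2 (NExp.var 7) (QExp.const 0)) Cmd.skip)

def processCmd : Cmd := Cmd.seq (resetCmd k) (phasesCmd k (C + 1))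

/-- The index expression `L i + R i`. -/
def keyE : NExp := NExp.add (NExp.get 20 (NExp.var 11)) (NExp.get 21 (NExp.var 11))

def sweepKeyCmd : Cmd :=
  Cmd.forTo 11 (NExp.var 0)
    (Cmd.cond (BExp.leN keyE (NExp.var 12)) (Cmd.cond (BExp.leN (NExp.var 12) keyE)
      (Cmd.seq (Cmd.setN 8 (NExp.const 0) (NExp.var 11))
        (Cmd.seq (Cmd.setN 9 (NExp.const 0) (NExp.get 20 (NExp.var 11)))
          (Cmd.seq (Cmd.setN 10 (NExp.const 0) (NExp.get 21 (NExp.var 11))) (processCmd k C))))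
      Cmd.skip) Cmd.skip)

def sweepCmd : Cmd :=
  Cmd.forTo 12 (NExp.add (NExp.add jobsE jobsE) (NExp.const 1)) (sweepKeyCmd k C)

def startCmd : Cmd :=
  Cmd.seq (Cmd.forTo 7 (NExp.var 23)
    (Cmd.setQ 2 (NExp.var 7) (QExp.add (boundE k) (QExp.const 1))))
    (Cmd.setQ 2 (NExp.const 0) (QExp.const 0))

def solveCmd : Cmd :=
  Cmd.seq (startCmd k) (Cmd.seq (sweepCmd k C)
    (Cmd.seq (Cmd.setN 8 (NExp.const 0) (NExp.var 0))
      (Cmd.seq (Cmd.setN 9 (NExp.const 0) (NExp.const 1))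
        (Cmd.seq (Cmd.setN 10 (NExp.const 0) (NExp.const 0)) (processCmd k C)))))

end Programs

/-- The constant parts of the memory during the dynamic program. -/
structure Ctx (k : ℕ) (d : Data) (T : ℚ) (s : State) : Prop where
  machines : s.idx 0 0 = d.m
  jobs : s.idx 0 1 = d.n
  time : s.val 0 = d.p
  left : s.idx 20 = d.L
  right : s.idx 21 = d.R
  stride : ∀ c ≤ d.C, s.idx 22 c = (d.n + 1) ^ c
  codes : s.idx 23 0 = d.V
  row : ∀ v < d.V, s.idx 24 v = v * d.n
  position : ∀ c ≤ d.C, ∀ v < d.V, s.idx (100 + c) v = pos d.n c v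
  guess : s.val 14 0 = T
  bound : d.B = (1 + 3 / k) * T
  cls : ∀ j < d.n, ∀ c ≤ d.C, d.cls j = c ↔ lo k c * T < d.p j ∧ d.p j ≤ hi k c * T

/-- The memory contains the table `t`. -/
def Rep (d : Data) (s : State) (t : Tab) : Prop :=
  ∀ v < d.V, s.val 2 v = t.D v ∧ ∀ j < d.n, s.idx 3 (v * d.n + j) = t.A v j

/-! ### Correctness and running time of one relaxation -/

variable {k : ℕ} {d : Data} {T : ℚ} {s : State} {t : Tab}

/-- The constant data live outside the arrays 2 to 13, to which all writes of the dynamic program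
are confined. -/
theorem Ctx.agree {s' : State} (h : Ctx k d T s) (ha : Agree (fun a => a ≤ 1 ∨ 14 ≤ a) s s') :
    Ctx k d T s' := by
  have e : ∀ a, a ≤ 1 ∨ 14 ≤ a → s'.idx a = s.idx a := fun a h => ha.idx h
  have e' : ∀ a, a ≤ 1 ∨ 14 ≤ a → s'.val a = s.val a := fun a h => ha.val h
  refine ⟨?_, ?_, ?_, ?_, ?_, ?_, ?_, ?_, ?_, ?_, h.bound, h.cls⟩
  · rw [e 0 (by simp)]; exact h.machines
  · rw [e 0 (by simp)]; exact h.jobs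
  · rw [e' 0 (by simp)]; exact h.time
  · rw [e 20 (by simp)]; exact h.left
  · rw [e 21 (by simp)]; exact h.right
  · rw [e 22 (by simp)]; exact h.stride
  · rw [e 23 (by simp)]; exact h.codes
  · rw [e 24 (by simp)]; exact h.row
  · intro c hc; rw [e (100 + c) (by omega)]; exact h.position c hc
  · rw [e' 14 (by simp)]; exact h.guess

theorem Rep.setN (h : Rep d s t) {a i x : ℕ} (ha : a ≠ 3) : Rep d (s.setN a i x) t := by
  intro v hv
  simpa [ha.symm] using h v hv

theorem row_injective {n v w j j' : ℕ} (hj : j < n) (hj' : j' < n)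
    (h : v * n + j = w * n + j') : v = w ∧ j = j' := by
  have h1 : (v * n + j) / n = v := by
    rw [mul_comm, Nat.mul_add_div (by omega), Nat.div_eq_of_lt hj, add_zero]
  have h2 : (w * n + j') / n = w := by
    rw [mul_comm, Nat.mul_add_div (by omega), Nat.div_eq_of_lt hj', add_zero]
  have : v = w := by rw [← h1, h, h2]
  subst this
  exact ⟨rfl, by omega⟩

/-- Different rows are disjoint in memory, so with `v ≠ w` the source stays intact while it is
copied. -/
theorem runs_copyRow {v w : ℕ} (h : Ctx k d T s) (hv : s.idx 7 0 = v) (hw : s.idx 5 0 = w)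
    (hvV : v < d.V) (hwV : w < d.V) (hne : v ≠ w) :
    Runs copyRow s (40 * (d.n + 1)) (fun s' => Agree (fun a => a ≠ 3 ∧ a ≠ 4) s s' ∧
      s'.val = s.val ∧
      (∀ j < d.n, s'.idx 3 (w * d.n + j) = s.idx 3 (v * d.n + j)) ∧
      ∀ u, u ≠ w → ∀ j < d.n, s'.idx 3 (u * d.n + j) = s.idx 3 (u * d.n + j)) := by
  refine Runs.mono (Runs.forTo (N := d.n) (t := 20) (fun a => a ≠ 3 ∧ a ≠ 4)
    (fun i s' => s'.val = s.val ∧ (∀ j < i, s'.idx 3 (w * d.n + j) = s.idx 3 (v * d.n + j)) ∧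
      ∀ u, u ≠ w → ∀ j < d.n, s'.idx 3 (u * d.n + j) = s.idx 3 (u * d.n + j))
    (by simp) ?_ ?_ ?_ ?_) ?_ ?_
  · intro i s' x hJ
    simpa using hJ
  · intro s' ha
    simp only [jobsE, NExp.eval]
    rw [ha.idx (by simp)]; exact h.jobs
  · simp
  · rintro i s' hi ha hi' ⟨J1, J2, J3⟩
    have e24 : s'.idx 24 = s.idx 24 := ha.idx (by simp)
    have e5 : s'.idx 5 = s.idx 5 := ha.idx (by simp)
    have e7 : s'.idx 7 = s.idx 7 := ha.idx (by simp)
    refine Runs.le (Runs.setN ?_) (by simp [NExp.cost])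
    refine ⟨(Agree.refl _ _).setN (by simp), by simpa using hi', by simpa using J1, ?_, ?_⟩
    · intro j hj
      simp only [NExp.eval, State.setN_idx, e24, e5, e7, hv, hw, h.row v hvV, h.row w hwV, hi']
      by_cases hji : j = i
      · subst hji
        simp [J3 v hne j hi]
      · have : ¬ (w * d.n + j = w * d.n + i) := by omega
        simp [hji, J2 j (by omega)]
    · intro u hu j hj
      simp only [NExp.eval, State.setN_idx, e24, e5, e7, hv, hw, h.row v hvV, h.row w hwV, hi']
      rw [if_neg fun hh => hu (row_injective hj hi hh.2).1]
      exact J3 u hu j hj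
  · simp [jobsE, NExp.cost]; omega
  · rintro s' ⟨h1, h2, h3, h4⟩
    exact ⟨h1, h2, h3, h4⟩

theorem runs_passJob {v w : ℕ} (h : Ctx k d T s) (hr : Rep d s t) (hv : s.idx 7 0 = v)
    (hw : s.idx 5 0 = w) (hvV : v < d.V) (hwV : w < d.V) (hne : v ≠ w) :
    Runs passJob s (100 * (d.n + 1)) (fun s' => Agree (fun a => a ≤ 1 ∨ 7 ≤ a) s s' ∧
      Rep d s' (if t.D v < t.D w then
        ⟨Function.update t.D w (t.D v), Function.update t.A w (t.A v)⟩ else t)) := by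
  refine Runs.le (Runs.cond (t := 1) (t' := 40 * (d.n + 1) + 10) (fun hb => ?_) fun hb => ?_) ?_
  · simp only [BExp.Holds, QExp.eval, loadE, NExp.eval, hv, hw, (hr v hvV).1, (hr w hwV).1] at hb
    rw [if_neg (not_lt.2 hb)]
    exact Runs.skip ⟨Agree.refl _ _, hr⟩
  · simp only [BExp.Holds, QExp.eval, loadE, NExp.eval, hv, hw, (hr v hvV).1, (hr w hwV).1] at hb
    rw [if_pos (not_le.1 hb)]
    refine Runs.le (Runs.seq (t' := 40 * (d.n + 1)) (Runs.setQ ?_)) ?_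
    · have ha : Agree (fun a => a ≤ 1 ∨ 7 ≤ a) s
        (s.setQ 2 ((NExp.var 5).eval s) ((loadE (NExp.var 7)).eval s)) :=
        (Agree.refl _ _).setQ (by simp)
      refine Runs.mono (runs_copyRow (v := v) (w := w)
        (h.agree (ha.mono fun a h => by omega)) (by simpa using hv)
        (by simpa using hw) hvV hwV hne) le_rfl ?_
      rintro s' ⟨k1, k2, k3, k4⟩
      refine ⟨ha.trans (k1.mono fun a h => by omega), fun u hu => ?_⟩
      by_cases huw : u = w
      · subst huw
        refine ⟨?_, fun j hj => ?_⟩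
        · simp [k2, NExp.eval, hw, loadE, QExp.eval, hv, (hr v hvV).1]
        · simp [k3 j hj, (hr v hvV).2 j hj]
      · refine ⟨?_, fun j hj => ?_⟩
        · simp [k2, NExp.eval, hw, huw, (hr u hu).1]
        · simp [k4 u huw j hj, huw, (hr u hu).2 j hj]
    · simp only [NExp.cost, loadE, QExp.cost]; omega
  · simp only [BExp.cost, NExp.cost, loadE, QExp.cost]; omega

theorem runs_takeJob {v w j₀ : ℕ} (h : Ctx k d T s) (hr : Rep d s t) (hv : s.idx 7 0 = v)
    (hw : s.idx 5 0 = w) (hj : s.idx 6 0 = j₀) (hvV : v < d.V) (hwV : w < d.V) (hne : v ≠ w)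
    (hj₀ : j₀ < d.n) :
    Runs (takeJob k) s (200 * (d.n + 1)) (fun s' => Agree (fun a => a ≤ 1 ∨ 7 ≤ a) s s' ∧
      Rep d s' (if s.idx 9 0 ≤ j₀ ∧ j₀ < s.idx 10 0 ∧ t.D v + d.p j₀ ≤ d.B ∧
          t.D v + d.p j₀ < t.D w then
        ⟨Function.update t.D w (t.D v + d.p j₀),
          Function.update t.A w (Function.update (t.A v) j₀ (s.idx 8 0))⟩ else t)) := by
  -- The nested tests decide a conjunction; each failing test refutes it and leaves the table
  -- unchanged.
  have hskip : ∀ p : Prop, [Decidable p] → ¬ p → ∀ t' : Tab, Runs Cmd.skip s 1 (fun s' =>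
      Agree (fun a => a ≤ 1 ∨ 7 ≤ a) s s' ∧ Rep d s' (if p then t' else t)) := by
    intro p _ hp t'
    rw [if_neg hp]
    exact Runs.skip ⟨Agree.refl _ _, hr⟩
  have eB : (boundE k).eval s = d.B := by
    simp only [boundE, guessE, QExp.eval, NExp.eval, h.guess, h.bound]
  have eD : newLoadE.eval s = t.D v + d.p j₀ := by
    simp only [newLoadE, loadE, QExp.eval, NExp.eval, hv, hj, h.time, (hr v hvV).1]
  have ew : (loadE (NExp.var 5)).eval s = t.D w := by
    simp only [loadE, QExp.eval, NExp.eval, hw, (hr w hwV).1]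
  refine Runs.le (Runs.cond (t' := 1) (fun b1 => Runs.cond (t' := 1) (fun b2 =>
    Runs.cond (t' := 1) (fun b3 =>
    Runs.cond (t := 1) (t' := 40 * (d.n + 1) + 30) (fun b4 => ?_) (fun b4 => ?_))
    (fun b3 => ?_)) (fun b2 => ?_)) (fun b1 => ?_)) ?_
  · simp only [BExp.Holds, eD, ew] at b4
    exact hskip _ (fun hh => by linarith [hh.2.2.2]) _
  · simp only [BExp.Holds, eD, ew, eB, NExp.eval, hj] at b1 b2 b3 b4
    rw [if_pos ⟨b1, b2, b3, not_le.1 b4⟩]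
    have ha : Agree (fun a => a ≤ 1 ∨ 7 ≤ a) s
        (s.setQ 2 ((NExp.var 5).eval s) (newLoadE.eval s)) :=
        (Agree.refl _ _).setQ (by simp)
    refine Runs.le (Runs.seq (t' := 40 * (d.n + 1) + 10) (Runs.setQ (Runs.seq (t' := 10)
      (Runs.mono (runs_copyRow (v := v) (w := w)
        (h.agree (ha.mono fun a h => by omega)) (by simpa using hv)
        (by simpa using hw) hvV hwV hne) le_rfl ?_)))) ?_
    · rintro s' ⟨k1, k2, k3, k4⟩
      refine Runs.le (Runs.setN ?_) (by simp [NExp.cost])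
      have k1' : ∀ a, a ≠ 3 → a ≠ 4 → s'.idx a = s.idx a := fun a h3 h4 => k1.idx ⟨h3, h4⟩
      refine ⟨(ha.trans (k1.mono fun a h => by omega)).setN (by simp), fun u hu => ?_⟩
      simp only [NExp.eval, k1' 24 (by simp) (by simp), k1' 5 (by simp) (by simp),
        k1' 6 (by simp) (by simp), k1' 8 (by simp) (by simp), hw, hj, h.row w hwV]
      by_cases huw : u = w
      · subst huw
        refine ⟨?_, fun j hjn => ?_⟩
        · simp [k2, NExp.eval, hw, eD]
        · by_cases hjj : j = j₀
          · simp [hjj]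
          · have := k3 j hjn
            simp only [State.setQ_idx] at this
            simp [hjj, this, (hr v hvV).2 j hjn]
      · refine ⟨?_, fun j hjn => ?_⟩
        · simp [k2, NExp.eval, hw, huw, (hr u hu).1]
        · have := k4 u huw j hjn
          simp only [State.setQ_idx] at this
          rw [State.setN_idx, if_neg fun hh => huw (row_injective hjn hj₀ hh.2).1, this]
          simp [huw, (hr u hu).2 j hjn]
    · simp only [NExp.cost, newLoadE, loadE, QExp.cost]; omega
  · simp only [BExp.Holds, eD, eB] at b3
    exact hskip _ (fun hh => b3 hh.2.2.1) _
  · simp only [BExp.Holds, NExp.eval, hj] at b2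
    exact hskip _ (fun hh => b2 hh.2.1) _
  · simp only [BExp.Holds, NExp.eval, hj] at b1
    exact hskip _ (fun hh => b1 hh.1) _
  · simp only [BExp.cost, NExp.cost, newLoadE, boundE, guessE, loadE, QExp.cost]; omega

/-- Classes depend on the guess and are not stored: whether a job has class `c` is decided by
comparing its size with two constant multiples of the guess, which is what `Ctx.cls` justifies. -/
theorem runs_relaxCmd {v c : ℕ} (h : Ctx k d T s) (hr : Rep d s t) (hv : s.idx 7 0 = v)
    (hvV : v < d.V) (hc : c ≤ d.C) :
    Runs (relaxCmd k c) s (300 * (d.n + 1)) (fun s' => Agree (fun a => a ≤ 1 ∨ 7 ≤ a) s s' ∧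
      Rep d s' (d.relax (s.idx 8 0) (s.idx 9 0) (s.idx 10 0) c v t)) := by
  have eB : (boundE k).eval s = d.B := by
    simp only [boundE, guessE, QExp.eval, NExp.eval, h.guess, h.bound]
  unfold relaxCmd Data.relax
  refine Runs.le (Runs.cond (t' := 1) (fun b1 => Runs.cond (t := 250 * (d.n + 1)) (t' := 1)
    (fun b2 => ?_) (fun b2 => ?_)) (fun b1 => ?_)) ?_
  · simp only [BExp.Holds, eB, loadE, jobsE, QExp.eval, NExp.eval, hv, (hr v hvV).1,
      h.position c hc v hvV, h.jobs] at b1 b2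
    have hn : pos d.n c v < d.n := b2
    have hwV : v + (d.n + 1) ^ c < d.V := add_pow_lt hn (Nat.lt_succ_of_le hc) hvV
    have hne : v ≠ v + (d.n + 1) ^ c := by
      have : 0 < (d.n + 1) ^ c := by positivity
      omega
    rw [if_pos ⟨b1, hn⟩]
    refine Runs.le (Runs.seq (t' := 200 * (d.n + 1) + 30) (Runs.setN (Runs.le (Runs.seq
      (t' := 200 * (d.n + 1) + 20) (Runs.setN ?_)) ?_))) ?_
    · simp only [NExp.eval, State.setN_idx, hv, h.stride c hc, h.position c hc v hvV,
        show ¬ (7 = 5) by simp, show ¬ (100 + c = 5) by omega, false_and, if_false]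
      set s₁ := (s.setN 5 0 (v + (d.n + 1) ^ c)).setN 6 0 (pos d.n c v) with hs₁
      have ha : Agree (fun a => a ≤ 1 ∨ 7 ≤ a) s s₁ :=
        ((Agree.refl _ _).setN (by simp)).setN (by simp)
      have h₁ : Ctx k d T s₁ := h.agree (ha.mono fun a h => by omega)
      have hr₁ : Rep d s₁ t := (hr.setN (by simp)).setN (by simp)
      have hcls := h.cls _ hn c hc
      have i7 : s₁.idx 7 0 = v := by simpa [hs₁] using hv
      have i5 : s₁.idx 5 0 = v + (d.n + 1) ^ c := by simp [hs₁]
      have i6 : s₁.idx 6 0 = pos d.n c v := by simp [hs₁]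
      have hpass : Runs passJob s₁ (200 * (d.n + 1)) (fun s' =>
          Agree (fun a => a ≤ 1 ∨ 7 ≤ a) s s' ∧ Rep d s' (if t.D v < t.D (v + (d.n + 1) ^ c) then
            ⟨Function.update t.D (v + (d.n + 1) ^ c) (t.D v),
              Function.update t.A (v + (d.n + 1) ^ c) (t.A v)⟩ else t)) :=
        Runs.mono (runs_passJob h₁ hr₁ i7 i5 hvV hwV hne) (by omega)
          fun s' hs' => ⟨ha.trans hs'.1, hs'.2⟩
      refine Runs.le (Runs.cond (t' := 200 * (d.n + 1)) (fun b3 => Runs.cond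
        (t := 200 * (d.n + 1)) (t' := 200 * (d.n + 1)) (fun b4 => ?_) (fun b4 => ?_))
        (fun b3 => ?_)) ?_
      · simp only [BExp.Holds, guessE, QExp.eval, NExp.eval, i6, h₁.time, h₁.guess] at b3 b4
        have hn' : d.cls (pos d.n c v) ≠ c := fun hh => by linarith [(hcls.1 hh).1]
        rw [if_neg hn']
        exact hpass
      · simp only [BExp.Holds, guessE, QExp.eval, NExp.eval, i6, h₁.time, h₁.guess] at b3 b4
        rw [if_pos (hcls.2 ⟨not_le.1 b4, b3⟩)]
        refine Runs.mono (runs_takeJob h₁ hr₁ i7 i5 i6 hvV hwV hne hn) le_rfl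
          fun s' hs' => ⟨ha.trans hs'.1, ?_⟩
        simpa [hs₁] using hs'.2
      · simp only [BExp.Holds, guessE, QExp.eval, NExp.eval, i6, h₁.time, h₁.guess] at b3
        have hn' : d.cls (pos d.n c v) ≠ c := fun hh => b3 (hcls.1 hh).2
        rw [if_neg hn']
        exact hpass
      · simp only [BExp.cost, NExp.cost, guessE, QExp.cost]; omega
    · simp only [NExp.cost]; omega
    · simp only [NExp.cost]; omega
  · simp only [BExp.Holds, jobsE, NExp.eval, hv, h.position c hc v hvV, h.jobs] at b2
    rw [if_neg fun hh => b2 hh.2]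
    exact Runs.skip ⟨Agree.refl _ _, hr⟩
  · simp only [BExp.Holds, eB, loadE, QExp.eval, NExp.eval, hv, (hr v hvV).1] at b1
    rw [if_neg fun hh => b1 hh.1]
    exact Runs.skip ⟨Agree.refl _ _, hr⟩
  · simp only [BExp.cost, NExp.cost, jobsE, boundE, guessE, loadE, QExp.cost]; omega

end ConvexMakespan

/-! ### Running time of the whole dynamic program -/

namespace ConvexMakespan

open RAM

variable {k : ℕ} {d : Data} {T : ℚ} {s : State} {t : Tab}

/-- The number of cells of the table of assignments, up to a constant factor. -/
def Data.cells (d : Data) : ℕ := d.V * (d.n + 1)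

theorem Data.V_pos (d : Data) : 0 < d.V := by unfold Data.V; positivity

theorem Data.cells_pos (d : Data) : 0 < d.cells := Nat.mul_pos d.V_pos d.n.succ_pos

/-- The cost of a loop over all codes whose body takes time linear in `n`, the time for copying one
row. -/
theorem Data.loop_le_cells (d : Data) {x y : ℕ} (h : x ≤ y * (d.n + 1)) :
    (d.V + 1) * x ≤ 2 * y * d.cells := by
  have h1 : d.V + 1 ≤ 2 * d.V := by have := d.V_pos; omega
  calc (d.V + 1) * x ≤ (2 * d.V) * (y * (d.n + 1)) := Nat.mul_le_mul h1 h
    _ = 2 * y * d.cells := by unfold Data.cells; ring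

theorem runs_phaseCmd {c : ℕ} (h : Ctx k d T s) (hr : Rep d s t) (hc : c ≤ d.C) :
    Runs (phaseCmd k c) s (700 * d.cells) (fun s' => Agree (fun a => a ≤ 1 ∨ 8 ≤ a) s s' ∧
      Rep d s' (d.phase (s.idx 8 0) (s.idx 9 0) (s.idx 10 0) c t)) := by
  refine Runs.le (Runs.forTo (N := d.V) (t := 300 * (d.n + 1)) (fun a => a ≤ 1 ∨ 8 ≤ a)
    (fun i s' => Rep d s' (iter (d.relax (s.idx 8 0) (s.idx 9 0) (s.idx 10 0) c) i t))
    (by simp) (fun i s' x hJ => hJ.setN (by simp)) ?_ hr ?_) ?_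
  · intro s' ha
    rw [NExp.eval, ha.idx (by simp)]; exact h.codes
  · intro i s' hi ha hi' hJ
    have := runs_relaxCmd (h.agree (ha.mono fun a h => by omega)) hJ hi' hi hc
    rw [ha.idx (a := 8) (by simp), ha.idx (a := 9) (by simp), ha.idx (a := 10) (by simp)] at this
    refine this.mono le_rfl fun s'' hs'' => ⟨hs''.1.mono fun a h => by omega, ?_, hs''.2⟩
    rw [hs''.1.idx (by simp)]; exact hi'
  · exact (d.loop_le_cells (y := 350) (by simp only [NExp.cost]; omega)).trans (by omega)

theorem runs_phasesCmd (h : Ctx k d T s) (hr : Rep d s t) (q : ℕ) (hq : q ≤ d.C + 1) :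
    Runs (phasesCmd k q) s (q * (700 * d.cells) + 1)
      (fun s' => Agree (fun a => a ≤ 1 ∨ 8 ≤ a) s s' ∧
        Rep d s' (iter (d.phase (s.idx 8 0) (s.idx 9 0) (s.idx 10 0)) q t)) := by
  induction q with
  | zero => exact Runs.le (Runs.skip ⟨Agree.refl _ _, hr⟩) (by omega)
  | succ q ih =>
    refine Runs.le (Runs.seq (t' := 700 * d.cells) ((ih (by omega)).mono le_rfl ?_))
      (le_of_eq (by ring))
    rintro s' ⟨ha, hr'⟩
    have := runs_phaseCmd (h.agree (ha.mono fun a h => by omega)) hr' (c := q) (by omega)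
    rw [ha.idx (a := 8) (by simp), ha.idx (a := 9) (by simp), ha.idx (a := 10) (by simp)] at this
    exact this.mono le_rfl fun s'' hs'' => ⟨ha.trans hs''.1, hs''.2⟩

theorem runs_resetCmd (h : Ctx k d T s) (hr : Rep d s t) :
    Runs (resetCmd k) s (200 * d.cells) (fun s' => Agree (fun a => a ≤ 1 ∨ 8 ≤ a) s s' ∧
      Rep d s' (d.reset t)) := by
  refine Runs.le (Runs.forTo (N := d.V) (t := 40) (fun a => a ≤ 1 ∨ 8 ≤ a)
    (fun i s' => Rep d s' (iter d.resetAt i t))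
    (by simp) (fun i s' x hJ => hJ.setN (by simp)) ?_ hr ?_) ?_
  · intro s' ha
    rw [NExp.eval, ha.idx (by simp)]; exact h.codes
  · intro i s' hi ha hi' hJ
    have h' : Ctx k d T s' := h.agree (ha.mono fun a h => by omega)
    have eB : (boundE k).eval s' = d.B := by
      simp only [boundE, guessE, QExp.eval, NExp.eval, h'.guess, h'.bound]
    have eD : (loadE (NExp.var 7)).eval s' = (iter d.resetAt i t).D i := by
      simp only [loadE, QExp.eval, NExp.eval, hi', (hJ i hi).1]
    refine Runs.le (Runs.cond (t' := 1) (fun hb => Runs.setQ ?_) (fun hb => Runs.skip ?_)) ?_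
    · simp only [BExp.Holds, eB, eD] at hb
      refine ⟨(Agree.refl _ _).setQ (by simp), by simpa using hi', fun v hv => ?_⟩
      simp only [iter, Data.resetAt, if_pos hb, NExp.eval, QExp.eval, hi', State.setQ_val,
        State.setQ_idx, Function.update_apply, true_and, (hJ v hv).1]
      exact (hJ v hv).2
    · simp only [BExp.Holds, eB, eD] at hb
      refine ⟨Agree.refl _ _, hi', ?_⟩
      simpa only [iter, Data.resetAt, if_neg hb] using hJ
    · simp only [BExp.cost, NExp.cost, boundE, guessE, loadE, QExp.cost]; omega
  · exact (d.loop_le_cells (y := 100) (by simp only [NExp.cost]; omega)).trans (by omega)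

theorem runs_processCmd (h : Ctx k d T s) (hr : Rep d s t) :
    Runs (processCmd k d.C) s ((d.C + 2) * (1000 * d.cells))
      (fun s' => Agree (fun a => a ≤ 1 ∨ 8 ≤ a) s s' ∧
        Rep d s' (d.process (s.idx 8 0) (s.idx 9 0) (s.idx 10 0) t)) := by
  refine Runs.le (Runs.seq (t' := (d.C + 1) * (700 * d.cells) + 1)
    ((runs_resetCmd h hr).mono le_rfl ?_)) ?_
  · rintro s' ⟨ha, hr'⟩
    have := runs_phasesCmd (h.agree (ha.mono fun a h => by omega)) hr' (d.C + 1) le_rfl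
    rw [ha.idx (a := 8) (by simp), ha.idx (a := 9) (by simp), ha.idx (a := 10) (by simp)] at this
    exact this.mono le_rfl fun s'' hs'' => ⟨ha.trans hs''.1, hs''.2⟩
  · have := d.cells_pos
    nlinarith

theorem runs_sweepKeyCmd {κ : ℕ} (h : Ctx k d T s) (hr : Rep d s t) (hκ : s.idx 12 0 = κ) :
    Runs (sweepKeyCmd k d.C) s ((d.m + 1) * ((d.C + 2) * (1100 * d.cells)))
      (fun s' => Agree (fun a => a ≤ 1 ∨ 12 ≤ a) s s' ∧ Rep d s' (d.sweepKey κ t)) := by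
  refine Runs.le (Runs.forTo (N := d.m) (t := (d.C + 2) * (1000 * d.cells) + 50)
    (fun a => a ≤ 1 ∨ 12 ≤ a)
    (fun i s' => Rep d s' (iter (fun i t => if d.L i + d.R i = κ then
      d.process i (d.L i) (d.R i) t else t) i t))
    (by simp) (fun i s' x hJ => hJ.setN (by simp)) ?_ hr ?_) ?_
  · intro s' ha
    rw [NExp.eval, ha.idx (by simp)]; exact h.machines
  · intro i s' hi ha hi' hJ
    have h' : Ctx k d T s' := h.agree (ha.mono fun a h => by omega)
    have hκ' : s'.idx 12 0 = κ := by rw [ha.idx (by simp)]; exact hκ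
    have e : keyE.eval s' = d.L i + d.R i := by
      simp only [keyE, NExp.eval, hi', h'.left, h'.right]
    simp only [iter]
    refine Runs.le (Runs.cond (t' := 1) (fun b1 => Runs.cond
      (t := (d.C + 2) * (1000 * d.cells) + 20) (t' := 1) (fun b2 => ?_)
      (fun b2 => Runs.skip ?_)) (fun b1 => Runs.skip ?_)) ?_
    · simp only [BExp.Holds, e, NExp.eval, hκ'] at b1 b2
      rw [if_pos (le_antisymm b1 b2)]
      refine Runs.le (Runs.seq (t' := (d.C + 2) * (1000 * d.cells) + 15) (Runs.setN
        (Runs.le (Runs.seq (t' := (d.C + 2) * (1000 * d.cells) + 10) (Runs.setN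
        (Runs.le (Runs.seq (t' := (d.C + 2) * (1000 * d.cells)) (Runs.setN ?_)) ?_))) ?_))) ?_
      · simp only [NExp.eval, State.setN_idx, hi', h'.left, h'.right,
          show ¬ (11 = 8) by simp, show ¬ (11 = 9) by simp, show ¬ (20 = 8) by simp,
          show ¬ (21 = 8) by simp, show ¬ (21 = 9) by simp, false_and, if_false]
        set s₁ := ((s'.setN 8 0 i).setN 9 0 (d.L i)).setN 10 0 (d.R i) with hs₁
        have ha₁ : Agree (fun a => a ≤ 1 ∨ 11 ≤ a) s' s₁ :=
          (((Agree.refl _ _).setN (by simp)).setN (by simp)).setN (by simp)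
        have hr₁ : Rep d s₁ _ := ((hJ.setN (by simp)).setN (by simp)).setN (by simp)
        refine (runs_processCmd (h'.agree (ha₁.mono fun a h => by omega)) hr₁).mono le_rfl ?_
        rintro s'' ⟨ha₂, hr₂⟩
        refine ⟨(ha₁.mono fun a h => by omega).trans (ha₂.mono fun a h => by omega), ?_, ?_⟩
        · rw [ha₂.idx (by simp), ha₁.idx (by simp)]; exact hi'
        · simpa [hs₁] using hr₂
      all_goals simp only [NExp.cost]; omega
    · simp only [BExp.Holds, e, NExp.eval, hκ'] at b2
      rw [if_neg fun hh => b2 hh.ge]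
      exact ⟨Agree.refl _ _, hi', hJ⟩
    · simp only [BExp.Holds, e, NExp.eval, hκ'] at b1
      rw [if_neg fun hh => b1 hh.le]
      exact ⟨Agree.refl _ _, hi', hJ⟩
    · simp only [BExp.cost, NExp.cost, keyE]; omega
  · refine Nat.mul_le_mul_left _ ?_
    have := d.cells_pos
    simp only [NExp.cost]
    nlinarith

/-- Scanning all machines once for each key replaces sorting. The bound generously charges a full
processing to every pair of a key and a machine; the extra factor of order `n` is affordable. -/
theorem runs_sweepCmd (h : Ctx k d T s) (hr : Rep d s t) :
    Runs (sweepCmd k d.C) s ((d.n + 1) * ((d.m + 1) * ((d.C + 2) * (2400 * d.cells))))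
      (fun s' => Agree (fun a => a ≤ 1 ∨ 13 ≤ a) s s' ∧ Rep d s' (d.sweep t)) := by
  refine Runs.le (Runs.forTo (N := 2 * d.n + 1)
    (t := (d.m + 1) * ((d.C + 2) * (1100 * d.cells)))
    (fun a => a ≤ 1 ∨ 13 ≤ a) (fun i s' => Rep d s' (iter d.sweepKey i t))
    (by simp) (fun i s' x hJ => hJ.setN (by simp)) ?_ hr ?_) ?_
  · intro s' ha
    simp only [jobsE, NExp.eval]
    rw [ha.idx (by simp), h.jobs]
    ring
  · intro i s' hi ha hi' hJ
    refine (runs_sweepKeyCmd (h.agree (ha.mono fun a h => by omega)) hJ hi').mono le_rfl ?_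
    rintro s'' ⟨ha', hr'⟩
    refine ⟨ha'.mono fun a h => by omega, ?_, hr'⟩
    rw [ha'.idx (by simp)]; exact hi'
  · have h1 : 1 ≤ (d.m + 1) * ((d.C + 2) * d.cells) :=
      Nat.mul_pos (by omega) (Nat.mul_pos (by omega) d.cells_pos)
    have e1 : (d.m + 1) * ((d.C + 2) * (1100 * d.cells)) =
      1100 * ((d.m + 1) * ((d.C + 2) * d.cells)) := by ring
    have e2 : (d.m + 1) * ((d.C + 2) * (2400 * d.cells)) =
      2400 * ((d.m + 1) * ((d.C + 2) * d.cells)) := by ring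
    rw [e1, e2]
    simp only [NExp.cost, jobsE]
    generalize (d.m + 1) * ((d.C + 2) * d.cells) = Z at *
    nlinarith

theorem runs_startCmd (h : Ctx k d T s) :
    Runs (startCmd k) s (200 * d.cells) (fun s' => Agree (fun a => a ≤ 1 ∨ 13 ≤ a) s s' ∧
      Rep d s' (d.start fun v j => s.idx 3 (v * d.n + j))) := by
  refine Runs.le (Runs.seq (t' := 10) (Runs.mono (Runs.forTo (N := d.V) (t := 20)
    (fun a => a ≤ 1 ∨ 8 ≤ a)
    (fun i s' => s'.idx 3 = s.idx 3 ∧ ∀ v < i, s'.val 2 v = d.B + 1)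
    (by simp) ?_ ?_ ⟨rfl, by simp⟩ ?_) le_rfl ?_)) ?_
  · rintro i s' x ⟨h1, h2⟩
    exact ⟨by funext j; simp [h1], h2⟩
  · intro s' ha
    rw [NExp.eval, ha.idx (by simp)]; exact h.codes
  · rintro i s' hi ha hi' ⟨J1, J2⟩
    have h' : Ctx k d T s' := h.agree (ha.mono fun a h => by omega)
    have eB : (boundE k).eval s' = d.B := by
      simp only [boundE, guessE, QExp.eval, NExp.eval, h'.guess, h'.bound]
    refine Runs.le (Runs.setQ ?_)
      (by simp only [NExp.cost, QExp.cost, boundE, guessE]; omega)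
    refine ⟨(Agree.refl _ _).setQ (by simp), by simpa using hi', J1, fun v hv => ?_⟩
    simp only [NExp.eval, QExp.eval, hi', State.setQ_val, eB]
    by_cases hvi : v = i
    · simp [hvi]
    · simp [hvi, J2 v (by omega)]
  · rintro s' ⟨ha, J1, J2⟩
    refine Runs.le (Runs.setQ ?_) (by simp [NExp.cost, QExp.cost])
    refine ⟨(ha.mono fun a h => by omega).setQ (by simp), fun v hv => ⟨?_, fun j _ => ?_⟩⟩
    · simp [NExp.eval, QExp.eval, Data.start, J2 v hv]
    · simp [Data.start, J1]
  · have h1 := d.loop_le_cells (x := 20 + (NExp.var 23).cost + 11) (y := 50)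
      (by simp only [NExp.cost]; omega)
    have := d.cells_pos
    omega

/-- The initial rows are whatever the memory contains, possibly remains of an earlier attempt. This
is harmless, since soundness and completeness hold for arbitrary initial rows. -/
theorem runs_solveCmd (h : Ctx k d T s) :
    Runs (solveCmd k d.C) s ((d.n + 1) * ((d.m + 1) * ((d.C + 2) * (4000 * d.cells))))
      (fun s' => Agree (fun a => a ≤ 1 ∨ 13 ≤ a) s s' ∧
        Rep d s' (d.solve fun v j => s.idx 3 (v * d.n + j))) := by
  have hmid : ∀ s₂ : State, Agree (fun a => a ≤ 1 ∨ 13 ≤ a) s s₂ →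
      Rep d s₂ (d.sweep (d.start fun v j => s.idx 3 (v * d.n + j))) →
      Runs (Cmd.seq (Cmd.setN 8 (NExp.const 0) (NExp.var 0))
      (Cmd.seq (Cmd.setN 9 (NExp.const 0) (NExp.const 1))
        (Cmd.seq (Cmd.setN 10 (NExp.const 0) (NExp.const 0)) (processCmd k d.C)))) s₂
        ((d.C + 2) * (1000 * d.cells) + 30) (fun s' => Agree (fun a => a ≤ 1 ∨ 13 ≤ a) s s' ∧
        Rep d s' (d.solve fun v j => s.idx 3 (v * d.n + j))) := by
    intro s₂ ha₂ hr₂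
    have h₂ : Ctx k d T s₂ := h.agree (ha₂.mono fun a h => by omega)
    refine Runs.le (Runs.seq (t' := (d.C + 2) * (1000 * d.cells) + 15) (Runs.setN
      (Runs.le (Runs.seq (t' := (d.C + 2) * (1000 * d.cells) + 10) (Runs.setN
      (Runs.le (Runs.seq (t' := (d.C + 2) * (1000 * d.cells)) (Runs.setN ?_)) ?_))) ?_))) ?_
    · simp only [NExp.eval, h₂.machines]
      set s₃ := ((s₂.setN 8 0 d.m).setN 9 0 1).setN 10 0 0 with hs₃
      have ha₃ : Agree (fun a => a ≤ 1 ∨ 11 ≤ a) s₂ s₃ :=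
        (((Agree.refl _ _).setN (by simp)).setN (by simp)).setN (by simp)
      have hr₃ : Rep d s₃ _ := ((hr₂.setN (by simp)).setN (by simp)).setN (by simp)
      refine (runs_processCmd (h₂.agree (ha₃.mono fun a h => by omega)) hr₃).mono le_rfl ?_
      rintro s'' ⟨ha₄, hr₄⟩
      refine ⟨ha₂.trans ((ha₃.mono fun a h => by omega).trans (ha₄.mono fun a h => by omega)), ?_⟩
      simpa [hs₃, Data.solve] using hr₄
    all_goals simp only [NExp.cost]; omega
  refine Runs.le (Runs.seq (t' := (d.n + 1) * ((d.m + 1) * ((d.C + 2) * (2400 * d.cells))) +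
    ((d.C + 2) * (1000 * d.cells) + 30)) ((runs_startCmd h).mono le_rfl ?_)) ?_
  · rintro s₁ ⟨ha₁, hr₁⟩
    refine Runs.seq ((runs_sweepCmd (h.agree (ha₁.mono fun a h => by omega)) hr₁).mono le_rfl ?_)
    rintro s₂ ⟨ha₂, hr₂⟩
    exact hmid s₂ (ha₁.trans ha₂) hr₂
  · have h1 := d.cells_pos
    have h2 : d.cells ≤ (d.C + 2) * d.cells := Nat.le_mul_of_pos_left _ (by omega)
    have h3 : (d.C + 2) * d.cells ≤ (d.n + 1) * ((d.m + 1) * ((d.C + 2) * d.cells)) :=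
      (Nat.le_mul_of_pos_left _ (by omega)).trans (Nat.le_mul_of_pos_left _ (by omega))
    have e1 : (d.n + 1) * ((d.m + 1) * ((d.C + 2) * (2400 * d.cells))) =
      2400 * ((d.n + 1) * ((d.m + 1) * ((d.C + 2) * d.cells))) := by ring
    have e2 : (d.n + 1) * ((d.m + 1) * ((d.C + 2) * (4000 * d.cells))) =
      4000 * ((d.n + 1) * ((d.m + 1) * ((d.C + 2) * d.cells))) := by ring
    have e3 : (d.C + 2) * (1000 * d.cells) = 1000 * ((d.C + 2) * d.cells) := by ring
    rw [e1, e2, e3]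
    omega

end ConvexMakespan

/-! ### Preprocessing

The rational array 25 holds the largest processing time. -/

namespace ConvexMakespan

open RAM

section Programs

variable (C : ℕ)

def maxE : QExp := QExp.get 25 (NExp.const 0)

def maxCmd : Cmd :=
  Cmd.forTo 4 jobsE (Cmd.cond (BExp.leQ (QExp.get 0 (NExp.var 4)) maxE) Cmd.skip
    (Cmd.setQ 25 (NExp.const 0) (QExp.get 0 (NExp.var 4))))

/-- Read one entry of the adjacency matrix. -/
def scanCmd : Cmd :=
  Cmd.seq (Cmd.cond (BExp.leN (NExp.const 1) (NExp.get 1 (NExp.var 5)))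
    (Cmd.setN 21 (NExp.var 11) (NExp.add (NExp.var 4) (NExp.const 1)))
    (Cmd.cond (BExp.leN (NExp.get 21 (NExp.var 11)) (NExp.const 0))
      (Cmd.setN 20 (NExp.var 11) (NExp.add (NExp.var 4) (NExp.const 1))) Cmd.skip))
    (Cmd.setN 5 (NExp.const 0) (NExp.add (NExp.var 5) (NExp.const 1)))

def intervalsCmd : Cmd := Cmd.forTo 11 (NExp.var 0) (Cmd.forTo 4 jobsE scanCmd)

/-- Stored numbers cannot be multiplied, so each power arises from the previous one by `n + 1`
additions. -/
def stridesCmd : ℕ → Cmd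
  | 0 => Cmd.setN 22 (NExp.const 0) (NExp.const 1)
  | q + 1 => Cmd.seq (stridesCmd q) (Cmd.seq (Cmd.setN 22 (NExp.const (q + 1)) (NExp.const 0))
      (Cmd.forTo 4 (NExp.add jobsE (NExp.const 1)) (Cmd.setN 22 (NExp.const (q + 1))
        (NExp.add (NExp.get 22 (NExp.const (q + 1))) (NExp.get 22 (NExp.const q))))))

/-- The digit of a code one stride ahead follows from the digit of the present code by a comparison,
which avoids division. -/
def positionsCmd : ℕ → Cmd
  | 0 => Cmd.skip
  | q + 1 => Cmd.seq (positionsCmd q)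
      (Cmd.cond (BExp.leN (NExp.add (NExp.get (100 + q) (NExp.var 7)) (NExp.const 1)) jobsE)
        (Cmd.setN (100 + q) (NExp.add (NExp.var 7) (NExp.get 22 (NExp.const q)))
          (NExp.add (NExp.get (100 + q) (NExp.var 7)) (NExp.const 1)))
        (Cmd.setN (100 + q) (NExp.add (NExp.var 7) (NExp.get 22 (NExp.const q)))
          (NExp.const 0)))

def tablesCmd : Cmd :=
  Cmd.forTo 7 (NExp.var 23) (Cmd.seq (Cmd.setN 24 (NExp.add (NExp.var 7) (NExp.const 1))
    (NExp.add (NExp.get 24 (NExp.var 7)) jobsE)) (positionsCmd (C + 1)))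

def prepareCmd : Cmd :=
  Cmd.seq maxCmd (Cmd.seq intervalsCmd (Cmd.seq (stridesCmd (C + 1))
    (Cmd.seq (Cmd.setN 23 (NExp.const 0) (NExp.get 22 (NExp.const (C + 1)))) (tablesCmd C))))

end Programs

variable {m n C : ℕ} {s : State}

theorem runs_maxCmd (hn : s.idx 0 1 = n) (h0 : s.val 25 0 = 0) :
    Runs maxCmd s (50 * (n + 1)) (fun s' => Agree (fun a => a ≠ 4 ∧ a ≠ 25) s s' ∧
      (∀ j < n, s.val 0 j ≤ s'.val 25 0) ∧ (s'.val 25 0 = 0 ∨ ∃ j < n, s'.val 25 0 = s.val 0 j)) := by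
  refine Runs.le (Runs.forTo (N := n) (t := 20) (fun a => a ≠ 4 ∧ a ≠ 25)
    (fun i s' => (∀ j < i, s.val 0 j ≤ s'.val 25 0) ∧
      (s'.val 25 0 = 0 ∨ ∃ j < n, s'.val 25 0 = s.val 0 j))
    (by simp) (fun i s' x hJ => by simpa using hJ) ?_ ⟨by simp, Or.inl h0⟩ ?_) ?_
  · intro s' ha
    simp only [jobsE, NExp.eval]
    rw [ha.idx (by simp)]; exact hn
  · rintro i s' hi ha hi' ⟨J1, J2⟩
    have e0 : s'.val 0 = s.val 0 := ha.val (by simp)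
    refine Runs.le (Runs.cond (fun hb => Runs.skip ?_) (fun hb => Runs.setQ ?_)) ?_
    · simp only [BExp.Holds, maxE, QExp.eval, NExp.eval, hi', e0] at hb
      refine ⟨Agree.refl _ _, hi', fun j hj => ?_, J2⟩
      rcases Nat.lt_succ_iff_lt_or_eq.1 hj with h | rfl
      · exact J1 j h
      · exact hb
    · simp only [BExp.Holds, maxE, QExp.eval, NExp.eval, hi', e0] at hb
      refine ⟨(Agree.refl _ _).setQ (by simp), by simpa using hi', fun j hj => ?_,
        Or.inr ⟨i, hi, by simp [NExp.eval, QExp.eval, hi', e0]⟩⟩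
      simp only [NExp.eval, QExp.eval, hi', e0, State.setQ_val, true_and, if_true]
      rcases Nat.lt_succ_iff_lt_or_eq.1 hj with h | rfl
      · exact (J1 j h).trans (not_le.1 hb).le
      · exact le_rfl
    · simp only [BExp.cost, maxE, NExp.cost, QExp.cost]; omega
  · simp only [jobsE, NExp.cost]; omega

/-- `l` and `r` are the ends of the interval of the elements `j < q` of `E`. -/
def Ends (E : ℕ → Prop) (q l r : ℕ) : Prop :=
  (∀ j < q, E j → l ≤ j ∧ j < r) ∧ (r = 0 → l = q) ∧
    (0 < r → l < r ∧ r ≤ q ∧ E l ∧ E (r - 1)) ∧ l ≤ q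

/-- The value `r = 0` means that no neighbour has been seen. Until then `l` keeps up with the scan,
so at the first neighbour it already has the right value. -/
theorem runs_scanCmd {E : ℕ → ℕ → Prop} {i j : ℕ} (hi : s.idx 11 0 = i) (hj : s.idx 4 0 = j)
    (hp : s.idx 5 0 = i * n + j) (hE : E i j ↔ 1 ≤ s.idx 1 (i * n + j))
    (h : Ends (E i) j (s.idx 20 i) (s.idx 21 i)) :
    Runs scanCmd s 60 (fun s' => Agree (fun a => a ≠ 5 ∧ a ≠ 20 ∧ a ≠ 21) s s' ∧
      s'.idx 5 0 = i * n + (j + 1) ∧ Ends (E i) (j + 1) (s'.idx 20 i) (s'.idx 21 i) ∧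
      ∀ i', i' ≠ i → s'.idx 20 i' = s.idx 20 i' ∧ s'.idx 21 i' = s.idx 21 i') := by
  obtain ⟨h1, h2, h3, h4⟩ := h
  refine Runs.le (Runs.seq (t' := 10) (Runs.cond (fun hb => Runs.setN ?_) (fun hb => Runs.cond
    (fun hb' => Runs.setN ?_) (fun hb' => Runs.skip ?_)))) ?_
  · simp only [BExp.Holds, NExp.eval, hp, ← hE] at hb
    refine Runs.le (Runs.setN ?_) (by simp [NExp.cost])
    refine ⟨((Agree.refl _ _).setN (by simp)).setN (by simp),
      by simp [NExp.eval, hp, add_assoc], ?_, ?_⟩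
    · simp only [NExp.eval, hi, hj, State.setN_idx]
      simp only [show ¬ (20 = 5) by simp, show ¬ (20 = 21) by simp, show ¬ (21 = 5) by simp,
        false_and, if_false, true_and, if_true]
      refine ⟨fun j' hj' hE' => ?_, by omega, fun _ => ?_, by omega⟩
      · rcases Nat.lt_succ_iff_lt_or_eq.1 hj' with h | rfl
        · exact ⟨(h1 j' h hE').1, by omega⟩
        · exact ⟨h4, by omega⟩
      · refine ⟨by omega, le_rfl, ?_, by simpa using hb⟩
        rcases Nat.eq_zero_or_pos (s.idx 21 i) with h0 | h0
        · rw [h2 h0]; exact hb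
        · exact (h3 h0).2.2.1
    · intro i' hi'
      simp [NExp.eval, hi, hi']
  · simp only [BExp.Holds, NExp.eval, hp, ← hE] at hb
    simp only [BExp.Holds, NExp.eval, hi] at hb'
    have h0 : s.idx 21 i = 0 := by omega
    refine Runs.le (Runs.setN ?_) (by simp [NExp.cost])
    refine ⟨((Agree.refl _ _).setN (by simp)).setN (by simp),
      by simp [NExp.eval, hp, add_assoc], ?_, ?_⟩
    · simp only [NExp.eval, hi, hj, State.setN_idx]
      simp only [show ¬ (20 = 5) by simp, show ¬ (21 = 20) by simp, show ¬ (21 = 5) by simp,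
        false_and, if_false, true_and, if_true, h0]
      refine ⟨fun j' hj' hE' => ?_, by omega, by omega, by omega⟩
      rcases Nat.lt_succ_iff_lt_or_eq.1 hj' with h | rfl
      · have := (h1 j' h hE').2
        omega
      · exact absurd hE' hb
    · intro i' hi'
      simp [NExp.eval, hi, hi']
  · simp only [BExp.Holds, NExp.eval, hp, ← hE] at hb
    simp only [BExp.Holds, NExp.eval, hi] at hb'
    refine Runs.le (Runs.setN ?_) (by simp [NExp.cost])
    refine ⟨(Agree.refl _ _).setN (by simp), by simp [NExp.eval, hp, add_assoc], ?_, ?_⟩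
    · simp only [NExp.eval, State.setN_idx]
      simp only [show ¬ (20 = 5) by simp, show ¬ (21 = 5) by simp, false_and, if_false]
      refine ⟨fun j' hj' hE' => ?_, by omega, fun h0 => ?_, by omega⟩
      · rcases Nat.lt_succ_iff_lt_or_eq.1 hj' with h | rfl
        · exact h1 j' h hE'
        · exact absurd hE' hb
      · have := h3 h0
        exact ⟨this.1, by omega, this.2.2⟩
    · intro i' _
      simp [NExp.eval]
  · simp only [BExp.cost, NExp.cost]; omega

/-- The address `i * n + j` is never computed: cell 0 of array 5 runs through the matrix row by row.
-/
theorem runs_intervalsCmd {E : ℕ → ℕ → Prop} (hm : s.idx 0 0 = m) (hn : s.idx 0 1 = n)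
    (hp : s.idx 5 0 = 0) (hE : ∀ i < m, ∀ j < n, (E i j ↔ 1 ≤ s.idx 1 (i * n + j)))
    (h20 : ∀ i, s.idx 20 i = 0) (h21 : ∀ i, s.idx 21 i = 0) :
    Runs intervalsCmd s ((m + 1) * (100 * (n + 1)))
      (fun s' => Agree (fun a => a ≠ 4 ∧ a ≠ 5 ∧ a ≠ 11 ∧ a ≠ 20 ∧ a ≠ 21) s s' ∧
        ∀ i < m, Ends (E i) n (s'.idx 20 i) (s'.idx 21 i)) := by
  refine Runs.mono (Runs.forTo (N := m) (t := 80 * (n + 1))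
    (fun a => a ≠ 4 ∧ a ≠ 5 ∧ a ≠ 11 ∧ a ≠ 20 ∧ a ≠ 21)
    (fun i s' => s'.idx 5 0 = i * n ∧ (∀ i' < i, Ends (E i') n (s'.idx 20 i') (s'.idx 21 i')) ∧
      ∀ i', i ≤ i' → s'.idx 20 i' = 0 ∧ s'.idx 21 i' = 0)
    (by simp) (fun i s' x hJ => by simpa using hJ) ?_ ?_ ?_) ?_ ?_
  · intro s' ha
    rw [NExp.eval, ha.idx (by simp)]; exact hm
  · simp [hp, h20, h21]
  · rintro i s₁ hi ha hi' ⟨J1, J2, J3⟩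
    refine Runs.mono (Runs.forTo (N := n) (t := 60)
      (fun a => a ≠ 4 ∧ a ≠ 5 ∧ a ≠ 20 ∧ a ≠ 21)
      (fun j s' => s'.idx 5 0 = i * n + j ∧ Ends (E i) j (s'.idx 20 i) (s'.idx 21 i) ∧
        ∀ i', i' ≠ i → s'.idx 20 i' = s₁.idx 20 i' ∧ s'.idx 21 i' = s₁.idx 21 i')
      (by simp) (fun i s' x hJ => by simpa using hJ) ?_ ?_ ?_) ?_ ?_
    · intro s' ha'
      simp only [jobsE, NExp.eval]
      rw [ha'.idx (by simp), ha.idx (by simp)]; exact hn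
    · refine ⟨by simpa using J1, ?_, fun _ _ => ⟨rfl, rfl⟩⟩
      simp [Ends, J3 i le_rfl]
    · rintro j s₂ hj ha' hj' ⟨K1, K2, K3⟩
      have hE' : E i j ↔ 1 ≤ s₂.idx 1 (i * n + j) := by
        rw [ha'.idx (by simp), ha.idx (by simp)]; exact hE i hi j hj
      have hi₂ : s₂.idx 11 0 = i := by rw [ha'.idx (by simp)]; exact hi'
      refine (runs_scanCmd hi₂ hj' K1 hE' K2).mono le_rfl ?_
      rintro s₃ ⟨L1, L2, L3, L4⟩
      refine ⟨L1.mono fun a h => ⟨h.2.1, h.2.2⟩, ?_, L2, L3, fun i' hi'' => ?_⟩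
      · rw [L1.idx (by simp)]; exact hj'
      · exact ⟨(L4 i' hi'').1.trans (K3 i' hi'').1, (L4 i' hi'').2.trans (K3 i' hi'').2⟩
    · simp only [jobsE, NExp.cost]; omega
    · rintro s₂ ⟨ha', K1, K2, K3⟩
      refine ⟨ha'.mono fun a h => ⟨h.1, h.2.1, h.2.2.2⟩, ?_, ?_, ?_, ?_⟩
      · rw [ha'.idx (by simp)]; exact hi'
      · rw [K1]; ring
      · intro i' hi''
        by_cases h : i' = i
        · subst h; exact K2
        · rw [(K3 i' h).1, (K3 i' h).2]; exact J2 i' (by omega)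
      · intro i' hi''
        rw [(K3 i' (by omega)).1, (K3 i' (by omega)).2]; exact J3 i' (by omega)
  · simp only [NExp.cost]
    exact Nat.mul_le_mul_left _ (by omega)
  · rintro s' ⟨h1, -, h2, -⟩
    exact ⟨h1, h2⟩

theorem runs_stridesCmd (hn : s.idx 0 1 = n) (q : ℕ) :
    Runs (stridesCmd q) s ((q + 1) * (100 * (n + 1)))
      (fun s' => Agree (fun a => a ≠ 4 ∧ a ≠ 22) s s' ∧ ∀ c ≤ q, s'.idx 22 c = (n + 1) ^ c) := by
  induction q with
  | zero =>
    refine Runs.le (Runs.setN ⟨(Agree.refl _ _).setN (by simp), ?_⟩)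
      (by simp only [NExp.cost]; omega)
    simp [NExp.eval]
  | succ q ih =>
    refine Runs.le (Runs.seq (t' := 100 * (n + 1)) (ih.mono le_rfl ?_)) (le_of_eq (by ring))
    rintro s₁ ⟨ha, h⟩
    refine Runs.le (Runs.seq (t' := (n + 2) * 40) (Runs.setN ?_))
      (by simp only [NExp.cost]; omega)
    simp only [NExp.eval]
    have ha₁ : Agree (fun a => a ≠ 4 ∧ a ≠ 22) s (s₁.setN 22 (q + 1) 0) := ha.setN (by simp)
    refine Runs.mono (Runs.forTo (N := n + 1) (t := 15) (fun a => a ≠ 4 ∧ a ≠ 22)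
      (fun i s' => s'.idx 22 (q + 1) = i * (n + 1) ^ q ∧ ∀ c ≤ q, s'.idx 22 c = (n + 1) ^ c)
      (by simp) (fun i s' x hJ => by simpa using hJ) ?_ ?_ ?_) ?_ ?_
    · intro s' ha'
      simp only [jobsE, NExp.eval]
      rw [(ha₁.trans ha').idx (by simp), hn]
    · refine ⟨by simp, fun c hc => ?_⟩
      rw [State.setN_idx, if_neg (by omega)]
      exact h c hc
    · rintro i s' hi ha' hi' ⟨J1, J2⟩
      refine Runs.le (Runs.setN ?_) (by simp [NExp.cost])
      refine ⟨(Agree.refl _ _).setN (by simp), by simpa using hi', ?_, fun c hc => ?_⟩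
      · simp [NExp.eval, J1, J2 q le_rfl]; ring
      · simp only [NExp.eval, State.setN_idx]
        rw [if_neg (by omega)]
        exact J2 c hc
    · simp only [jobsE, NExp.cost]; omega
    · rintro s' ⟨ha', J1, J2⟩
      refine ⟨ha₁.trans ha', fun c hc => ?_⟩
      rcases Nat.le_succ_iff.1 hc with h' | rfl
      · exact J2 c h'
      · rw [J1, pow_succ]; ring

theorem runs_positionsCmd {v : ℕ} (hn : s.idx 0 1 = n) (hv : s.idx 7 0 = v)
    (hS : ∀ c ≤ C, s.idx 22 c = (n + 1) ^ c)
    (h : ∀ c ≤ C, ∀ u < v + (n + 1) ^ c, s.idx (100 + c) u = pos n c u) (q : ℕ) (hq : q ≤ C + 1) :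
    Runs (positionsCmd q) s (q * 50 + 1) (fun s' => Agree (fun a => a < 100) s s' ∧
      ∀ c ≤ C, ∀ u, (u < v + (n + 1) ^ c ∨ c < q ∧ u = v + (n + 1) ^ c) →
        s'.idx (100 + c) u = pos n c u) := by
  induction q with
  | zero => exact Runs.skip ⟨Agree.refl _ _, fun c hc u hu => h c hc u (by omega)⟩
  | succ q ih =>
    refine Runs.le (Runs.seq (t' := 50) ((ih (by omega)).mono le_rfl ?_)) (by omega)
    rintro s₁ ⟨ha, h₁⟩
    have hn₁ : s₁.idx 0 1 = n := by rw [ha.idx (by simp)]; exact hn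
    have hv₁ : s₁.idx 7 0 = v := by rw [ha.idx (by simp)]; exact hv
    have hS₁ : s₁.idx 22 q = (n + 1) ^ q := by
      rw [ha.idx (by simp)]; exact hS q (by omega)
    have hpq : s₁.idx (100 + q) v = pos n q v :=
      h₁ q (by omega) v (Or.inl (Nat.lt_add_of_pos_right (by positivity)))
    have step : ∀ x, x = pos n q (v + (n + 1) ^ q) →
        Agree (fun a => a < 100) s (s₁.setN (100 + q) (v + (n + 1) ^ q) x) ∧
        ∀ c ≤ C, ∀ u, (u < v + (n + 1) ^ c ∨ c < q + 1 ∧ u = v + (n + 1) ^ c) →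
          (s₁.setN (100 + q) (v + (n + 1) ^ q) x).idx (100 + c) u = pos n c u := by
      rintro x rfl
      refine ⟨ha.setN (by simp), fun c hc u hu => ?_⟩
      rw [State.setN_idx]
      split_ifs with hh
      · obtain ⟨hcq, rfl⟩ := hh
        obtain rfl : c = q := by omega
        rfl
      · refine h₁ c hc u ?_
        rcases hu with hu | ⟨hu1, hu2⟩
        · exact Or.inl hu
        · refine Or.inr ⟨?_, hu2⟩
          rcases Nat.lt_succ_iff_lt_or_eq.1 hu1 with h' | rfl
          · exact h'
          · exact absurd ⟨rfl, hu2⟩ hh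
    refine Runs.le (Runs.cond (fun hb => Runs.setN ?_) (fun hb => Runs.setN ?_)) ?_
    · simp only [BExp.Holds, NExp.eval, jobsE, hv₁, hpq, hn₁] at hb
      simp only [NExp.eval, hv₁, hS₁, hpq]
      exact step _ (pos_add_self hb).symm
    · simp only [BExp.Holds, NExp.eval, jobsE, hv₁, hpq, hn₁] at hb
      simp only [NExp.eval, hv₁, hS₁]
      exact step _ (pos_add_self_of_eq hb).symm
    · simp only [BExp.cost, NExp.cost, jobsE]; omega

/-- When code `i` is reached, the digits in place `c` are correct for all codes below `i + (n + 1) ^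
c`. At the start these digits are 0, like the memory. -/
theorem runs_tablesCmd {V : ℕ} (hn : s.idx 0 1 = n) (hV : s.idx 23 0 = V)
    (hS : ∀ c ≤ C, s.idx 22 c = (n + 1) ^ c) (h0 : s.idx 24 0 = 0)
    (h : ∀ c ≤ C, ∀ u, s.idx (100 + c) u = 0) :
    Runs (tablesCmd C) s ((V + 1) * (C * 50 + 100))
      (fun s' => Agree (fun a => a ≠ 7 ∧ a ≠ 24 ∧ a < 100) s s' ∧
        (∀ v ≤ V, s'.idx 24 v = v * n) ∧
        ∀ c ≤ C, ∀ u < V, s'.idx (100 + c) u = pos n c u) := by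
  refine Runs.mono (Runs.forTo (N := V) (t := C * 50 + 80) (fun a => a ≠ 7 ∧ a ≠ 24 ∧ a < 100)
    (fun i s' => (∀ v ≤ i, s'.idx 24 v = v * n) ∧
      ∀ c ≤ C, ∀ u < i + (n + 1) ^ c, s'.idx (100 + c) u = pos n c u)
    (by simp) ?_ ?_ ?_ ?_) ?_ ?_
  · rintro i s' x ⟨h1, h2⟩
    refine ⟨by simpa using h1, fun c hc u hu => ?_⟩
    rw [State.setN_idx, if_neg (by omega)]
    exact h2 c hc u hu
  · intro s' ha
    rw [NExp.eval, ha.idx (by simp)]; exact hV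
  · refine ⟨fun v hv => ?_, fun c hc u hu => ?_⟩
    · obtain rfl : v = 0 := by omega
      simpa using h0
    · rw [h c hc, pos_of_lt (by omega)]
  · rintro i s₁ hi ha hi' ⟨J1, J2⟩
    have hn₁ : s₁.idx 0 1 = n := by rw [ha.idx (by simp)]; exact hn
    refine Runs.le (Runs.seq (t' := (C + 1) * 50 + 1) (Runs.setN ?_))
      (by simp only [NExp.cost, jobsE]; omega)
    simp only [NExp.eval, jobsE, hi', hn₁, J1 i le_rfl]
    have ha₂ : Agree (fun a => a ≠ 24) s₁ (s₁.setN 24 (i + 1) (i * n + n)) :=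
      (Agree.refl _ _).setN (by simp)
    refine (runs_positionsCmd (n := n) (C := C) (v := i) (by simpa using hn₁) (by simpa using hi')
      ?_ ?_ (C + 1) le_rfl).mono le_rfl ?_
    · intro c hc
      rw [ha₂.idx (by simp), ha.idx (by simp)]
      exact hS c hc
    · intro c hc u hu
      rw [ha₂.idx (by omega)]
      exact J2 c hc u hu
    · rintro s₃ ⟨ha₃, h₃⟩
      refine ⟨(ha₂.mono fun a h => h.2.1).trans (ha₃.mono fun a h => h.2.2), ?_,
        fun v hv => ?_, fun c hc u hu => ?_⟩
      · rw [ha₃.idx (by simp), ha₂.idx (by simp)]; exact hi'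
      · rw [ha₃.idx (by simp), State.setN_idx]
        split_ifs with hh
        · rw [hh.2]; ring
        · exact J1 v (by omega)
      · exact h₃ c hc u (by omega)
  · simp only [NExp.cost]
    exact Nat.mul_le_mul_left _ (by omega)
  · rintro s' ⟨h1, h2, h3⟩
    exact ⟨h1, h2, fun c hc u hu => h3 c hc u (by omega)⟩

/-- The memory after the preprocessing. -/
structure Ready (m n C : ℕ) (p : ℕ → ℚ) (E : ℕ → ℕ → Prop) (s : State) : Prop where
  machines : s.idx 0 0 = m
  jobs : s.idx 0 1 = n
  time : s.val 0 = p
  ends : ∀ i < m, Ends (E i) n (s.idx 20 i) (s.idx 21 i)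
  stride : ∀ c ≤ C, s.idx 22 c = (n + 1) ^ c
  codes : s.idx 23 0 = (n + 1) ^ (C + 1)
  row : ∀ v ≤ (n + 1) ^ (C + 1), s.idx 24 v = v * n
  position : ∀ c ≤ C, ∀ v < (n + 1) ^ (C + 1), s.idx (100 + c) v = pos n c v
  le_max : ∀ j < n, p j ≤ s.val 25 0
  max_eq : s.val 25 0 = 0 ∨ ∃ j < n, s.val 25 0 = p j

theorem runs_prepareCmd {E : ℕ → ℕ → Prop} (hm : s.idx 0 0 = m) (hn : s.idx 0 1 = n)
    (hE : ∀ i < m, ∀ j < n, (E i j ↔ 1 ≤ s.idx 1 (i * n + j)))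
    (h0 : ∀ a, 2 ≤ a → ∀ i, s.idx a i = 0) (h0' : s.val 25 0 = 0) :
    Runs (prepareCmd C) s ((m + 1) * (1000 * (C + 2) * ((n + 1) ^ (C + 1) * (n + 1))))
      (fun s' => Ready m n C (s.val 0) E s') := by
  have hcost : 50 * (n + 1) + ((m + 1) * (100 * (n + 1)) + ((C + 1 + 1) * (100 * (n + 1)) + (10 +
      ((n + 1) ^ (C + 1) + 1) * (C * 50 + 100)))) ≤
      (m + 1) * (1000 * (C + 2) * ((n + 1) ^ (C + 1) * (n + 1))) := by
    have h1 : 1 ≤ (n + 1) ^ (C + 1) := Nat.one_le_pow _ _ (by omega)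
    generalize (n + 1) ^ (C + 1) = V at *
    have h2 : n + 1 ≤ V * (n + 1) := Nat.le_mul_of_pos_left _ h1
    have h3 : V ≤ V * (n + 1) := Nat.le_mul_of_pos_right _ (by omega)
    generalize V * (n + 1) = X at *
    have h4 : (C + 2) * X ≤ (m + 1) * ((C + 2) * X) := Nat.le_mul_of_pos_left _ (by omega)
    have h5 : X ≤ (C + 2) * X := Nat.le_mul_of_pos_left _ (by omega)
    have h6 : (m + 1) * (n + 1) ≤ (m + 1) * ((C + 2) * X) :=
      Nat.mul_le_mul_left _ (h2.trans h5)
    have h7 : (C + 2) * (n + 1) ≤ (C + 2) * X := Nat.mul_le_mul_left _ h2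
    have h8 : (C + 2) * (V + 1) ≤ (C + 2) * (2 * X) := Nat.mul_le_mul_left _ (by omega)
    nlinarith
  refine Runs.le (Runs.seq ((runs_maxCmd hn h0').mono le_rfl ?_)) hcost
  rintro s₁ ⟨a1, b1, c1⟩
  have hm₁ : s₁.idx 0 0 = m := by rw [a1.idx (by simp)]; exact hm
  have hn₁ : s₁.idx 0 1 = n := by rw [a1.idx (by simp)]; exact hn
  refine Runs.seq ((runs_intervalsCmd (E := E) hm₁ hn₁ ?_ ?_ ?_ ?_).mono le_rfl ?_)
  · rw [a1.idx (by simp)]; exact h0 5 (by simp) 0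
  · rw [a1.idx (by simp)]; exact hE
  · rw [a1.idx (by simp)]; exact h0 20 (by simp)
  · rw [a1.idx (by simp)]; exact h0 21 (by simp)
  rintro s₂ ⟨a2, b2⟩
  have hn₂ : s₂.idx 0 1 = n := by rw [a2.idx (by simp)]; exact hn₁
  refine Runs.seq ((runs_stridesCmd hn₂ (C + 1)).mono le_rfl ?_)
  rintro s₃ ⟨a3, b3⟩
  refine Runs.seq (Runs.le (Runs.setN ?_) (by simp [NExp.cost]))
  simp only [NExp.eval, b3 (C + 1) le_rfl]
  set s₄ := s₃.setN 23 0 ((n + 1) ^ (C + 1)) with hs₄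
  have a4 : Agree (fun a => a ≠ 23) s₃ s₄ := (Agree.refl _ _).setN (by simp)
  have hn₄ : s₄.idx 0 1 = n := by
    rw [a4.idx (by simp), a3.idx (by simp)]; exact hn₂
  have e23 : s₄.idx 23 0 = (n + 1) ^ (C + 1) := by simp [hs₄]
  have e22 : ∀ c ≤ C, s₄.idx 22 c = (n + 1) ^ c := by
    intro c hc; rw [a4.idx (by simp)]; exact b3 c (by omega)
  refine (runs_tablesCmd hn₄ e23 e22 ?_ ?_).mono le_rfl ?_
  · rw [a4.idx (by simp), a3.idx (by simp), a2.idx (by simp), a1.idx (by simp)]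
    exact h0 24 (by simp) 0
  · intro c _ u
    rw [a4.idx (by omega), a3.idx (by omega), a2.idx (by omega), a1.idx (by omega)]
    exact h0 _ (by omega) u
  rintro s₅ ⟨a5, b5, c5⟩
  have q1 : Agree (fun a => a = 0 ∨ a = 25) s₁ s₅ :=
    (a2.mono fun a h => by omega).trans ((a3.mono fun a h => by omega).trans
      ((a4.mono fun a h => by omega).trans (a5.mono fun a h => by omega)))
  have q2 : Agree (fun a => a = 20 ∨ a = 21) s₂ s₅ :=
    (a3.mono fun a h => by omega).trans
      ((a4.mono fun a h => by omega).trans (a5.mono fun a h => by omega))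
  refine ⟨?_, ?_, ?_, ?_, ?_, ?_, b5, c5, ?_, ?_⟩
  · rw [q1.idx (by simp)]; exact hm₁
  · rw [q1.idx (by simp)]; exact hn₁
  · rw [q1.val (by simp), a1.val (by simp)]
  · rw [q2.idx (by simp), q2.idx (by simp)]; exact b2
  · intro c hc
    rw [a5.idx (by simp)]; exact e22 c hc
  · rw [a5.idx (by simp)]; exact e23
  · rw [q1.val (by simp)]; exact b1
  · rw [q1.val (by simp)]; exact c1

end ConvexMakespan

/-! ### The approximation algorithm -/

namespace ConvexMakespan

open RAM

section Programs

variable (k C : ℕ)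

/-- The last code. -/
def lastE : NExp := NExp.sub (NExp.var 23) (NExp.const 1)

def attemptCmd : Cmd :=
  Cmd.seq (solveCmd k C) (Cmd.cond (BExp.leQ (loadE lastE) (boundE k))
    (Cmd.setN 13 (NExp.const 0) (NExp.const 1))
    (Cmd.setQ 14 (NExp.const 0) (QExp.add guessE (QExp.scale (1 / k) maxE))))

def searchCmd : Cmd :=
  Cmd.seq (Cmd.setQ 14 (NExp.const 0) maxE) (Cmd.seq (Cmd.setN 13 (NExp.const 0) (NExp.const 0))
    (Cmd.loop (BExp.leN (NExp.var 13) (NExp.const 0)) (attemptCmd k C)))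

def outputCmd : Cmd :=
  Cmd.forTo 4 jobsE (Cmd.setN 2 (NExp.var 4)
    (NExp.get 3 (NExp.add (NExp.get 24 lastE) (NExp.var 4))))

def mainCmd : Cmd := Cmd.seq (prepareCmd C) (Cmd.seq (searchCmd k C) outputCmd)

end Programs

/-! ### Size classes -/

/-- The class of a job of size `x`. -/
noncomputable def classOf (k : ℕ) (T x : ℚ) : ℕ := sInf {c : ℕ | x ≤ hi k c * T}

theorem hi_pos {k : ℕ} (hk : 0 < k) (c : ℕ) : 0 < hi k c := by
  have : (0 : ℚ) < k := by exact_mod_cast hk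
  unfold hi; positivity

theorem hi_succ (k c : ℕ) : hi k (c + 1) = (1 + 2 / k) * hi k c := by
  unfold hi; ring

theorem hi_mono {k : ℕ} (hk : 0 < k) : Monotone (hi k) := by
  refine monotone_nat_of_le_succ fun c => ?_
  have : (0 : ℚ) < k := by exact_mod_cast hk
  have h1 : (0 : ℚ) ≤ 2 / k := by positivity
  rw [hi_succ]
  nlinarith [hi_pos hk c]

theorem le_hi_classOf {k c : ℕ} {T x : ℚ} (h : x ≤ hi k c * T) : x ≤ hi k (classOf k T x) * T :=
  Nat.sInf_mem (s := {c : ℕ | x ≤ hi k c * T}) ⟨c, h⟩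

theorem classOf_le {k c : ℕ} {T x : ℚ} (h : x ≤ hi k c * T) : classOf k T x ≤ c :=
  Nat.sInf_le h

theorem lo_lt_of_classOf {k c : ℕ} {T x : ℚ} (hx : 0 < x) (h : classOf k T x = c) :
    lo k c * T < x := by
  unfold lo
  split_ifs with hc
  · simpa using hx
  · have : c - 1 < classOf k T x := by omega
    exact not_le.1 fun h' => Nat.notMem_of_lt_sInf this h'

/-- As `hi` is monotone, the half-open ranges of the classes are disjoint, and those up to `C` cover
all positive sizes up to `hi k C * T`. -/
theorem classOf_eq_iff {k c C : ℕ} {T x : ℚ} (hk : 0 < k) (hT : 0 ≤ T) (hx : 0 < x)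
    (hC : x ≤ hi k C * T) : classOf k T x = c ↔ lo k c * T < x ∧ x ≤ hi k c * T := by
  constructor
  · rintro h
    exact ⟨lo_lt_of_classOf hx h, h ▸ le_hi_classOf hC⟩
  · rintro ⟨h1, h2⟩
    refine le_antisymm (classOf_le h2) ?_
    by_contra hlt
    rw [not_le] at hlt
    have h3 := le_hi_classOf hC
    have h4 : lo k c = hi k (c - 1) := by unfold lo; rw [if_neg (by omega)]
    have h5 : hi k (classOf k T x) ≤ hi k (c - 1) := hi_mono hk (by omega)
    rw [h4] at h1
    have := mul_le_mul_of_nonneg_right h5 hT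
    linarith

/-- The dynamic program for the guess `T` in a memory with the intervals of the machines. -/
noncomputable def dataOf (k m n C : ℕ) (p : ℕ → ℚ) (s : State) (T : ℚ) : Data where
  m := m
  n := n
  C := C
  p := p
  cls j := classOf k T (p j)
  B := (1 + 3 / k) * T
  L := s.idx 20
  R := s.idx 21

/-- There is a feasible assignment with loads at most `M`. -/
def Achievable (m n : ℕ) (p : ℕ → ℚ) (E : ℕ → ℕ → Prop) (M : ℚ) : Prop :=
  ∃ b : ℕ → ℕ, (∀ j < n, b j < m ∧ E (b j) j) ∧
    ∀ i, ∑ j ∈ Finset.range n, (if b j = i then p j else 0) ≤ M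

variable {k m n C : ℕ} {p : ℕ → ℚ} {E : ℕ → ℕ → Prop} {s : State} {T M : ℚ}

/-- The properties of an instance, for machines and jobs numbered by natural numbers. -/
structure Inst (m n : ℕ) (p : ℕ → ℚ) (E : ℕ → ℕ → Prop) : Prop where
  pos : ∀ j < n, 0 < p j
  zero : ∀ j, n ≤ j → p j = 0
  jobs_pos : 0 < n
  lt : ∀ i j, E i j → j < n
  executable : ∀ j < n, ∃ i < m, E i j
  convex : ∀ i < m, ∀ a b c, a ≤ b → b ≤ c → E i a → E i c → E i b
  enclosed : ∀ i i', i < m → i' < m → (∀ j, E i j → E i' j) → ∀ a b c, a ≤ b → b ≤ c →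
    E i' a → E i' c → ¬ E i a → ¬ E i c → ¬ E i b

theorem Inst.nonneg (h : Inst m n p E) (j : ℕ) : 0 ≤ p j := by
  rcases lt_or_ge j n with hj | hj
  · exact (h.pos j hj).le
  · exact (h.zero j hj).ge

theorem Inst.mem_iff (h : Inst m n p E) {i l r : ℕ} (hi : i < m) (he : Ends (E i) n l r) (j : ℕ) :
    E i j ↔ l ≤ j ∧ j < r := by
  constructor
  · exact fun hj => he.1 j (h.lt i j hj) hj
  · rintro ⟨h1, h2⟩
    obtain ⟨-, -, h3, h4⟩ := he.2.2.1 (by omega)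
    exact h.convex i hi l j (r - 1) h1 (by omega) h3 h4

/-- The intervals are sorted by the sums of their ends. -/
theorem Inst.sorted (h : Inst m n p E) {i i' l r l' r' : ℕ} (hi : i < m) (hi' : i' < m)
    (he : Ends (E i) n l r) (he' : Ends (E i') n l' r') (hlr : l < r) (hlr' : l' < r')
    (hsum : l + r ≤ l' + r') : l ≤ l' ∧ r ≤ r' := by
  have m1 := h.mem_iff hi he
  have m2 := h.mem_iff hi' he'
  constructor
  -- If `l' < l`, then `r < r'` by the order of the sums. The first interval lies strictly inside
  -- the second, and the difference contains `l'` and `r' - 1` but not `l` between them.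
  · by_contra hcon
    have := h.enclosed i i' hi hi' (fun j hj => by rw [m1] at hj; rw [m2]; omega)
      l' l (r' - 1) (by omega) (by omega)
    simp only [m1, m2] at this
    omega
  -- Symmetrically, `r' < r` forces `l < l'`, and the difference has a gap at `l'`.
  · by_contra hcon
    have := h.enclosed i' i hi' hi (fun j hj => by rw [m2] at hj; rw [m1]; omega)
      l l' (r - 1) (by omega) (by omega)
    simp only [m1, m2] at this
    omega

theorem Ready.agree {s' : State} (h : Ready m n C p E s)
    (ha : Agree (fun a => a ≤ 1 ∨ 15 ≤ a) s s') : Ready m n C p E s' := by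
  have e : ∀ a, a ≤ 1 ∨ 15 ≤ a → s'.idx a = s.idx a := fun a h => ha.idx h
  have e' : ∀ a, a ≤ 1 ∨ 15 ≤ a → s'.val a = s.val a := fun a h => ha.val h
  refine ⟨?_, ?_, ?_, ?_, ?_, ?_, ?_, ?_, ?_, ?_⟩
  · rw [e 0 (by simp)]; exact h.machines
  · rw [e 0 (by simp)]; exact h.jobs
  · rw [e' 0 (by simp)]; exact h.time
  · rw [e 20 (by simp), e 21 (by simp)]; exact h.ends
  · rw [e 22 (by simp)]; exact h.stride
  · rw [e 23 (by simp)]; exact h.codes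
  · rw [e 24 (by simp)]; exact h.row
  · intro c hc; rw [e (100 + c) (by omega)]; exact h.position c hc
  · rw [e' 25 (by simp)]; exact h.le_max
  · rw [e' 25 (by simp)]; exact h.max_eq

theorem Ready.max_pos (h : Ready m n C p E s) (hI : Inst m n p E) : 0 < s.val 25 0 :=
  lt_of_lt_of_le (hI.pos 0 hI.jobs_pos) (h.le_max 0 hI.jobs_pos)

/-- The machine that executes the longest job has at least this load. -/
theorem Ready.max_le (h : Ready m n C p E s) (hI : Inst m n p E) (hM : Achievable m n p E M) :
    s.val 25 0 ≤ M := by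
  rcases h.max_eq with h0 | ⟨j, hj, h0⟩
  · exact absurd h0 (h.max_pos hI).ne'
  · obtain ⟨b, -, hb⟩ := hM
    rw [h0]
    refine le_trans ?_ (hb (b j))
    have := Finset.single_le_sum (f := fun j' => if b j' = b j then p j' else 0)
      (fun j' _ => by split_ifs <;> [exact hI.nonneg j'; exact le_rfl])
      (Finset.mem_range.2 hj)
    simpa using this

/-- A crude upper bound for the optimum; it makes the search stop. -/
theorem Ready.achievable (h : Ready m n C p E s) (hI : Inst m n p E) :
    Achievable m n p E (n * s.val 25 0) := by
  choose! b hb using hI.executable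
  refine ⟨b, hb, fun i => ?_⟩
  calc ∑ j ∈ Finset.range n, (if b j = i then p j else 0)
      ≤ ∑ _j ∈ Finset.range n, s.val 25 0 := by
        refine Finset.sum_le_sum fun j hj => ?_
        split_ifs
        · exact h.le_max j (Finset.mem_range.1 hj)
        · exact (h.max_pos hI).le
    _ = n * s.val 25 0 := by simp

theorem le_hi_mul (hk : 0 < k) (hC : (k : ℚ) ≤ (1 + 2 / k) ^ C) (hT0 : 0 ≤ T) {x : ℚ} (hx : x ≤ T) :
    x ≤ hi k C * T := by
  have : (1 : ℚ) ≤ hi k C := by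
    unfold hi
    rwa [one_le_div (by exact_mod_cast hk)]
  nlinarith

theorem Ready.le_hi (h : Ready m n C p E s) (hI : Inst m n p E) (hk : 0 < k)
    (hC : (k : ℚ) ≤ (1 + 2 / k) ^ C) (hT : s.val 25 0 ≤ T) (j : ℕ) : p j ≤ hi k C * T := by
  refine le_hi_mul hk hC ((h.max_pos hI).le.trans hT) ?_
  rcases lt_or_ge j n with hj | hj
  · exact (h.le_max j hj).trans hT
  · rw [hI.zero j hj]; exact (h.max_pos hI).le.trans hT

theorem Ready.ctx (h : Ready m n C p E s) (hI : Inst m n p E) (hk : 0 < k)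
    (hC : (k : ℚ) ≤ (1 + 2 / k) ^ C) (hT : s.val 25 0 ≤ T) (hg : s.val 14 0 = T) :
    Ctx k (dataOf k m n C p s T) T s where
  machines := h.machines
  jobs := h.jobs
  time := h.time
  left := rfl
  right := rfl
  stride := h.stride
  codes := h.codes
  row := fun v hv => h.row v (le_of_lt hv)
  position := h.position
  guess := hg
  bound := rfl
  cls := fun j hj _ _ => classOf_eq_iff hk ((h.max_pos hI).le.trans hT) (hI.pos j hj)
    (h.le_hi hI hk hC hT j)

theorem Ready.solve_sound (h : Ready m n C p E s) (hI : Inst m n p E) (hk : 0 < k)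
    (hC : (k : ℚ) ≤ (1 + 2 / k) ^ C) (hT : s.val 25 0 ≤ T) {A : ℕ → ℕ → ℕ}
    (hD : ((dataOf k m n C p s T).solve A).D ((dataOf k m n C p s T).V - 1) ≤ (1 + 3 / k) * T) :
    (∀ j < n, ((dataOf k m n C p s T).solve A).A ((dataOf k m n C p s T).V - 1) j < m ∧
      E (((dataOf k m n C p s T).solve A).A ((dataOf k m n C p s T).V - 1) j) j) ∧
    ∀ i, ∑ j ∈ Finset.range n,
      (if ((dataOf k m n C p s T).solve A).A ((dataOf k m n C p s T).V - 1) j = i then p j else 0)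
      ≤ (1 + 3 / k) * T := by
  have hT0 : 0 ≤ T := (h.max_pos hI).le.trans hT
  obtain ⟨h1, h2⟩ := Data.solve_sound (d := dataOf k m n C p s T) A
    (mul_nonneg (by positivity) hT0) hI.nonneg
    (fun j _ => classOf_le (h.le_hi hI hk hC hT j)) hD
  refine ⟨fun j hj => ⟨(h1 j hj).1, ?_⟩, h2⟩
  exact (hI.mem_iff (h1 j hj).1 (h.ends _ (h1 j hj).1) j).2 (h1 j hj).2

/-- Rounding within a class costs the factor `ρ = 1 + 2 / k` and the overshoot of small jobs `σ = T
/ k`; together they give exactly the bound used by the program. -/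
theorem Ready.solve_complete (h : Ready m n C p E s) (hI : Inst m n p E) (hk : 0 < k)
    (hC : (k : ℚ) ≤ (1 + 2 / k) ^ C) (hT : s.val 25 0 ≤ T) (A : ℕ → ℕ → ℕ)
    (hM : Achievable m n p E M) (hMT : M ≤ T) :
    ((dataOf k m n C p s T).solve A).D ((dataOf k m n C p s T).V - 1) ≤ (1 + 3 / k) * T := by
  have hT0 : 0 ≤ T := (h.max_pos hI).le.trans hT
  have hk' : (0 : ℚ) < k := by exact_mod_cast hk
  obtain ⟨b, hb1, hb2⟩ := hM
  refine Data.solve_complete (d := dataOf k m n C p s T) A (b := b) (lo := fun c => lo k c * T)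
    (ρ := 1 + 2 / k) (σ := T / k) (T := T) hI.nonneg hI.pos
    (fun j _ => classOf_le (h.le_hi hI hk hC hT j)) ?_ ?_ ?_ (by positivity) ?_ ?_ ?_ ?_ hT0
    (fun i => (hb2 i).trans hMT) ?_
  · intro i i' hi hi' h1 h2 h3
    exact hI.sorted hi hi' (h.ends i hi) (h.ends i' hi') h1 h2 h3
  · intro i hi
    obtain ⟨-, h2, h3, h4⟩ := h.ends i hi
    refine ⟨h4, ?_⟩
    rcases Nat.eq_zero_or_pos (s.idx 21 i) with h0 | h0
    · exact le_of_eq_of_le h0 (Nat.zero_le _)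
    · exact (h3 h0).2.1
  · intro j hj
    exact ⟨(hb1 j hj).1, (hI.mem_iff (hb1 j hj).1 (h.ends _ (hb1 j hj).1) j).1 (hb1 j hj).2⟩
  · have : (0 : ℚ) ≤ 2 / k := by positivity
    linarith
  · intro j hj
    have := le_hi_classOf (h.le_hi hI hk hC hT j)
    change classOf k T (p j) = 0 at hj
    rw [hj] at this
    refine this.trans (le_of_eq ?_)
    simp only [hi]; ring
  · intro j hj hc
    change classOf k T (p j) ≠ 0 at hc
    refine ⟨(lo_lt_of_classOf (hI.pos j hj) rfl).le, ?_⟩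
    have := le_hi_classOf (h.le_hi hI hk hC hT j)
    obtain ⟨c, hcc⟩ := Nat.exists_eq_succ_of_ne_zero hc
    change p j ≤ (1 + 2 / k) * (lo k (classOf k T (p j)) * T)
    rw [hcc] at this ⊢
    rw [Nat.succ_eq_add_one, hi_succ] at this
    simpa [lo, mul_assoc] using this
  · intro c
    refine mul_nonneg ?_ hT0
    unfold lo
    split_ifs
    · exact le_rfl
    · exact (hi_pos hk _).le
  · change (1 + 2 / (k : ℚ)) * T + T / k ≤ (1 + 3 / k) * T
    exact le_of_eq (by ring)

/-! ### The search for the guess -/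

/-- The result of the search: a guess not much above the optimum with an assignment `a`. -/
def Solved (k m n : ℕ) (p : ℕ → ℚ) (E : ℕ → ℕ → Prop) (a : ℕ → ℕ) : Prop :=
  ∃ T : ℚ, (∀ M, Achievable m n p E M → T ≤ (1 + 1 / k) * M) ∧ (∀ j < n, a j < m ∧ E (a j) j) ∧
    ∀ i, ∑ j ∈ Finset.range n, (if a j = i then p j else 0) ≤ (1 + 3 / k) * T

theorem runs_attemptCmd (h : Ready m n C p E s) (hI : Inst m n p E) (hk : 0 < k)
    (hC : (k : ℚ) ≤ (1 + 2 / k) ^ C) (hT : s.val 25 0 ≤ T) (hg : s.val 14 0 = T)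
    (hM : ∀ M, Achievable m n p E M → T ≤ (1 + 1 / k) * M) (hs : s.idx 13 0 = 0) :
    Runs (attemptCmd k C) s
      ((n + 1) * ((m + 1) * ((C + 2) * (4100 * ((n + 1) ^ (C + 1) * (n + 1))))))
      (fun s' => Agree (fun a => a ≤ 1 ∨ 15 ≤ a) s s' ∧
        ((s'.idx 13 0 = 1 ∧
          Solved k m n p E (fun j => s'.idx 3 (((n + 1) ^ (C + 1) - 1) * n + j))) ∨
        (s'.idx 13 0 = 0 ∧ s'.val 14 0 = T + 1 / k * s.val 25 0 ∧
          ∀ M, Achievable m n p E M → T + 1 / k * s.val 25 0 ≤ (1 + 1 / k) * M))) := by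
  have hctx := h.ctx hI hk hC hT hg
  refine Runs.le (Runs.seq (t' := 60) ((runs_solveCmd hctx).mono le_rfl ?_)) ?_
  · rintro s₁ ⟨ha, hr⟩
    have h₁ : Ctx k (dataOf k m n C p s T) T s₁ := hctx.agree (ha.mono fun a h => by omega)
    have hV : (dataOf k m n C p s T).V - 1 < (dataOf k m n C p s T).V :=
      Nat.sub_lt (dataOf k m n C p s T).V_pos one_pos
    have eB : (boundE k).eval s₁ = (1 + 3 / k) * T := by
      simp only [boundE, guessE, QExp.eval, NExp.eval, h₁.guess]
    have eD := (hr _ hV).1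
    have eL : lastE.eval s₁ = (dataOf k m n C p s T).V - 1 := by
      simp only [lastE, NExp.eval, h₁.codes]
    have e25 : s₁.val 25 0 = s.val 25 0 := by rw [ha.val (by simp)]
    refine Runs.le (Runs.cond (fun hb => Runs.setN ?_) (fun hb => Runs.setQ ?_)) ?_
    · simp only [BExp.Holds, eB, loadE, QExp.eval, eL, eD] at hb
      refine ⟨(ha.mono fun a h => by omega).setN (by simp), Or.inl ⟨by simp [NExp.eval], T, hM, ?_⟩⟩
      obtain ⟨k1, k2⟩ := h.solve_sound hI hk hC hT hb
      have e : ∀ j < n, s₁.idx 3 (((n + 1) ^ (C + 1) - 1) * n + j) = _ := (hr _ hV).2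
      simp only [State.setN_idx, show ¬ (3 = 13) by simp, false_and, if_false]
      refine ⟨fun j hj => by rw [e j hj]; exact k1 j hj, fun i => le_trans (le_of_eq ?_) (k2 i)⟩
      refine Finset.sum_congr rfl fun j hj => ?_
      rw [e j (Finset.mem_range.1 hj)]
    · simp only [BExp.Holds, eB, loadE, QExp.eval, eL, eD] at hb
      refine ⟨(ha.mono fun a h => by omega).setQ (by simp), Or.inr ⟨?_, ?_, fun M hM' => ?_⟩⟩
      · rw [State.setQ_idx, ha.idx (by simp)]; exact hs
      · simp [guessE, maxE, QExp.eval, NExp.eval, h₁.guess, e25]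
      -- Failure means `T < M` by completeness. The increment is `1 / k` of the largest processing
      -- time, hence at most `M / k`.
      · have h1 : T < M := by
          by_contra hcon
          exact hb (h.solve_complete hI hk hC hT _ hM' (not_lt.1 hcon))
        have h2 := h.max_le hI hM'
        have h3 : (0 : ℚ) ≤ 1 / k := by positivity
        nlinarith
    · simp only [BExp.cost, NExp.cost, QExp.cost, loadE, lastE, boundE, guessE, maxE]; omega
  · have h1 := (dataOf k m n C p s T).cells_pos
    change (n + 1) * ((m + 1) * ((C + 2) * (4000 * ((n + 1) ^ (C + 1) * (n + 1))))) + 60 ≤ _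
    change 0 < (n + 1) ^ (C + 1) * (n + 1) at h1
    have h2 : 1 ≤ (n + 1) * ((m + 1) * ((C + 2) * ((n + 1) ^ (C + 1) * (n + 1)))) :=
      Nat.mul_pos (by omega) (Nat.mul_pos (by omega) (Nat.mul_pos (by omega) h1))
    generalize (n + 1) ^ (C + 1) * (n + 1) = X at *
    nlinarith

/-- After `g` failures the guess is `1 + g / k` times the largest processing time and still at most
`1 + 1 / k` times any achievable load. -/
theorem runs_searchCmd (h : Ready m n C p E s) (hI : Inst m n p E) (hk : 0 < k)
    (hC : (k : ℚ) ≤ (1 + 2 / k) ^ C) :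
    Runs (searchCmd k C) s ((k + 2) * (n + 1) *
      ((n + 1) * ((m + 1) * ((C + 2) * (4200 * ((n + 1) ^ (C + 1) * (n + 1)))))))
      (fun s' => Ready m n C p E s' ∧
          Solved k m n p E (fun j => s'.idx 3 (((n + 1) ^ (C + 1) - 1) * n + j))) := by
  have hk' : (0 : ℚ) < k := by exact_mod_cast hk
  have hcost : 1 ≤ (n + 1) * ((m + 1) * ((C + 2) * ((n + 1) ^ (C + 1) * (n + 1)))) :=
    Nat.succ_le_of_lt (by positivity)
  set W := (n + 1) * ((m + 1) * ((C + 2) * ((n + 1) ^ (C + 1) * (n + 1)))) with hW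
  have hpos := h.max_pos hI
  refine Runs.le (Runs.seq (t' := 10 + ((k + 1) * n * (10 + 4100 * W) + 10))
    (Runs.setQ (Runs.seq (Runs.le (Runs.setN ?_) (by simp [NExp.cost]))))) ?_
  · refine Runs.le (Runs.loop (G := (k + 1) * n) (t := 4100 * W) (fun g s' =>
        Agree (fun a => a ≤ 1 ∨ 15 ≤ a) s s' ∧ ((s'.idx 13 0 = 1 ∧
          Solved k m n p E (fun j => s'.idx 3 (((n + 1) ^ (C + 1) - 1) * n + j))) ∨
        (s'.idx 13 0 = 0 ∧ s'.val 14 0 = (1 + g / k) * s.val 25 0 ∧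
          ∀ M, Achievable m n p E M → (1 + g / k) * s.val 25 0 ≤ (1 + 1 / k) * M)))
        ?_ ?_ ?_ ?_) ?_
    · rintro g s' ⟨ha, hh⟩ hb
      simp only [BExp.Holds, NExp.eval] at hb
      obtain ⟨-, -, h1⟩ := hh.resolve_left (by omega)
      -- Compared with the achievable load of `n` times the largest processing time, this gives `k +
      -- g ≤ (k + 1) * n`, which bounds the number of attempts.
      have h2 := h1 _ (h.achievable hI)
      have h3 : (1 + g / k : ℚ) ≤ (1 + 1 / k) * n := by
        refine le_of_mul_le_mul_right ?_ hpos
        linarith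
      have h4 : (k + g : ℚ) ≤ (k + 1) * n := by
        have := mul_le_mul_of_nonneg_left h3 hk'.le
        field_simp at this
        linarith
      have h5 : k + g ≤ (k + 1) * n := by exact_mod_cast h4
      omega
    · rintro g s' ⟨ha, hh⟩ hb
      simp only [BExp.Holds, NExp.eval] at hb
      obtain ⟨h0, h1, h2⟩ := hh.resolve_left (by omega)
      have e25 : s'.val 25 = s.val 25 := ha.val (by simp)
      have h3 : (0 : ℚ) ≤ g / k := by positivity
      have hrun := runs_attemptCmd (h.agree ha) hI hk hC (T := (1 + g / k) * s.val 25 0)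
        (by rw [e25]; nlinarith) h1 h2 h0
      rw [e25, show (1 + g / k : ℚ) * s.val 25 0 + 1 / k * s.val 25 0 =
        (1 + (g + 1 : ℕ) / k) * s.val 25 0 by push_cast; ring] at hrun
      refine hrun.mono (le_of_eq (by rw [hW]; ring)) ?_
      rintro s'' ⟨ha', h'⟩
      exact ⟨ha.trans ha', h'⟩
    · rintro g s' ⟨ha, hh⟩ hb
      simp only [BExp.Holds, NExp.eval] at hb
      exact ⟨h.agree ha, (hh.resolve_right fun h' => hb (by omega)).2⟩
    · refine ⟨((Agree.refl _ _).setQ (by simp)).setN (by simp), Or.inr ⟨by simp [NExp.eval], ?_, ?_⟩⟩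
      · simp [NExp.eval, QExp.eval, maxE]
      · intro M hM
        have h1 := h.max_le hI hM
        have h2 : (0 : ℚ) ≤ 1 / k := by positivity
        simp only [Nat.cast_zero, zero_div, add_zero, one_mul]
        nlinarith
    · simp only [BExp.cost, NExp.cost]
      exact Nat.add_le_add (Nat.mul_le_mul_left _ (by omega)) (by omega)
  · have e : (n + 1) * ((m + 1) * ((C + 2) * (4200 * ((n + 1) ^ (C + 1) * (n + 1))))) =
      4200 * W := by rw [hW]; ring
    rw [e]
    simp only [NExp.cost, QExp.cost, maxE]
    have h1 : (k + 1) * n * (10 + 4100 * W) ≤ (k + 1) * n * (4200 * W) :=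
      Nat.mul_le_mul_left _ (by omega)
    have h2 : (k + 2) * (n + 1) * (4200 * W) =
      (k + 1) * n * (4200 * W) + (n + k + 2) * (4200 * W) := by ring
    have h3 : 1 * (4200 * W) ≤ (n + k + 2) * (4200 * W) := Nat.mul_le_mul_right _ (by omega)
    omega

theorem runs_outputCmd (h : Ready m n C p E s) :
    Runs outputCmd s (50 * (n + 1)) (fun s' =>
      ∀ j < n, s'.idx 2 j = s.idx 3 (((n + 1) ^ (C + 1) - 1) * n + j)) := by
  refine Runs.mono (Runs.forTo (N := n) (t := 20) (fun a => a ≠ 2 ∧ a ≠ 4)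
    (fun i s' => ∀ j < i, s'.idx 2 j = s.idx 3 (((n + 1) ^ (C + 1) - 1) * n + j))
    (by simp) (fun i s' x hJ => by simpa using hJ) ?_ (by simp) ?_) ?_ ?_
  · intro s' ha
    simp only [jobsE, NExp.eval]
    rw [ha.idx (by simp)]; exact h.jobs
  · intro i s' hi ha hi' hJ
    refine Runs.le (Runs.setN ?_) (by simp [NExp.cost, lastE])
    refine ⟨(Agree.refl _ _).setN (by simp), by simpa using hi', fun j hj => ?_⟩
    have e3 : s'.idx 3 = s.idx 3 := ha.idx (by simp)
    have e24 : s'.idx 24 = s.idx 24 := ha.idx (by simp)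
    have e23 : s'.idx 23 = s.idx 23 := ha.idx (by simp)
    simp only [NExp.eval, lastE, hi', e3, e24, e23, h.codes, h.row _ (Nat.sub_le _ 1),
      State.setN_idx, true_and]
    split_ifs with hji
    · rw [hji]
    · exact hJ j (by omega)
  · simp only [jobsE, NExp.cost]; omega
  · rintro s' ⟨-, h'⟩
    exact h'

/-- The exponent `C + 4` collects `C + 1` for the codes and one each for the length of a row, the
keys and the guesses. -/
theorem runs_mainCmd (hI : Inst m n p E) (hk : 0 < k) (hC : (k : ℚ) ≤ (1 + 2 / k) ^ C)
    (hm : s.idx 0 0 = m) (hn : s.idx 0 1 = n) (hp : s.val 0 = p)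
    (hE : ∀ i < m, ∀ j < n, (E i j ↔ 1 ≤ s.idx 1 (i * n + j)))
    (h0 : ∀ a, 2 ≤ a → ∀ i, s.idx a i = 0) (h0' : s.val 25 0 = 0) :
    Runs (mainCmd k C) s ((k + 2) * (C + 2) * 6000 * ((m + 1) * (n + 1) ^ (C + 4)))
      (fun s' => Solved k m n p E (s'.idx 2)) := by
  refine Runs.le (Runs.seq ((runs_prepareCmd (E := E) hm hn hE h0 h0').mono le_rfl fun s₁ h₁ =>
    Runs.seq ((runs_searchCmd (hp ▸ h₁) hI hk hC).mono le_rfl fun s₂ h₂ =>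
      (runs_outputCmd h₂.1).mono le_rfl fun s₃ h₃ => ?_))) ?_
  · obtain ⟨T, t1, t2, t3⟩ := h₂.2
    refine ⟨T, t1, fun j hj => by rw [h₃ j hj]; exact t2 j hj, fun i => ?_⟩
    refine le_trans (le_of_eq (Finset.sum_congr rfl fun j hj => ?_)) (t3 i)
    rw [h₃ j (Finset.mem_range.1 hj)]
  · have hn1 : 1 ≤ n + 1 := by omega
    have e1 : (n + 1) ^ (C + 4) = (n + 1) ^ (C + 1) * (n + 1) * (n + 1) * (n + 1) := by ring
    rw [e1]
    have hV : 1 ≤ (n + 1) ^ (C + 1) := Nat.one_le_pow _ _ hn1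
    set X := (n + 1) ^ (C + 1) * (n + 1) with hX
    have h1 : (m + 1) * (1000 * (C + 2) * X) ≤ (k + 2) * (C + 2) * 1000 * ((m + 1) * (X * (n + 1) * (n + 1))) := by
      calc (m + 1) * (1000 * (C + 2) * X) = 1 * (C + 2) * 1000 * ((m + 1) * (X * 1 * 1)) := by ring
        _ ≤ _ := by gcongr; omega
    have h2 : (k + 2) * (n + 1) * ((n + 1) * ((m + 1) * ((C + 2) * (4200 * X)))) =
      (k + 2) * (C + 2) * 4200 * ((m + 1) * (X * (n + 1) * (n + 1))) := by ring
    have h3 : 50 * (n + 1) ≤ (k + 2) * (C + 2) * 50 * ((m + 1) * (X * (n + 1) * (n + 1))) := by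
      have hX1 : 1 ≤ X := Nat.mul_pos hV hn1
      calc 50 * (n + 1) = 1 * 1 * 50 * (1 * (1 * 1 * (n + 1))) := by ring
        _ ≤ _ := by gcongr <;> omega
    rw [h2]
    have e2 : (k + 2) * (C + 2) * 6000 * ((m + 1) * (X * (n + 1) * (n + 1))) =
      6000 * ((k + 2) * (C + 2) * ((m + 1) * (X * (n + 1) * (n + 1)))) := by ring
    have e3 : (k + 2) * (C + 2) * 4200 * ((m + 1) * (X * (n + 1) * (n + 1))) =
      4200 * ((k + 2) * (C + 2) * ((m + 1) * (X * (n + 1) * (n + 1)))) := by ring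
    have e4 : (k + 2) * (C + 2) * 1000 * ((m + 1) * (X * (n + 1) * (n + 1))) =
      1000 * ((k + 2) * (C + 2) * ((m + 1) * (X * (n + 1) * (n + 1)))) := by ring
    have e5 : (k + 2) * (C + 2) * 50 * ((m + 1) * (X * (n + 1) * (n + 1))) =
      50 * ((k + 2) * (C + 2) * ((m + 1) * (X * (n + 1) * (n + 1)))) := by ring
    rw [e4] at h1
    rw [e5] at h3
    rw [e2, e3]
    omega

end ConvexMakespan

/-! ### Transfer to instances on `Fin m` and `Fin n` -/

namespace ConvexMakespan

open RAM MinMax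

/-- The relation `E` on natural numbers. -/
def natRel {m n : ℕ} (E : Fin m → Fin n → Bool) (i j : ℕ) : Prop :=
  ∃ (hi : i < m) (hj : j < n), E ⟨i, hi⟩ ⟨j, hj⟩ = true

variable {m n : ℕ} {E : Fin m → Fin n → Bool} {p : Fin n → ℚ}

theorem input_val (j : Fin n) : (input E p).val 0 j = p j := by simp [input]

theorem inst_of_isInstance (h : IsInstance E p) : Inst m n ((input E p).val 0) (natRel E) where
  pos := fun j hj => by simpa [input, hj] using h.time_pos ⟨j, hj⟩
  zero := fun j hj => by simp [input, not_lt.2 hj]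
  jobs_pos := h.jobs_pos
  lt := fun _ _ hE => hE.2.1
  executable := fun j hj => by
    obtain ⟨i, hi⟩ := h.executable ⟨j, hj⟩
    exact ⟨i, i.2, i.2, hj, hi⟩
  convex := by
    rintro i hi a b c hab hbc ⟨_, ha, hEa⟩ ⟨_, hc, hEc⟩
    have hb : b < n := by omega
    exact ⟨hi, hb, (h.adjacency ⟨i, hi⟩).out (x := ⟨a, ha⟩) (y := ⟨c, hc⟩) hEa hEc
      (show (⟨b, hb⟩ : Fin n) ∈ Set.Icc _ _ from ⟨hab, hbc⟩)⟩
  enclosed := by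
    rintro i i' hi hi' hsub a b c hab hbc ⟨_, ha, hEa⟩ ⟨_, hc, hEc⟩ hna hnc ⟨_, hb, hEb⟩
    have hs : nbhd E ⟨i, hi⟩ ⊆ nbhd E ⟨i', hi'⟩ := fun j hj => (hsub j ⟨hi, j.2, hj⟩).2.2
    exact ((h.enclosure _ _ hs).out (x := ⟨a, ha⟩) (y := ⟨c, hc⟩)
      ⟨hEa, fun hh => hna ⟨hi, ha, hh⟩⟩ ⟨hEc, fun hh => hnc ⟨hi, hc, hh⟩⟩
      (show (⟨b, hb⟩ : Fin n) ∈ Set.Icc _ _ from ⟨hab, hbc⟩)).2 hEb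

theorem natRel_iff_input {i j : ℕ} (hi : i < m) (hj : j < n) :
    natRel E i j ↔ 1 ≤ (input E p).idx 1 (i * n + j) := by
  have : (∃ i' : Fin m, ∃ j' : Fin n, i * n + j = i' * n + j' ∧ E i' j' = true) ↔ natRel E i j := by
    constructor
    · rintro ⟨i', j', he, hE⟩
      obtain ⟨rfl, rfl⟩ := row_injective hj j'.2 he
      exact ⟨hi, hj, hE⟩
    · rintro ⟨_, _, hE⟩
      exact ⟨⟨i, hi⟩, ⟨j, hj⟩, rfl, hE⟩
  simp only [input, this]
  split_ifs <;> simp_all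

theorem load_eq (a : Fin n → Fin m) (a' : ℕ → ℕ) (h : ∀ j : Fin n, a' j = a j) (i : Fin m) :
    ∑ j with a j = i, (p j : ℝ) =
      ((∑ j ∈ Finset.range n, if a' j = i then (input E p).val 0 j else 0 : ℚ) : ℝ) := by
  rw [← Fin.sum_univ_eq_sum_range (fun j => if a' j = i then (input E p).val 0 j else 0) n,
    Finset.sum_filter, Rat.cast_sum]
  refine Finset.sum_congr rfl fun j _ => ?_
  rw [h j, input_val]
  by_cases hji : a j = i
  · simp [hji]
  · simp [hji, Fin.val_inj]

/-- The makespan is a supremum of reals, but the largest load is attained and rational, so the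
search over rational guesses can be compared with it. -/
theorem exists_achievable [Nonempty (Fin m)] (b : Fin n → Fin m) (hb : IsFeasible E b)
    (hp : ∀ j, 0 < p j) :
    ∃ M : ℚ, Achievable m n ((input E p).val 0) (natRel E) M ∧ (M : ℝ) ≤ makespan p b := by
  let b' : ℕ → ℕ := fun j => if hj : j < n then b ⟨j, hj⟩ else 0
  have hb' : ∀ j : Fin n, b' j = b j := fun j => by simp [b']
  let load : ℕ → ℚ := fun i =>
    ∑ j ∈ Finset.range n, if b' j = i then (input E p).val 0 j else 0
  obtain ⟨i₀, hi₀⟩ := Finite.exists_max fun i : Fin m => load i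
  refine ⟨load i₀, ⟨b', fun j hj => ?_, fun i => ?_⟩, ?_⟩
  · have : b' j = b ⟨j, hj⟩ := hb' ⟨j, hj⟩
    rw [this]
    exact ⟨(b _).2, (b _).2, hj, hb ⟨j, hj⟩⟩
  · by_cases hi : i < m
    · exact hi₀ ⟨i, hi⟩
    · refine le_trans (le_of_eq (Finset.sum_eq_zero fun j hj => if_neg ?_))
        (Finset.sum_nonneg fun j hj => ?_)
      · have : b' j = b ⟨j, Finset.mem_range.1 hj⟩ := hb' ⟨j, Finset.mem_range.1 hj⟩
        rw [this]
        rintro rfl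
        exact hi (b _).2
      · split_ifs
        · have := input_val (E := E) (p := p) ⟨j, Finset.mem_range.1 hj⟩
          exact this ▸ (hp _).le
        · exact le_rfl
  · rw [← load_eq b b' hb' i₀]
    exact le_ciSup (f := fun i => ∑ j with b j = i, (p j : ℝ)) (Set.finite_range _).bddAbove i₀

/-- `C ≥ 1` gives `C + 4 ≤ 2 * (C + 1) + 1`, and the one spare factor `n` is at most `m + n`.
Replacing `n + 1` by `2 * n` and `m + 1` by `2 * m` costs a constant. -/
theorem steps_le {k C m n : ℕ} (hC : 1 ≤ C) (hm : 0 < m) (hn : 0 < n) :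
    (k + 2) * (C + 2) * 6000 * ((m + 1) * (n + 1) ^ (C + 4)) ≤
      ((k + 2) * (C + 2) * 6000 * (2 * 2 ^ (C + 4))) * ((m + n) * m * n ^ (2 * (C + 1))) := by
  have h1 : (n + 1) ^ (C + 4) ≤ (2 * n) ^ (C + 4) := Nat.pow_le_pow_left (by omega) _
  have h2 : n ^ (C + 4) ≤ n ^ (2 * (C + 1) + 1) := Nat.pow_le_pow_right hn (by omega)
  calc (k + 2) * (C + 2) * 6000 * ((m + 1) * (n + 1) ^ (C + 4))
      ≤ (k + 2) * (C + 2) * 6000 * ((2 * m) * (2 ^ (C + 4) * n ^ (2 * (C + 1) + 1))) := by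
        rw [mul_pow] at h1
        gcongr
        · omega
        · exact h1.trans (Nat.mul_le_mul_left _ h2)
    _ = ((k + 2) * (C + 2) * 6000 * (2 * 2 ^ (C + 4))) * (n * m * n ^ (2 * (C + 1))) := by
        rw [pow_succ n]; ring
    _ ≤ _ := by gcongr; omega

theorem isApproxAlgorithm_mainCmd {k C : ℕ} (hk : 0 < k) (hC : (k : ℚ) ≤ (1 + 2 / k) ^ C)
    (hC1 : 1 ≤ C) :
    IsApproxAlgorithm (mainCmd k C) (1 + 4 / (k : ℝ) + 3 / (k : ℝ) ^ 2)
      (fun m n => ((k + 2) * (C + 2) * 6000 * (2 * 2 ^ (C + 4))) *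
        ((m + n) * m * n ^ (2 * (C + 1)))) := by
  intro m n E p h
  obtain ⟨i₀, -⟩ := h.executable ⟨0, h.jobs_pos⟩
  have hm : 0 < m := i₀.pos
  have : Nonempty (Fin m) := ⟨i₀⟩
  obtain ⟨t, s, he, ht, T, h1, h2, h3⟩ := runs_mainCmd (s := input E p) (inst_of_isInstance h) hk hC
    (by simp [input]) (by simp [input]) rfl (fun i hi j hj => natRel_iff_input hi hj)
    (fun a ha i => by simp [input, show a ≠ 0 by omega, show a ≠ 1 by omega]) (by simp [input])
  let a : Fin n → Fin m := fun j => ⟨s.idx 2 j, (h2 j j.2).1⟩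
  refine ⟨t, s, a, he, ht.trans (steps_le hC1 hm h.jobs_pos), fun j => rfl,
    fun j => (h2 j j.2).2.2.2, fun b hb => ?_⟩
  obtain ⟨M, hM, hMb⟩ := exists_achievable b hb h.time_pos
  have hk' : (0 : ℝ) < k := by exact_mod_cast hk
  have hT : (T : ℝ) ≤ (1 + 1 / k) * M := by
    simpa only [Rat.cast_mul, Rat.cast_add, Rat.cast_div, Rat.cast_one, Rat.cast_natCast]
      using (Rat.cast_le (K := ℝ)).2 (h1 M hM)
  refine ciSup_le fun i => ?_
  rw [load_eq (E := E) a (s.idx 2) (fun j => rfl) i]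
  have h4 : ((∑ j ∈ Finset.range n, if s.idx 2 j = i then (input E p).val 0 j else 0 : ℚ) : ℝ) ≤
      (1 + 3 / k) * T := by
    simpa only [Rat.cast_mul, Rat.cast_add, Rat.cast_div, Rat.cast_one, Rat.cast_natCast,
      Rat.cast_ofNat] using (Rat.cast_le (K := ℝ)).2 (h3 i)
  calc _ ≤ (1 + 3 / (k : ℝ)) * T := h4
    _ ≤ (1 + 3 / (k : ℝ)) * ((1 + 1 / k) * makespan p b) := by
        refine mul_le_mul_of_nonneg_left (hT.trans ?_) (by positivity)
        exact mul_le_mul_of_nonneg_left hMb (by positivity)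
    -- `(1 + 3 / k) * (1 + 1 / k) = 1 + 4 / k + 3 / k ^ 2`.
    _ = _ := by field_simp; ring

/-! ### The number of size classes -/

/-- The number of size classes of large jobs. -/
noncomputable def numClasses (k : ℕ) : ℕ := ⌈Real.log k / Real.log (1 + 2 / k)⌉₊

theorem log_ratio_pos {k : ℕ} (hk : 4 ≤ k) : 0 < Real.log (1 + 2 / (k : ℝ)) := by
  have : (0 : ℝ) < k := by exact_mod_cast (by omega : 0 < k)
  exact Real.log_pos (by linarith [show (0 : ℝ) < 2 / k by positivity])

theorem le_pow_numClasses {k : ℕ} (hk : 4 ≤ k) : (k : ℚ) ≤ (1 + 2 / k) ^ numClasses k := by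
  have hk' : (0 : ℝ) < k := by exact_mod_cast (by omega : 0 < k)
  have h1 : Real.log k / Real.log (1 + 2 / k) ≤ numClasses k := Nat.le_ceil _
  rw [div_le_iff₀ (log_ratio_pos hk), ← Real.log_pow] at h1
  have h2 := (Real.log_le_log_iff hk' (by positivity)).1 h1
  refine (Rat.cast_le (K := ℝ)).1 ?_
  simpa only [Rat.cast_pow, Rat.cast_add, Rat.cast_div, Rat.cast_one, Rat.cast_natCast,
    Rat.cast_ofNat] using h2

theorem one_le_numClasses {k : ℕ} (hk : 4 ≤ k) : 1 ≤ numClasses k := by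
  refine Nat.one_le_ceil_iff.2 (div_pos (Real.log_pos ?_) (log_ratio_pos hk))
  exact_mod_cast (by omega : 1 < k)

theorem numClasses_le_ceil {k : ℕ} (hk : 4 ≤ k) :
    numClasses k ≤ ⌈Real.log k / Real.log (1 + 1 / k)⌉₊ := by
  have hk' : (0 : ℝ) < k := by exact_mod_cast (by omega : 0 < k)
  have h1 : (0 : ℝ) < 1 / k := by positivity
  refine Nat.ceil_mono (div_le_div_of_nonneg_left (Real.log_natCast_nonneg k)
    (Real.log_pos (by linarith)) (Real.log_le_log (by linarith) ?_))
  gcongr; norm_num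

/-- With `y = k ^ 0.4` one has `log k ≤ y` and `log (1 + 2 / k) ≥ 2 / (k + 2)`. Hence the number of
classes is below `y * (k + 2) / 2 + 1`, which is at most `k * y` because `k ≥ 4` and `y ≥ 1`. -/
theorem numClasses_le_rpow {k : ℕ} (hk : 4 ≤ k) : (numClasses k : ℝ) ≤ (k : ℝ) ^ (1.4 : ℝ) := by
  have hk4 : (4 : ℝ) ≤ k := by exact_mod_cast hk
  have hk' : (0 : ℝ) < k := by linarith
  set y : ℝ := (k : ℝ) ^ (0.4 : ℝ) with hy
  have hy0 : 0 < y := by positivity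
  have hk14 : (k : ℝ) ^ (1.4 : ℝ) = k * y := by
    rw [show (1.4 : ℝ) = 1 + 0.4 by norm_num, Real.rpow_add hk', Real.rpow_one]
  have hlogy : Real.log k = 5 / 2 * Real.log y := by
    rw [hy, Real.log_rpow hk', show (0.4 : ℝ) = 2 / 5 by norm_num]; ring
  -- Holds since `1.7 ^ 5 < 16`, that is, `1.7 ^ 2.5 < 4 ≤ k`.
  have hy1 : 17 / 10 ≤ y := by
    have : (17 / 10 : ℝ) = ((17 / 10 : ℝ) ^ (2.5 : ℝ)) ^ (0.4 : ℝ) := by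
      rw [← Real.rpow_mul (by norm_num)]; norm_num
    rw [this, hy]
    refine Real.rpow_le_rpow (by positivity) (le_trans ?_ hk4) (by norm_num)
    have h5 : ((17 / 10 : ℝ) ^ (2.5 : ℝ)) ^ (2 : ℕ) ≤ 4 ^ 2 := by
      rw [← Real.rpow_natCast, ← Real.rpow_mul (by norm_num)]
      norm_num
    exact le_of_sq_le_sq h5 (by norm_num)
  -- From `log y ≤ y / e` and `e > 2.7`, using `log k = 2.5 * log y`.
  have hlog : Real.log k ≤ y := by
    have h1 := Real.add_one_le_exp (Real.log (y / Real.exp 1))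
    rw [Real.exp_log (by positivity), Real.log_div hy0.ne' (Real.exp_pos 1).ne',
      Real.log_exp] at h1
    have h2 : y / Real.exp 1 ≤ y / (27 / 10) := by
      gcongr
      linarith [Real.exp_one_gt_d9]
    have h3 : Real.log y ≤ y / (27 / 10) := by linarith
    rw [hlogy]
    linarith
  have hr : 2 / ((k : ℝ) + 2) ≤ Real.log (1 + 2 / k) := by
    have h1 := Real.one_sub_inv_le_log_of_pos (show (0 : ℝ) < 1 + 2 / k by positivity)
    refine le_trans (le_of_eq ?_) h1
    field_simp
    ring
  have h0 : 0 ≤ Real.log k / Real.log (1 + 2 / (k : ℝ)) :=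
    div_nonneg (Real.log_natCast_nonneg k) (log_ratio_pos hk).le
  have hceil : (numClasses k : ℝ) < Real.log k / Real.log (1 + 2 / k) + 1 := Nat.ceil_lt_add_one h0
  have hdiv : Real.log k / Real.log (1 + 2 / k) ≤ y / (2 / (k + 2)) := by
    gcongr
  have e : y / (2 / ((k : ℝ) + 2)) = y * (k + 2) / 2 := by field_simp
  rw [hk14]
  rw [e] at hdiv
  nlinarith

end ConvexMakespan

/-! ### The approximation algorithms and the PTAS -/

theorem theorem2 :
    (∀ k : ℕ, 4 ≤ k →
      ∃ C : ℕ, (C : ℝ) ≤ (k : ℝ) ^ (1.4 : ℝ) ∧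
        C ≤ ⌈Real.log k / Real.log (1 + 1 / k)⌉₊ ∧
        ∃ (P : RAM.Cmd) (K : ℕ),
          MinMax.IsApproxAlgorithm P (1 + 4 / (k : ℝ) + 3 / (k : ℝ) ^ 2)
            (fun m n => K * ((m + n) * m * n ^ (2 * (C + 1))))) ∧
    (∀ ε : ℝ, 0 < ε →
      ∃ (P : RAM.Cmd) (K d : ℕ),
        MinMax.IsApproxAlgorithm P (1 + ε) (fun m n => K * (m + n) ^ d)) := by
  have main : ∀ k : ℕ, 4 ≤ k → ∃ C : ℕ, (C : ℝ) ≤ (k : ℝ) ^ (1.4 : ℝ) ∧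
      C ≤ ⌈Real.log k / Real.log (1 + 1 / k)⌉₊ ∧
      ∃ (P : RAM.Cmd) (K : ℕ), MinMax.IsApproxAlgorithm P (1 + 4 / (k : ℝ) + 3 / (k : ℝ) ^ 2)
        (fun m n => K * ((m + n) * m * n ^ (2 * (C + 1)))) := fun k hk =>
    ⟨ConvexMakespan.numClasses k, ConvexMakespan.numClasses_le_rpow hk,
      ConvexMakespan.numClasses_le_ceil hk, _, _,
      ConvexMakespan.isApproxAlgorithm_mainCmd (by omega) (ConvexMakespan.le_pow_numClasses hk)
        (ConvexMakespan.one_le_numClasses hk)⟩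
  refine ⟨main, fun ε hε => ?_⟩
  -- For `k ≥ 1` the error `4 / k + 3 / k ^ 2` is at most `7 / k`.
  obtain ⟨k₀, hk₀⟩ := exists_nat_ge (7 / ε)
  set k := max 4 k₀ with hkdef
  obtain ⟨C, -, -, P, K, hP⟩ := main k (le_max_left _ _)
  refine ⟨P, K, 2 * (C + 1) + 2, fun m n E p h => ?_⟩
  obtain ⟨t, s, a, h1, h2, h3, h4, h5⟩ := hP m n E p h
  have hk4 : (4 : ℝ) ≤ k := by exact_mod_cast le_max_left 4 k₀
  have hk7 : 7 / ε ≤ k := hk₀.trans (by exact_mod_cast le_max_right 4 k₀)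
  have hε' : 4 / (k : ℝ) + 3 / (k : ℝ) ^ 2 ≤ ε := by
    have h6 : 3 / (k : ℝ) ^ 2 ≤ 3 / k := by
      gcongr
      nlinarith
    have h7 : 7 / (k : ℝ) ≤ ε := by
      rw [div_le_iff₀ hε] at hk7
      rw [div_le_iff₀ (by linarith)]
      linarith
    have h8 : 4 / (k : ℝ) + 3 / k = 7 / k := by ring
    linarith
  refine ⟨t, s, a, h1, h2.trans ?_, h3, h4, fun b hb => (h5 b hb).trans ?_⟩
  · refine Nat.mul_le_mul_left _ ?_
    calc (m + n) * m * n ^ (2 * (C + 1))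
        ≤ (m + n) * (m + n) * (m + n) ^ (2 * (C + 1)) := by gcongr <;> omega
      _ = (m + n) ^ (2 * (C + 1) + 2) := by ring
  · refine mul_le_mul_of_nonneg_right (by linarith) ?_
    exact Real.iSup_nonneg fun i => Finset.sum_nonneg fun j _ => by
      exact_mod_cast (h.time_pos j).le
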